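/- Setting. Let $(Y_i)_{i\ge1}$ be independent symmetric real random variables, put $U_i(x)=-\log \mathsf P(|Y_i|\ge x)$ for $x\ge 0$, and assume that every $U_i$ is convex on $[0,\infty)$ with $U_i(1)=1$. For a constant $C_0$ assume (1) $U_i(2s)\le C_0U_i(s)$ for all $i\ge1$ and $s\ge1$; (2) $U_i'(0)\ge 1/C_0$ for all $i\ge 1$, where $U_i'(0)$ is the right derivative at $0$. For $t\in\ell^2$ let $X_t=\sum_{i\ge1}t_iY_i$ (almost sure limit of the partial sums), and for $T\subset\ell^2$ let $\mathsf E\sup_{t\in T}X_t=\sup\{\mathsf E\max_{t\in F}X_t: F\subset T \text{ finite, nonempty}\}\in[0,\infty]$ (with value $0$ if $T=\emptyset$). Distances. Put $\hat U_i(x)=x^2$ for $|x|\le1$, $\hat U_i(x)=2U_i(|x|)-1$ for $|x|\ge1$, $\mathcal N_u(t)=\sup\{\sum_i t_ia_i:\sum_i\hat U_i(a_i)\le u\}$ and $B(u)=\{t\in\ell^2:\mathcal N_u(t)\le u\}$. For $r>0$ and $j\in\mathbb Z$ let $\varphi_j(s,t)=\inf\{u>0: s-t\in r^{-j}B(u)\}\in[0,\infty]$,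 $\bar\varphi_j(s,t)=\varphi_j(s/4,t/4)$, $B_j(s,c)=\{t\in\ell^2:\varphi_j(s,t)\le c\}$ and $B_j(c)=B_j(0,c)$. Let $N_n=2^{2^n}$ for all $n\ge0$, and let $\tilde j_0$ be the supremum of all $j\in\mathbb Z$ with $\bar\varphi_j(s,t)\le1$ for all $s,t\in T$. Iterative organized trees. Such a tree $\Gamma$ of $T$ has the largest element $T$ and generations $\mathcal B_0,\mathcal B_1,\dots$ of subsets $A$ of $T$ carrying parameters $\mathbf n(A)\in\mathbb N$ and $\mathbf j(A)\in\mathbb Z\cup\{\infty\}$. The set $c(A)$ of children of an element $A$ is obtained as follows. If $A=T$, choose any integer $n\ge0$; if $A\in\mathcal B_k$ and $\mathbf j(A)<\infty$, choose any integer $n>\mathbf n(A)$; if $\mathbf j(A)=\infty$, there are no children. * If $|A|<N_n$, the children of $A$ are the singletons $\{a\}$, $a\in A$, with $\mathbf n(\{a\})=n$ and $\mathbf j(\{a\})=\infty$. * If $|A|\ge N_n$, choose any $N_n$ distinct points of $A$. For each chosen point $t$ let $\mathbf j(t)$ be the least integer $j$ such that $\bar\varphi_j(t,t')>2^n$ for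 all other chosen points $t'$, and such that moreover $j\ge\tilde j_0$ if $A=T$, respectively $B_j(2^n)\subset B_{\mathbf j(A)}(2^{\mathbf n(A)})$ if $A\in\mathcal B_k$. The children of $A$ are the sets $A_t=A\cap B_{\mathbf j(t)}(t,2^n)$, with $\mathbf n(A_t)=n$ and $\mathbf j(A_t)=\mathbf j(t)$. Here $\mathcal B_0=c(T)$ and $\mathcal B_{k+1}=\bigcup_{A\in\mathcal B_k}c(A)$; $p(A)$ denotes the parent of $A$. (An element of the tree is a set together with its parameters and its place in the tree.) Let $S_\Gamma$ be the set of $t\in T$ such that $\{t\}$ belongs to $\bigcup_{i\ge0}\mathcal B_i$ or $t$ lies in infinitely many elements of $\Gamma$. Put $$\rho(\Gamma)=\inf_{t\in S_\Gamma}\ \sum_{t\in A,\ A\in\bigcup_{i\ge0}\mathcal B_i}\log\bigl(|c(p(A))|\bigr)\,r^{-\mathbf j(A)},\qquad r^{-\infty}=0,$$ and let $\mathrm{Size}(T)\in[0,\infty]$ be the supremum of $\rho(\Gamma)$ over all iterative organized trees $\Gamma$ of $T$ with $S_\Gamma\ne\emptyset$ (with value $0$ if there are none). Theorem. There are a threshold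 $r_0(C_0)$ depending only on $C_0$ and a constant $K(r)$ depending only on $r$ such that, for all $(Y_i)_{i\ge 1}$ as above satisfying (1) and (2), every real $r\ge r_0(C_0)$ and every $T\subset\ell^2$, $$\mathsf E\sup_{t\in T}X_t\ \le\ K(r)\,\mathrm{Size}(T).$$ -/

import Mathlib

open MeasureTheory ProbabilityTheory Filter Topology
open scoped ENNReal NNReal Pointwise

namespace CanonicalProcess

noncomputable section

/-- The real sequence space `ℓ²`. -/
abbrev Ell2 : Type := lp (fun _ : ℕ => ℝ) 2

/-- `U_i(x) = -log P(|Y_i| ≥ x)`.  (The value at a point of probability zero is never relevant: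
a convex `U_i` on `[0, ∞)` with `U_i(0) = 0`, `U_i(1) = 1` satisfies `U_i(x) ≥ x` for `x ≥ 1`.) -/
def tailFun {Ω : Type*} [MeasurableSpace Ω] (μ : Measure Ω) (Y : ℕ → Ω → ℝ) (i : ℕ) (x : ℝ) : ℝ :=
  -Real.log (μ.real {ω | x ≤ |Y i ω|})

/-- `X_t = ∑ t_i Y_i`, the limit of the partial sums (the series converges almost surely, but in
general not absolutely). -/
def process {Ω : Type*} (Y : ℕ → Ω → ℝ) (t : Ell2) (ω : Ω) : ℝ :=
  limUnder atTop (fun m : ℕ => ∑ i ∈ Finset.range m, t i * Y i ω)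

/-- `E sup_{t ∈ T} X_t`, defined as the supremum over finite nonempty `F ⊆ T` of
`E max_{t ∈ F} X_t` (each of these is nonnegative for a centred process). -/
def expSup {Ω : Type*} [MeasurableSpace Ω] (μ : Measure Ω) (X : Ell2 → Ω → ℝ) (T : Set Ell2) :
    ℝ≥0∞ :=
  ⨆ (F : Finset Ell2) (hF : F.Nonempty) (_ : (F : Set Ell2) ⊆ T),
    ENNReal.ofReal (∫ ω, F.sup' hF (fun t => X t ω) ∂μ)

/-- `Û(x) = x²` for `|x| ≤ 1` and `Û(x) = 2 U(|x|) - 1` for `|x| ≥ 1`. -/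
def hatU (V : ℝ → ℝ) (x : ℝ) : ℝ :=
  if |x| ≤ 1 then x ^ 2 else 2 * V |x| - 1

/-- `𝒩_u(t) = sup {∑ t_i a_i : ∑ Û_i(a_i) ≤ u}`. -/
def normN (U : ℕ → ℝ → ℝ) (u : ℝ) (t : Ell2) : ℝ :=
  sSup {x | ∃ a : ℕ → ℝ, Summable (fun i => hatU (U i) (a i)) ∧
    ∑' i, hatU (U i) (a i) ≤ u ∧ x = ∑' i, t i * a i}

/-- `B(u) = {t : 𝒩_u(t) ≤ u}`. -/
def setB (U : ℕ → ℝ → ℝ) (u : ℝ) : Set Ell2 :=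
  {t | normN U u t ≤ u}

/-- `φ_j(s, t) = inf {u > 0 : s - t ∈ r^{-j} B(u)}`, with value `∞` if there is no such `u`. -/
def phi (U : ℕ → ℝ → ℝ) (r : ℝ) (j : ℤ) (s t : Ell2) : ℝ≥0∞ :=
  ⨅ (u : ℝ) (_ : 0 < u ∧ s - t ∈ (r ^ (-j)) • setB U u), ENNReal.ofReal u

/-- `φ̄_j(s, t) = φ_j(s/4, t/4)`. -/
def phiBar (U : ℕ → ℝ → ℝ) (r : ℝ) (j : ℤ) (s t : Ell2) : ℝ≥0∞ :=
  phi U r j ((1 / 4 : ℝ) • s) ((1 / 4 : ℝ) • t)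

/-- `B_j(s, c) = {t : φ_j(s, t) ≤ c}`, as a subset of `ℓ²`. -/
def ballB (U : ℕ → ℝ → ℝ) (r : ℝ) (j : ℤ) (s : Ell2) (c : ℝ≥0∞) : Set Ell2 :=
  {t | phi U r j s t ≤ c}

/-- `N_n = 2^{2^n}`. -/
def bigN (n : ℕ) : ℕ := 2 ^ 2 ^ n

/-- An element `A` of a tree other than the largest one, together with `𝐧(A)` and `𝐣(A)`. -/
structure Node where
  /-- the set `A` -/
  carrier : Set Ell2
  /-- the parameter `𝐧(A)` -/
  n : ℕ
  /-- the parameter `𝐣(A)` in `ℤ ∪ {∞}` -/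
  j : WithTop ℤ

/-- `C` is a family of children of `A` with parameter `n`, where `adm` is the additional
requirement on the integers `j`.

If `|A| < N_n`, the children are the singletons of `A`, with `𝐣 = ∞`.
Otherwise one selects `N_n` points of `A`; for a selected point `t`, `𝐣(t)` is the least integer
`j` satisfying `adm` with `φ̄_j(t, t') > 2^n` for all the other selected points `t'`, and the
children are the sets `A_t = A ∩ B_{𝐣(t)}(t, 2^n)`, with `𝐣(A_t) = 𝐣(t)`. -/
def IsOffspring (U : ℕ → ℝ → ℝ) (r : ℝ) (A : Set Ell2) (adm : ℤ → Prop) (n : ℕ)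
    (C : Set Node) : Prop :=
  (A.encard < bigN n ∧ C = {D | ∃ a ∈ A, D = ⟨{a}, n, ⊤⟩}) ∨
  (∃ P : Finset Ell2, (P : Set Ell2) ⊆ A ∧ P.card = bigN n ∧ ∃ jj : Ell2 → ℤ,
    (∀ t ∈ P, IsLeast {j : ℤ | (∀ t' ∈ P, t' ≠ t → (2 : ℝ≥0∞) ^ n < phiBar U r j t t') ∧ adm j}
      (jj t)) ∧
    C = {D | ∃ t ∈ P, D = ⟨A ∩ ballB U r (jj t) t (2 ^ n), n, (jj t : WithTop ℤ)⟩})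

/-- The generations `𝓑_0, 𝓑_1, …` generated by a child map `c`; `c none` is the set of children of
the largest element. -/
def generation (c : Option Node → Set Node) : ℕ → Set Node
  | 0 => c none
  | k + 1 => ⋃ A ∈ generation c k, c (some A)

/-- An iterative organized tree of `T`.  Its largest element is `T` (written `none`). -/
structure IterativeOrganizedTree (U : ℕ → ℝ → ℝ) (r : ℝ) (T : Set Ell2) where
  /-- the children of an element of the tree -/
  c : Option Node → Set Node
  /-- the first generation: a number `n₀ ≥ 0` is chosen, and `𝐣(t) ≥ j̃₀`, where `j̃₀` is the
  largest `i` with `φ̄_i ≤ 1` on `T × T` -/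
  root : ∃ n₀ : ℕ, IsOffspring U r T
    (fun j => ∀ i : ℤ, (∀ s ∈ T, ∀ t ∈ T, phiBar U r i s t ≤ 1) → i ≤ j) n₀ (c none)
  /-- the singletons with `𝐣 = ∞` have no descendants -/
  leaf : ∀ k, ∀ A ∈ generation c k, A.j = ⊤ → c (some A) = ∅
  /-- the later generations: for each `A` a number `n > 𝐧(A)` is chosen, and
  `B_{𝐣(t)}(2^n) ⊆ B_{𝐣(A)}(2^{𝐧(A)})` -/
  step : ∀ k, ∀ A ∈ generation c k, ∀ jA : ℤ, A.j = (jA : WithTop ℤ) →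
    ∃ n : ℕ, A.n < n ∧ IsOffspring U r A.carrier
      (fun j => ballB U r j 0 (2 ^ n) ⊆ ballB U r jA 0 (2 ^ A.n)) n (c (some A))

/-- `r^{-j}`, with `r^{-∞} = 0`. -/
def scale (r : ℝ) : WithTop ℤ → ℝ≥0∞
  | ⊤ => 0
  | (j : ℤ) => ENNReal.ofReal (r ^ (-j))

namespace IterativeOrganizedTree

variable {U : ℕ → ℝ → ℝ} {r : ℝ} {T : Set Ell2}

/-- The elements of `⋃_{i ≥ 0} 𝓑_i`. -/
def nodes (Γ : IterativeOrganizedTree U r T) : Set Node := ⋃ k, generation Γ.c k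

/-- All elements of the tree, including the largest one. -/
def vertices (Γ : IterativeOrganizedTree U r T) : Set (Option Node) :=
  insert none (some '' Γ.nodes)

/-- The set `S_Γ` of all `t ∈ T` such that `{t}` is an element of `⋃_{i ≥ 0} 𝓑_i`, or `t` belongs
to infinitely many elements of the tree. -/
def points (Γ : IterativeOrganizedTree U r T) : Set Ell2 :=
  {t ∈ T | (∃ A ∈ Γ.nodes, A.carrier = {t}) ∨ {A ∈ Γ.nodes | t ∈ A.carrier}.Infinite}

open Classical in
/-- `∑_{t ∈ A, A ∈ ⋃_{i ≥ 0} 𝓑_i} log |c(p(A))| r^{-𝐣(A)}`; the elements `A` are listed by their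
parents `D = p(A)`. -/
def pathSum (Γ : IterativeOrganizedTree U r T) (t : Ell2) : ℝ≥0∞ :=
  ∑' D : Γ.vertices, ∑' A : Γ.c D,
    if t ∈ A.1.carrier then ENNReal.ofReal (Real.log (Γ.c D).ncard) * scale r A.1.j else 0

/-- `ρ(Γ)`, the infimum over `t ∈ S_Γ` of the above sums. -/
def rho (Γ : IterativeOrganizedTree U r T) : ℝ≥0∞ := ⨅ t ∈ Γ.points, Γ.pathSum t

end IterativeOrganizedTree

/-- `Size(T)`, the supremum of `ρ(Γ)` over the iterative organized trees `Γ` of `T`.  Trees with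
`S_Γ = ∅`, for which `ρ(Γ)` would be an infimum over the empty set, are left out. -/
def size (U : ℕ → ℝ → ℝ) (r : ℝ) (T : Set Ell2) : ℝ≥0∞ :=
  ⨆ (Γ : IterativeOrganizedTree U r T) (_ : Γ.points.Nonempty), Γ.rho

end

end CanonicalProcess

/-! Between the two sides of the inequality stands a combinatorial quantity: the largest value of a
finite tree of separated families of points. A step with N_n points separated at scale j adds the
weight 2^n r^{-j}, and the value is bounded by the sum along every branch. Apart from the tail
estimate, only the norms N_n = 𝒩_{2^n} matter. They at most double from n to n+1, and the doubling
of the U_i makes them grow geometrically in n (`IsScaleNorm`).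

Trees against Size. Fix a finite F in T and let V(A) be the supremum of the values of nested trees
with points in A ∩ F. Since F has finitely many subsets, some family satisfies V(A) ≤ 2^n r^{-j(t)}
+ V(A_t) at all of its points t at once (`exists_optimal_step`). Making this choice at every node
gives an iterative organized tree. Along a branch through a point of S_Γ, V drops to 0, at a
singleton or as soon as n ≥ |F|, so the sum in ρ(Γ) is at least V/2 (`treeValue_le_size`). When V is
already 0 the chosen families keep a fixed first point, which makes S_Γ nonempty. The inclusion of
balls required of nested trees costs only a constant: a step violating it has a weight geometrically
smaller than a later one and can be deleted (`Tree.exists_nested`).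

The process against trees. This is Talagrand's partitioning scheme with the value of free trees as
functional. A set is split into fewer than N_{n+1} pieces of finer scale and a remainder of the same
scale, where the functional of small balls has dropped by a multiple of the current weight
(`exists_split`). Along the resulting nested sets the weights are dominated by their local peaks. A
peak can only follow a passage to a remainder, so the drops of the functional pay for all peaks
(`sum_weights_le`).

Probability. The exponential moments of Y_i are bounded through the conjugate of Û_i, which gives
P(|X_v| > 64 𝒩_w(v)) ≤ 2e^{-w} (`IsCanonical.measure_process_gt`). A union bound over the
splittings, with a factor N_{n+1} at level n, then bounds the expected maximum by the largest sum of
weights along a trajectory (`IsCanonical.integral_sup_le`). -/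

namespace CanonicalProcess

/-! ### The functions `Û` and the norms `𝒩_u` -/

/-- Convex functions `U_i` on `[0, ∞)` with `U_i(0) = 0`, `U_i(1) = 1` and `U_i(2s) ≤ C U_i(s)`
for `s ≥ 1`. -/
structure IsYoungFamily (U : ℕ → ℝ → ℝ) (C : ℝ) : Prop where
  convex : ∀ i, ConvexOn ℝ (Set.Ici 0) (U i)
  zero : ∀ i, U i 0 = 0
  one : ∀ i, U i 1 = 1
  doubling : ∀ i, ∀ s : ℝ, 1 ≤ s → U i (2 * s) ≤ C * U i s

lemma summable_sq (t : Ell2) : Summable (fun i => t i ^ 2) := by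
  have h := (lp.memℓp t).summable (by norm_num)
  simpa using h

lemma hatU_neg (V : ℝ → ℝ) (x : ℝ) : hatU V (-x) = hatU V x := by
  simp [hatU]

lemma hatU_of_abs_le {V : ℝ → ℝ} {x : ℝ} (hx : |x| ≤ 1) : hatU V x = x ^ 2 := if_pos hx

lemma hatU_of_one_lt {V : ℝ → ℝ} {x : ℝ} (hx : 1 < |x|) : hatU V x = 2 * V |x| - 1 :=
  if_neg (not_le.2 hx)

lemma hatU_zero (V : ℝ → ℝ) : hatU V 0 = 0 := by simp [hatU]

namespace IsYoungFamily

variable {U : ℕ → ℝ → ℝ} {C : ℝ} (hU : IsYoungFamily U C)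
include hU

lemma mul_le (i : ℕ) {c x : ℝ} (hc : 0 ≤ c) (hc1 : c ≤ 1) (hx : 0 ≤ x) :
    U i (c * x) ≤ c * U i x := by
  have h := (hU.convex i).2 (x := x) (y := 0) hx (by simp) hc (sub_nonneg.2 hc1) (by ring)
  simpa [hU.zero i] using h

lemma self_le (i : ℕ) {x : ℝ} (hx : 1 ≤ x) : x ≤ U i x := by
  have hx0 : 0 < x := by linarith
  have h := hU.mul_le i (c := x⁻¹) (x := x) (by positivity) (inv_le_one_of_one_le₀ hx) hx0.le
  rw [inv_mul_cancel₀ hx0.ne', hU.one, inv_mul_eq_div, le_div_iff₀ hx0] at h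
  linarith

lemma two_le : 2 ≤ C := by
  have h1 := hU.doubling 0 1 le_rfl
  have h2 := hU.self_le 0 (x := 2) (by norm_num)
  rw [hU.one] at h1
  norm_num at h1
  linarith

lemma abs_le_hatU (i : ℕ) {x : ℝ} (hx : 1 ≤ |x|) : |x| ≤ hatU (U i) x := by
  rcases eq_or_lt_of_le hx with h | h
  · rw [hatU_of_abs_le h.ge, ← sq_abs, ← h]; norm_num
  · rw [hatU_of_one_lt h]
    have := hU.self_le i hx
    linarith

lemma hatU_nonneg (i : ℕ) (x : ℝ) : 0 ≤ hatU (U i) x := by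
  rcases le_total |x| 1 with h | h
  · rw [hatU_of_abs_le h]; positivity
  · exact (abs_nonneg x).trans (hU.abs_le_hatU i h)

/-- The only form of convexity of Û that the norms need. If x is beyond 1 and cx is not, then (cx)²
≤ c|x| ≤ cÛ(x). -/
lemma hatU_mul_le (i : ℕ) {c : ℝ} (hc : 0 ≤ c) (hc1 : c ≤ 1) (x : ℝ) :
    hatU (U i) (c * x) ≤ c * hatU (U i) x := by
  have hcx : |c * x| = c * |x| := by rw [abs_mul, abs_of_nonneg hc]
  rcases le_or_gt |x| 1 with h | h
  · have h' : |c * x| ≤ 1 := by rw [hcx]; exact mul_le_one₀ hc1 (abs_nonneg _) h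
    rw [hatU_of_abs_le h, hatU_of_abs_le h', mul_pow]
    have : c ^ 2 ≤ c := by nlinarith
    exact mul_le_mul_of_nonneg_right this (sq_nonneg x)
  · rcases le_or_gt |c * x| 1 with h' | h'
    · have h2 := mul_le_mul_of_nonneg_left (hU.abs_le_hatU i h.le) hc
      rw [hatU_of_abs_le h', ← sq_abs]
      rw [← hcx] at h2
      nlinarith [abs_nonneg (c * x)]
    · rw [hatU_of_one_lt h, hatU_of_one_lt h', hcx]
      have := hU.mul_le i hc hc1 (abs_nonneg x)
      linarith

lemma monotone_U (i : ℕ) {x y : ℝ} (hx : 0 ≤ x) (hxy : x ≤ y) (hy : 0 ≤ U i y) :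
    U i x ≤ U i y := by
  rcases eq_or_lt_of_le (hx.trans hxy) with h | h
  · have : x = y := le_antisymm hxy (by linarith)
    rw [this]
  · have h1 := hU.mul_le i (c := x / y) (x := y) (by positivity) (by rw [div_le_one h]; exact hxy) h.le
    rw [div_mul_cancel₀ _ h.ne'] at h1
    refine h1.trans (mul_le_of_le_one_left hy ?_)
    rw [div_le_one h]; exact hxy

/-- The factor 8 is needed when |x| ≤ 1 < |2x|: there x² ≥ 1/4, while Û(2x) ≤ 2U(2) - 1 ≤ 2C. -/
lemma hatU_two_mul_le (i : ℕ) (x : ℝ) : hatU (U i) (2 * x) ≤ 8 * C * hatU (U i) x := by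
  have hC := hU.two_le
  have hx2 : |2 * x| = 2 * |x| := by rw [abs_mul]; norm_num
  rcases le_or_gt |x| 1 with h | h
  · rcases le_or_gt |2 * x| 1 with h' | h'
    · rw [hatU_of_abs_le h, hatU_of_abs_le h']
      nlinarith [sq_nonneg x]
    · rw [hatU_of_abs_le h, hatU_of_one_lt h', hx2]
      have h1 := hU.doubling i 1 le_rfl
      rw [hU.one] at h1
      have h3 : U i (2 * |x|) ≤ U i (2 * 1) := by
        apply hU.monotone_U i (by positivity) (by linarith)
        have := hU.self_le i (x := 2 * 1) (by norm_num)
        linarith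
      rw [hx2] at h'
      have h4 : 1 / 4 ≤ x ^ 2 := by rw [← sq_abs]; nlinarith
      nlinarith
  · have h' : 1 < |2 * x| := by rw [hx2]; linarith
    rw [hatU_of_one_lt h, hatU_of_one_lt h', hx2]
    have h1 := hU.doubling i |x| h.le
    have h2 := hU.self_le i h.le
    nlinarith

end IsYoungFamily

/-- The sequences `a` with `∑ Û_i(a_i) ≤ u`. -/
def admissible (U : ℕ → ℝ → ℝ) (u : ℝ) : Set (ℕ → ℝ) :=
  {a | Summable (fun i => hatU (U i) (a i)) ∧ ∑' i, hatU (U i) (a i) ≤ u}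

lemma normN_eq (U : ℕ → ℝ → ℝ) (u : ℝ) (t : Ell2) :
    normN U u t = sSup ((fun a : ℕ → ℝ => ∑' i, t i * a i) '' admissible U u) := by
  unfold normN admissible
  congr 1
  ext x
  constructor
  · rintro ⟨a, h1, h2, h3⟩
    exact ⟨a, ⟨h1, h2⟩, h3.symm⟩
  · rintro ⟨a, ⟨h1, h2⟩, h3⟩
    exact ⟨a, h1, h2, h3.symm⟩

lemma zero_mem_admissible (U : ℕ → ℝ → ℝ) {u : ℝ} (hu : 0 ≤ u) :
    (fun _ => 0) ∈ admissible U u := by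
  simp [admissible, hatU_zero, hu]

lemma neg_mem_admissible {U : ℕ → ℝ → ℝ} {u : ℝ} {a : ℕ → ℝ} (ha : a ∈ admissible U u) :
    (fun i => - a i) ∈ admissible U u := by
  simpa [admissible, hatU_neg] using ha

namespace IsYoungFamily

variable {U : ℕ → ℝ → ℝ} {C : ℝ} (hU : IsYoungFamily U C)
include hU

/-- If |a_i| ≥ 1 then |a_i| ≤ Û(a_i) ≤ u. Hence admissible sequences lie in ℓ², the pairings with t
converge, and the supremum defining the norm is over a bounded set. -/
lemma sq_le_of_admissible {u : ℝ} {a : ℕ → ℝ} (ha : a ∈ admissible U u) (i : ℕ) :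
    a i ^ 2 ≤ max 1 u * hatU (U i) (a i) := by
  have h0 := hU.hatU_nonneg i (a i)
  rcases le_total |a i| 1 with h | h
  · rw [← hatU_of_abs_le (V := U i) h]
    exact le_mul_of_one_le_left h0 (le_max_left _ _)
  · have h1 := hU.abs_le_hatU i h
    have h2 : hatU (U i) (a i) ≤ u :=
      (ha.1.le_tsum i (fun j _ => hU.hatU_nonneg j (a j))).trans ha.2
    rw [← sq_abs, sq]
    exact mul_le_mul ((h1.trans h2).trans (le_max_right _ _)) h1 (abs_nonneg _) (by positivity)

lemma summable_sq_of_admissible {u : ℝ} {a : ℕ → ℝ} (ha : a ∈ admissible U u) :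
    Summable (fun i => a i ^ 2) :=
  Summable.of_nonneg_of_le (fun _ => sq_nonneg _) (hU.sq_le_of_admissible ha) (ha.1.mul_left _)

lemma summable_mul {u : ℝ} {a : ℕ → ℝ} (ha : a ∈ admissible U u) (t : Ell2) :
    Summable (fun i => t i * a i) := by
  refine Summable.of_norm_bounded ((summable_sq t).add (hU.summable_sq_of_admissible ha)) ?_
  intro i
  rw [Real.norm_eq_abs, abs_le]
  constructor <;> nlinarith [sq_nonneg (t i + a i), sq_nonneg (t i - a i), sq_nonneg (t i), sq_nonneg (a i)]

lemma bddAbove (u : ℝ) (t : Ell2) :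
    BddAbove ((fun a : ℕ → ℝ => ∑' i, t i * a i) '' admissible U u) := by
  refine ⟨∑' i, t i ^ 2 + max 1 u * u, ?_⟩
  rintro _ ⟨a, ha, rfl⟩
  have h1 : ∑' i, t i * a i ≤ ∑' i, (t i ^ 2 + max 1 u * hatU (U i) (a i)) := by
    refine Summable.tsum_le_tsum ?_ (hU.summable_mul ha t) ((summable_sq t).add (ha.1.mul_left _))
    intro i
    have := hU.sq_le_of_admissible ha i
    nlinarith [sq_nonneg (t i - a i), sq_nonneg (t i), sq_nonneg (a i)]
  refine h1.trans ?_
  rw [(summable_sq t).tsum_add (ha.1.mul_left _), tsum_mul_left]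
  have := mul_le_mul_of_nonneg_left ha.2 (le_trans zero_le_one (le_max_left 1 u))
  linarith

lemma le_normN {u : ℝ} {a : ℕ → ℝ} (ha : a ∈ admissible U u) (t : Ell2) :
    ∑' i, t i * a i ≤ normN U u t := by
  rw [normN_eq]
  exact le_csSup (hU.bddAbove u t) ⟨a, ha, rfl⟩

omit hU in
lemma normN_le {u b : ℝ} (hu : 0 ≤ u) {t : Ell2}
    (h : ∀ a ∈ admissible U u, ∑' i, t i * a i ≤ b) : normN U u t ≤ b := by
  rw [normN_eq]
  refine csSup_le ⟨_, _, zero_mem_admissible U hu, rfl⟩ ?_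
  rintro _ ⟨a, ha, rfl⟩
  exact h a ha

lemma normN_nonneg {u : ℝ} (hu : 0 ≤ u) (t : Ell2) : 0 ≤ normN U u t := by
  simpa using hU.le_normN (zero_mem_admissible U hu) t

lemma normN_mono {u v : ℝ} (hu : 0 ≤ u) (huv : u ≤ v) (t : Ell2) :
    normN U u t ≤ normN U v t :=
  normN_le hu fun _ ha => hU.le_normN ⟨ha.1, ha.2.trans huv⟩ t

/-- Dividing a by c divides ∑ Û(a_i) by at least c. -/
lemma normN_mul_le {c u : ℝ} (hc : 1 ≤ c) (hu : 0 ≤ u) (t : Ell2) :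
    normN U (c * u) t ≤ c * normN U u t := by
  have hc0 : 0 < c := by linarith
  refine normN_le (by positivity) fun a ha => ?_
  have hle : ∀ i, hatU (U i) (c⁻¹ * a i) ≤ c⁻¹ * hatU (U i) (a i) := fun i =>
    hU.hatU_mul_le i (by positivity) (inv_le_one_of_one_le₀ hc) _
  have hs := Summable.of_nonneg_of_le (fun i => hU.hatU_nonneg i _) hle (ha.1.mul_left c⁻¹)
  have hmem : (fun i => c⁻¹ * a i) ∈ admissible U u := by
    refine ⟨hs, (hs.tsum_le_tsum hle (ha.1.mul_left c⁻¹)).trans ?_⟩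
    rw [tsum_mul_left, inv_mul_le_iff₀ hc0]
    exact ha.2
  have h := hU.le_normN hmem t
  have h2 : ∑' i, t i * (c⁻¹ * a i) = c⁻¹ * ∑' i, t i * a i := by
    rw [← tsum_mul_left]; congr 1; ext i; ring
  rw [h2, inv_mul_le_iff₀ hc0] at h
  exact h

/-- Doubling a multiplies ∑ Û(a_i) by at most 8C. This is the source of the growth of the norms. -/
lemma two_mul_normN_le {u : ℝ} (hu : 0 ≤ u) (t : Ell2) :
    2 * normN U u t ≤ normN U (8 * C * u) t := by
  have hC := hU.two_le
  rw [mul_comm, ← le_div_iff₀ (by norm_num)]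
  refine normN_le hu fun a ha => ?_
  rw [le_div_iff₀ (by norm_num)]
  have hle : ∀ i, hatU (U i) (2 * a i) ≤ 8 * C * hatU (U i) (a i) := fun i =>
    hU.hatU_two_mul_le i _
  have hs := Summable.of_nonneg_of_le (fun i => hU.hatU_nonneg i _) hle (ha.1.mul_left (8 * C))
  have hmem : (fun i => 2 * a i) ∈ admissible U (8 * C * u) := by
    refine ⟨hs, (hs.tsum_le_tsum hle (ha.1.mul_left (8 * C))).trans ?_⟩
    rw [tsum_mul_left]
    exact mul_le_mul_of_nonneg_left ha.2 (by linarith)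
  have h := hU.le_normN hmem t
  have h2 : ∑' i, t i * (2 * a i) = (∑' i, t i * a i) * 2 := by
    rw [← tsum_mul_right]; congr 1; ext i; ring
  rwa [h2] at h

lemma normN_add_le {u : ℝ} (hu : 0 ≤ u) (s t : Ell2) :
    normN U u (s + t) ≤ normN U u s + normN U u t := by
  refine normN_le hu fun a ha => ?_
  have h : ∑' i, (s + t) i * a i = ∑' i, s i * a i + ∑' i, t i * a i := by
    rw [← (hU.summable_mul ha s).tsum_add (hU.summable_mul ha t)]
    congr 1; ext i; simp [add_mul]
  rw [h]
  exact add_le_add (hU.le_normN ha s) (hU.le_normN ha t)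

lemma normN_neg {u : ℝ} (hu : 0 ≤ u) (t : Ell2) : normN U u (-t) = normN U u t := by
  have key : ∀ t : Ell2, normN U u (-t) ≤ normN U u t := by
    intro t
    refine normN_le hu fun a ha => ?_
    have h := hU.le_normN (neg_mem_admissible ha) t
    simpa using h
  refine le_antisymm (key t) ?_
  simpa using key (-t)

lemma normN_smul {u : ℝ} (hu : 0 ≤ u) {c : ℝ} (hc : 0 < c) (t : Ell2) :
    normN U u (c • t) = c * normN U u t := by
  have key : ∀ (c : ℝ), 0 < c → ∀ t : Ell2, normN U u (c • t) ≤ c * normN U u t := by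
    intro c hc t
    refine normN_le hu fun a ha => ?_
    have h := mul_le_mul_of_nonneg_left (hU.le_normN ha t) hc.le
    rw [← tsum_mul_left] at h
    simpa [mul_assoc] using h
  refine le_antisymm (key c hc t) ?_
  have h := key c⁻¹ (by positivity) (c • t)
  rw [smul_smul, inv_mul_cancel₀ hc.ne', one_smul, le_inv_mul_iff₀ hc] at h
  exact h

lemma sum_le_normN {u : ℝ} (m : ℕ) (a : ℕ → ℝ)
    (ha : ∑ i ∈ Finset.range m, hatU (U i) (a i) ≤ u) (t : Ell2) :
    ∑ i ∈ Finset.range m, t i * a i ≤ normN U u t := by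
  classical
  set b : ℕ → ℝ := fun i => if i ∈ Finset.range m then a i else 0 with hb
  have h0 : ∀ i ∉ Finset.range m, hatU (U i) (b i) = 0 := by
    intro i hi; simp only [hb, if_neg hi, hatU_zero]
  have hsum : ∑' i, hatU (U i) (b i) = ∑ i ∈ Finset.range m, hatU (U i) (a i) := by
    rw [tsum_eq_sum h0]
    exact Finset.sum_congr rfl fun i hi => by simp only [hb, if_pos hi]
  have hmem : b ∈ admissible U u :=
    ⟨summable_of_ne_finset_zero h0, hsum.trans_le ha⟩
  have h := hU.le_normN hmem t
  rw [tsum_eq_sum (s := Finset.range m)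
    (fun i hi => by simp only [hb, if_neg hi, mul_zero])] at h
  rwa [Finset.sum_congr rfl (g := fun i => t i * a i)
    (fun i hi => by simp only [hb, if_pos hi])] at h

lemma normN_pos {u : ℝ} (hu : 0 < u) {t : Ell2} (ht : t ≠ 0) : 0 < normN U u t := by
  obtain ⟨i, hi⟩ : ∃ i, t i ≠ 0 := by
    by_contra! h
    exact ht (by ext i; simpa using h i)
  -- The bound e ≤ 1 keeps Û quadratic at the test point, and e² ≤ e ≤ u makes the test sequence
  -- admissible.
  set e : ℝ := min 1 u with he
  have he0 : 0 < e := lt_min one_pos hu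
  set a : ℕ → ℝ := fun j => if j = i then e * (t i / |t i|) else 0 with ha
  have hai : |e * (t i / |t i|)| = e := by
    rw [abs_mul, abs_div, abs_abs, div_self (abs_ne_zero.2 hi), abs_of_pos he0, mul_one]
  have hsum : ∑ j ∈ Finset.range (i + 1), hatU (U j) (a j) ≤ u := by
    rw [Finset.sum_eq_single_of_mem i (by simp)
      (fun j _ hj => by simp [ha, hj, hatU_zero])]
    simp only [ha, if_true]
    rw [hatU_of_abs_le (by rw [hai]; exact min_le_left _ _), ← sq_abs, hai]
    have h1 : e ≤ 1 := min_le_left _ _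
    have h2 : e ≤ u := min_le_right _ _
    nlinarith
  have h := hU.sum_le_normN (i + 1) a hsum t
  rw [Finset.sum_eq_single_of_mem i (by simp) (fun j _ hj => by simp [ha, hj])] at h
  simp only [ha, if_true] at h
  refine lt_of_lt_of_le ?_ h
  have : t i * (e * (t i / |t i|)) = e * (t i ^ 2 / |t i|) := by ring
  rw [this]
  have : 0 < |t i| := abs_pos.2 hi
  positivity

end IsYoungFamily

/-! ### The distances `φ_j` -/

namespace IsYoungFamily

variable {U : ℕ → ℝ → ℝ} {C r : ℝ} (hU : IsYoungFamily U C) (hr : 0 < r)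
include hU hr

lemma sub_mem_smul_setB {u : ℝ} (hu : 0 ≤ u) (j : ℤ) (v : Ell2) :
    v ∈ (r ^ (-j)) • setB U u ↔ r ^ j * normN U u v ≤ u := by
  have hrj : (0 : ℝ) < r ^ (-j) := by positivity
  rw [Set.mem_smul_set_iff_inv_smul_mem₀ hrj.ne', setB, Set.mem_ofPred_eq,
    hU.normN_smul hu (by positivity), zpow_neg, inv_inv]

-- By `normN_mul_le` the quotient 𝒩_u/u is nonincreasing, so the sets r^{-j}B(u) increase with u.
omit hr in
lemma normN_ball_mono {u v : ℝ} (hu : 0 < u) (huv : u ≤ v) {a : ℝ} (ha : 0 ≤ a) {t : Ell2}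
    (h : a * normN U u t ≤ u) : a * normN U v t ≤ v := by
  have h1 : normN U v t ≤ v / u * normN U u t := by
    have h := hU.normN_mul_le (c := v / u) (u := u) (by rw [one_le_div hu]; exact huv) hu.le t
    rwa [div_mul_cancel₀ _ hu.ne'] at h
  calc a * normN U v t ≤ a * (v / u * normN U u t) := mul_le_mul_of_nonneg_left h1 ha
    _ = v / u * (a * normN U u t) := by ring
    _ ≤ v / u * u := mul_le_mul_of_nonneg_left h (div_nonneg (hu.le.trans huv) hu.le)
    _ = v := div_mul_cancel₀ _ hu.ne'

lemma phi_le_iff {c : ℝ} (hc : 0 < c) (j : ℤ) (s t : Ell2) :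
    phi U r j s t ≤ ENNReal.ofReal c ↔ r ^ j * normN U c (s - t) ≤ c := by
  have hrj : (0 : ℝ) < r ^ j := by positivity
  constructor
  · intro h
    -- The infimum is not known to be attained, so the bound is proved for every c' > c and c'
    -- decreases to c.
    refine le_of_forall_gt_imp_ge_of_dense fun c' hc' => ?_
    have h1 : phi U r j s t < ENNReal.ofReal c' :=
      lt_of_le_of_lt h ((ENNReal.ofReal_lt_ofReal_iff (hc.trans hc')).2 hc')
    unfold phi at h1
    simp only [iInf_lt_iff] at h1
    obtain ⟨u, ⟨hu, hmem⟩, hlt⟩ := h1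
    rw [hU.sub_mem_smul_setB hr hu.le] at hmem
    have huc : u ≤ c' := by
      have := (ENNReal.ofReal_lt_ofReal_iff (hc.trans hc')).1 hlt
      exact this.le
    have h2 := hU.normN_ball_mono hu huc hrj.le hmem
    exact (mul_le_mul_of_nonneg_left (hU.normN_mono hc.le hc'.le _) hrj.le).trans h2
  · intro h
    unfold phi
    exact iInf₂_le c ⟨hc, (hU.sub_mem_smul_setB hr hc.le j _).2 h⟩

lemma phiBar_le_iff {c : ℝ} (hc : 0 < c) (j : ℤ) (s t : Ell2) :
    phiBar U r j s t ≤ ENNReal.ofReal c ↔ r ^ j * normN U c (s - t) ≤ 4 * c := by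
  unfold phiBar
  rw [hU.phi_le_iff hr hc, ← smul_sub, hU.normN_smul hc.le (by norm_num)]
  constructor <;> intro h <;> linarith

omit hU hr in
lemma two_pow_eq (n : ℕ) : (2 : ℝ≥0∞) ^ n = ENNReal.ofReal (2 ^ n) := by
  rw [ENNReal.ofReal_pow (by norm_num)]; norm_num

lemma mem_ballB_iff (j : ℤ) (n : ℕ) (s t : Ell2) :
    t ∈ ballB U r j s (2 ^ n) ↔ r ^ j * normN U (2 ^ n) (t - s) ≤ 2 ^ n := by
  rw [ballB, Set.mem_ofPred_eq, two_pow_eq, hU.phi_le_iff hr (by positivity),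
    ← neg_sub t s, hU.normN_neg (by positivity)]

lemma lt_phiBar_iff (j : ℤ) (n : ℕ) (s t : Ell2) :
    (2 : ℝ≥0∞) ^ n < phiBar U r j s t ↔ 4 * 2 ^ n < r ^ j * normN U (2 ^ n) (s - t) := by
  rw [two_pow_eq, ← not_le, hU.phiBar_le_iff hr (by positivity), not_le]

end IsYoungFamily

/-! ### Abstract separated trees -/

/-- A sequence of norms on an abelian group which at least doubles in a bounded number of steps and
at most doubles at each step. -/
structure IsScaleNorm {E : Type*} [AddCommGroup E] (N : ℕ → E → ℝ) (θ : ℝ) : Prop where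
  one_lt : 1 < θ
  zero : ∀ n, N n 0 = 0
  nonneg : ∀ n v, 0 ≤ N n v
  neg : ∀ n v, N n (-v) = N n v
  add_le : ∀ n v w, N n (v + w) ≤ N n v + N n w
  double : ∀ n v, N (n + 1) v ≤ 2 * N n v
  growth : ∀ n d v, θ ^ d * N n v ≤ 2 * N (n + d) v
  pos : ∀ n v, v ≠ 0 → 0 < N n v

namespace IsScaleNorm

variable {E : Type*} [AddCommGroup E] {N : ℕ → E → ℝ} {θ : ℝ} (hN : IsScaleNorm N θ)
include hN

lemma sub_comm (n : ℕ) (s t : E) : N n (s - t) = N n (t - s) := by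
  rw [← neg_sub, hN.neg]

lemma sub_le (n : ℕ) (s t u : E) : N n (s - t) ≤ N n (s - u) + N n (t - u) := by
  rw [hN.sub_comm n t u]
  simpa using hN.add_le n (s - u) (u - t)

end IsScaleNorm

/-- The ball `{s : s - t ∈ r^{-j} B(2^n)}`. -/
def cell {E : Type*} [AddCommGroup E] (N : ℕ → E → ℝ) (r : ℝ) (n : ℕ) (j : ℤ) (t : E) : Set E :=
  {s | r ^ j * N n (s - t) ≤ 2 ^ n}

/-- `s - t ∉ 4 r^{-j} B(2^n)`. -/
def Sep {E : Type*} [AddCommGroup E] (N : ℕ → E → ℝ) (r : ℝ) (n : ℕ) (j : ℤ) (s t : E) : Prop :=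
  4 * 2 ^ n < r ^ j * N n (s - t)

lemma mem_cell {E : Type*} [AddCommGroup E] {N : ℕ → E → ℝ} {r : ℝ} {n : ℕ} {j : ℤ} {s t : E} :
    s ∈ cell N r n j t ↔ r ^ j * N n (s - t) ≤ 2 ^ n := Iff.rfl

/-- `Tree N r next A adm x`: there is a finite tree of separated families of points of `A` whose
first step has parameters satisfying `adm`, a step with parameters `n, j` being followed by a step
with parameters satisfying `next n j`, and such that the sum of the numbers `2^n r^{-j}` along every
branch is at least `x`. -/
inductive Tree {E : Type*} [AddCommGroup E] (N : ℕ → E → ℝ) (r : ℝ)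
    (next : ℕ → ℤ → ℕ → ℤ → Prop) : Set E → (ℕ → ℤ → Prop) → ℝ → Prop
  | zero (A : Set E) (adm : ℕ → ℤ → Prop) (x : ℝ) : x ≤ 0 → Tree N r next A adm x
  | node (A : Set E) (adm : ℕ → ℤ → Prop) (n : ℕ) (j : ℤ) (P : Finset E) (x y : ℝ) :
      adm n j → ↑P ⊆ A → P.card = bigN n →
      (∀ t ∈ P, ∀ t' ∈ P, t' ≠ t → Sep N r n j t t') →
      (∀ t ∈ P, Tree N r next (A ∩ cell N r n j t) (next n j) x) →
      y ≤ 2 ^ n * r ^ (-j) + x → Tree N r next A adm y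

lemma Tree.mono {E : Type*} [AddCommGroup E] {N : ℕ → E → ℝ} {r : ℝ}
    {next : ℕ → ℤ → ℕ → ℤ → Prop} {A B : Set E} {adm adm' : ℕ → ℤ → Prop} {x y : ℝ}
    (h : Tree N r next A adm x) (hAB : A ⊆ B) (hadm : ∀ n j, adm n j → adm' n j) (hy : y ≤ x) :
    Tree N r next B adm' y := by
  induction h generalizing B adm' y with
  | zero A adm x hx => exact .zero _ _ _ (hy.trans hx)
  | node A adm n j P x z ha hP hc hsep _ hz ih =>
    exact .node _ _ n j P x y (hadm _ _ ha) (hP.trans hAB) hc hsep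
      (fun t ht => ih t ht (Set.inter_subset_inter_left _ hAB) (fun _ _ h => h) le_rfl)
      (hy.trans hz)

/-- Trees in which only the first parameter has to increase. -/
def freeNext (n : ℕ) (_ : ℤ) (n' : ℕ) (_ : ℤ) : Prop := n < n'

/-- `B_{j'}(2^{n'}) ⊆ B_j(2^n)`. -/
def CellLE {E : Type*} [AddCommGroup E] (N : ℕ → E → ℝ) (r : ℝ) (n : ℕ) (j : ℤ) (n' : ℕ)
    (j' : ℤ) : Prop :=
  ∀ v : E, r ^ j' * N n' v ≤ 2 ^ n' → r ^ j * N n v ≤ 2 ^ n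

/-- Trees in which the first parameter increases and the balls decrease. -/
def nestedNext {E : Type*} [AddCommGroup E] (N : ℕ → E → ℝ) (r : ℝ) (n : ℕ) (j : ℤ) (n' : ℕ)
    (j' : ℤ) : Prop :=
  n < n' ∧ CellLE N r n j n' j'

/-! ### From free trees to nested trees -/

section Prune

variable {E : Type*} [AddCommGroup E] {N : ℕ → E → ℝ} {θ r : ℝ}

/-- Growth over d levels puts the later ball inside the earlier one once twice the later weight is
at most θ^d times the earlier weight. -/
lemma cellLE_of_le (hN : IsScaleNorm N θ) (hr : 0 < r) {n d : ℕ} {j j' : ℤ}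
    (h : 2 * (2 ^ (n + d) * r ^ (-j')) ≤ θ ^ d * (2 ^ n * r ^ (-j))) :
    CellLE N r n j (n + d) j' := by
  intro v hv
  have hθ : 0 < θ ^ d := pow_pos (zero_lt_one.trans hN.one_lt) _
  have hj : (0 : ℝ) < r ^ j := by positivity
  have hj' : (0 : ℝ) < r ^ j' := by positivity
  have h1 := hN.growth n d v
  have h2 : N (n + d) v ≤ 2 ^ (n + d) * r ^ (-j') := by
    rw [zpow_neg, ← div_eq_mul_inv, le_div_iff₀ hj']; linarith
  have h3 : θ ^ d * N n v ≤ θ ^ d * (2 ^ n * r ^ (-j)) := by linarith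
  have h4 := le_of_mul_le_mul_left h3 hθ
  rw [zpow_neg, ← div_eq_mul_inv, le_div_iff₀ hj] at h4
  linarith

/-- Induction from the leaves. The weight a of a step that is not nested with its successor of
weight a', d + 1 levels later, satisfies a ≤ 2a'q^{d+1}, so deleting it is cheap. The term κ 2^n
r^{-j} q^{n - n₀} is a reserve held by the first surviving step for all deletions above it. Its
parameters n, j are recorded so that the step above can be tested against it. -/
lemma Tree.exists_nested (hN : IsScaleNorm N θ) (hr : 0 < r) {q κ : ℝ} (hq : q = θ⁻¹)
    (hκ : κ = 2 * q / (1 - q)) {A : Set E} {adm : ℕ → ℤ → Prop} {x : ℝ}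
    (h : Tree N r freeNext A adm x) (n₀ : ℕ) (hadm : ∀ n j, adm n j → n₀ ≤ n) :
    x ≤ 0 ∨ ∃ n j y, n₀ ≤ n ∧
      Tree N r (nestedNext N r) A (fun n' j' => n' = n ∧ j' = j) y ∧
      x + κ * (2 ^ n * r ^ (-j)) * q ^ (n - n₀) ≤ (1 + κ) * y := by
  have hθ := hN.one_lt
  have hθ0 : 0 < θ := by linarith
  have hq0 : 0 < q := by rw [hq]; positivity
  have hq1 : q < 1 := by rw [hq]; exact inv_lt_one_of_one_lt₀ hθ
  have hκ0 : 0 < κ := by rw [hκ]; have := sub_pos.2 hq1; positivity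
  have hκq : κ * (1 - q) = 2 * q := by rw [hκ, div_mul_cancel₀ _ (sub_pos.2 hq1).ne']
  induction h generalizing n₀ with
  | zero A adm x hx => exact Or.inl hx
  | node A adm n j P x y ha hP hc hsep _ hy ih =>
    right
    have hn0 := hadm _ _ ha
    have ha0 : 0 < 2 ^ n * r ^ (-j) := by positivity
    have ih' := fun t ht => ih t ht (n + 1) (fun _ _ h => h)
    by_cases hgood : ∀ t ∈ P, x ≤ 0 ∨ ∃ n' j' y, nestedNext N r n j n' j' ∧
        Tree N r (nestedNext N r) (A ∩ cell N r n j t) (fun n'' j'' => n'' = n' ∧ j'' = j') y ∧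
        x ≤ (1 + κ) * y
    · refine ⟨n, j, 2 ^ n * r ^ (-j) + max 0 (x / (1 + κ)), hn0,
        .node _ _ n j P (max 0 (x / (1 + κ))) _ ⟨rfl, rfl⟩ hP hc hsep ?_ le_rfl, ?_⟩
      · intro t ht
        rcases le_or_gt x 0 with hx | hx
        · refine .zero _ _ _ ?_
          have : x / (1 + κ) ≤ 0 := div_nonpos_of_nonpos_of_nonneg hx (by positivity)
          exact max_le le_rfl this
        · rcases hgood t ht with h | ⟨n', j', y', h1, h2, h3⟩
          · linarith
          · refine h2.mono subset_rfl ?_ ?_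
            · rintro _ _ ⟨rfl, rfl⟩; exact h1
            · have : x / (1 + κ) ≤ y' := by rw [div_le_iff₀' (by positivity)]; exact h3
              refine max_le ?_ this
              exact (div_pos hx (by positivity)).le.trans this
      · have h1 : q ^ (n - n₀) ≤ 1 := pow_le_one₀ hq0.le hq1.le
        have h2 : κ * (2 ^ n * r ^ (-j)) * q ^ (n - n₀) ≤ κ * (2 ^ n * r ^ (-j)) :=
          mul_le_of_le_one_right (by positivity) h1
        have h3 : x ≤ (1 + κ) * max 0 (x / (1 + κ)) := by
          rw [← div_le_iff₀' (by positivity)]; exact le_max_right _ _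
        nlinarith
    -- Below some t the first surviving step is not nested with the present one: delete the present
    -- step and keep only the subtree below t.
    · push Not at hgood
      obtain ⟨t, ht, hx, hbad⟩ := hgood
      rcases ih' t ht with h | ⟨n', j', y', h1, h2, h3⟩
      · linarith
      · refine ⟨n', j', y', by omega, h2.mono Set.inter_subset_left (fun _ _ h => h) le_rfl, ?_⟩
        have ha0' : 0 < 2 ^ n' * r ^ (-j') := by positivity
        obtain ⟨d, rfl⟩ : ∃ d, n' = n + (d + 1) := ⟨n' - n - 1, by omega⟩
        have hlt : θ ^ (d + 1) * (2 ^ n * r ^ (-j)) < 2 * (2 ^ (n + (d + 1)) * r ^ (-j')) := by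
          by_contra! hle
          have := hbad _ j' y' ⟨by omega, cellLE_of_le hN hr hle⟩ h2
          have h4 : 0 ≤ κ * (2 ^ (n + (d + 1)) * r ^ (-j')) * q ^ (n + (d + 1) - (n + 1)) := by
            positivity
          linarith
        set a := 2 ^ n * r ^ (-j) with hadef
        set a' := 2 ^ (n + (d + 1)) * r ^ (-j') with hadef'
        have hqθ : q ^ (d + 1) * θ ^ (d + 1) = 1 := by
          rw [← mul_pow, hq, inv_mul_cancel₀ hθ0.ne', one_pow]
        have h5 : a ≤ 2 * a' * q ^ (d + 1) := by
          have := mul_le_mul_of_nonneg_left hlt.le (pow_pos hq0 (d + 1)).le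
          rw [← mul_assoc, hqθ, one_mul] at this
          linarith
        have e1 : n + (d + 1) - (n + 1) = d := by omega
        rw [e1] at h3
        have h6 : q ^ (n + (d + 1) - n₀) ≤ q ^ (d + 1) :=
          pow_le_pow_of_le_one hq0.le hq1.le (by omega)
        have h7 : κ * a' * q ^ (n + (d + 1) - n₀) ≤ κ * a' * q ^ (d + 1) :=
          mul_le_mul_of_nonneg_left h6 (by positivity)
        -- Since κ(1 - q) = 2q, lowering the reserve by one power of q releases exactly the bound
        -- for the deleted weight.
        have h8 : κ * a' * q ^ d = κ * a' * q ^ (d + 1) + 2 * a' * q ^ (d + 1) := by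
          rw [pow_succ]
          linear_combination (a' * q ^ d) * hκq
        linarith

end Prune

/-! ### The value of a set -/

section Value

variable {E : Type*} [AddCommGroup E] {N : ℕ → E → ℝ} {θ r : ℝ}

/-- The supremum of the values of the nested trees on `A` with points in `F`. -/
noncomputable def treeValue (N : ℕ → E → ℝ) (r : ℝ) (F : Finset E) (A : Set E)
    (adm : ℕ → ℤ → Prop) : ℝ≥0∞ :=
  ⨆ (y : ℝ) (_ : Tree N r (nestedNext N r) (A ∩ F) adm y), ENNReal.ofReal y

lemma le_treeValue {F : Finset E} {A : Set E} {adm : ℕ → ℤ → Prop} {y : ℝ}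
    (h : Tree N r (nestedNext N r) (A ∩ F) adm y) :
    ENNReal.ofReal y ≤ treeValue N r F A adm :=
  le_iSup₂ (f := fun (y : ℝ) (_ : Tree N r (nestedNext N r) (A ∩ F) adm y) => ENNReal.ofReal y) y h

lemma two_le_bigN (n : ℕ) : 2 ≤ bigN n := by
  unfold bigN
  calc 2 = 2 ^ 1 := rfl
    _ ≤ 2 ^ 2 ^ n := Nat.pow_le_pow_right (by norm_num) Nat.one_le_two_pow

lemma bigN_injective : Function.Injective bigN := by
  intro m n h
  exact Nat.pow_right_injective (le_refl 2) (Nat.pow_right_injective (le_refl 2) h)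

lemma lt_bigN (n : ℕ) : n < bigN n :=
  Nat.lt_two_pow_self.trans Nat.lt_two_pow_self

/-- If no family of points of `A ∩ F` is available, the value is `0`. -/
lemma treeValue_eq_zero {F : Finset E} {A : Set E} {adm : ℕ → ℤ → Prop}
    (h : ∀ n j (P : Finset E), adm n j → (P : Set E) ⊆ A ∩ F → P.card = bigN n → False) :
    treeValue N r F A adm = 0 := by
  refine le_antisymm (iSup₂_le fun y hy => ?_) bot_le
  cases hy with
  | zero _ _ _ hx => exact (ENNReal.ofReal_eq_zero.2 hx).le
  | node _ _ n j P _ _ ha hP hc => exact (h n j P ha hP hc).elim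

/-- A separated family stays separated at all finer scales, and at only finitely many coarser
ones. -/
lemma exists_isLeast_sep (hN : IsScaleNorm N θ) (hr : 1 < r) {n : ℕ} {P : Finset E}
    (hP : 1 < P.card) {adm : ℤ → Prop} {t : E}
    {j : ℤ} (hj : (∀ t' ∈ P, t' ≠ t → Sep N r n j t t') ∧ adm j) :
    ∃ k, k ≤ j ∧ IsLeast {j : ℤ | (∀ t' ∈ P, t' ≠ t → Sep N r n j t t') ∧ adm j} k := by
  obtain ⟨t', ht', hne⟩ := Finset.exists_mem_ne hP t
  have hbdd : ∃ b : ℤ, ∀ z : ℤ, ((∀ t' ∈ P, t' ≠ t → Sep N r n z t t') ∧ adm z) → b ≤ z := by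
    obtain ⟨m, hm⟩ := pow_unbounded_of_one_lt (N n (t - t')) hr
    refine ⟨-(m : ℤ), fun z hz => ?_⟩
    by_contra! hlt
    have h1 := hz.1 t' ht' hne
    unfold Sep at h1
    have h2 : r ^ z ≤ r ^ (-(m : ℤ)) := zpow_le_zpow_right₀ hr.le hlt.le
    have h3 : r ^ z * N n (t - t') ≤ r ^ (-(m : ℤ)) * r ^ m :=
      mul_le_mul h2 hm.le (hN.nonneg _ _) (by positivity)
    rw [zpow_neg, zpow_natCast, inv_mul_cancel₀ (by positivity)] at h3
    have h4 : (1 : ℝ) ≤ 2 ^ n := one_le_pow₀ (by norm_num)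
    linarith
  obtain ⟨k, hk, hle⟩ := Int.exists_least_of_bdd hbdd ⟨j, hj⟩
  exact ⟨k, hle j hj, hk, hle⟩

/-- The cardinality of P determines n, and P determines the least scales, so there are finitely many
candidates even though n and j are unbounded. If each failed at one of its points, each would have a
bound strictly below V there. A tree with value above the largest of these bounds gives a
contradiction. -/
lemma exists_optimal_step (hN : IsScaleNorm N θ) (hr : 1 < r) {F : Finset E} {A : Set E}
    {adm : ℕ → ℤ → Prop} (hpos : 0 < treeValue N r F A adm) :
    ∃ n, ∃ P : Finset E, (P : Set E) ⊆ A ∩ F ∧ P.card = bigN n ∧ ∃ jj : E → ℤ,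
      (∀ t ∈ P, IsLeast {j : ℤ | (∀ t' ∈ P, t' ≠ t → Sep N r n j t t') ∧ adm n j} (jj t)) ∧
      ∀ t ∈ P, treeValue N r F A adm ≤ ENNReal.ofReal (2 ^ n * r ^ (-jj t)) +
        treeValue N r F (A ∩ cell N r n (jj t) t) (nestedNext N r n (jj t)) := by
  classical
  set V := treeValue N r F A adm with hV
  let rhs : ℕ → ℤ → E → ℝ≥0∞ := fun n j t => ENNReal.ofReal (2 ^ n * r ^ (-j)) +
        treeValue N r F (A ∩ cell N r n j t) (nestedNext N r n j)
  let valid : Finset E → ℕ → (E → ℤ) → Prop := fun P n jj => P.card = bigN n ∧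
    (∀ t ∈ P, IsLeast {j : ℤ | (∀ t' ∈ P, t' ≠ t → Sep N r n j t t') ∧ adm n j} (jj t))
  by_contra! hcon
  have hc : ∀ P ∈ F.powerset, ∃ c < V, ∀ n jj, (P : Set E) ⊆ A ∩ F → valid P n jj →
      ∃ t ∈ P, rhs n (jj t) t ≤ c := by
    intro P _
    by_cases hex : (P : Set E) ⊆ A ∩ F ∧ ∃ n jj, valid P n jj
    · obtain ⟨hPA, n, jj, hv⟩ := hex
      obtain ⟨t, ht, hlt⟩ := hcon n P hPA hv.1 jj hv.2
      refine ⟨_, hlt, fun n' jj' _ hv' => ⟨t, ht, ?_⟩⟩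
      have hnn : n' = n := bigN_injective (hv'.1.symm.trans hv.1)
      subst hnn
      have : jj' t = jj t := (hv'.2 t ht).unique (hv.2 t ht)
      rw [this]
    · exact ⟨0, hpos, fun n jj hPA hv => (hex ⟨hPA, n, jj, hv⟩).elim⟩
  choose! c hcV hcP using hc
  have hsup : F.powerset.sup c < V := (Finset.sup_lt_iff hpos).2 hcV
  obtain ⟨y, hy⟩ := lt_iSup_iff.1 (hsup.trans_eq (by rw [hV]; rfl))
  obtain ⟨hy1, hlt⟩ := lt_iSup_iff.1 hy
  cases hy1 with
  | zero _ _ _ hx =>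
    rw [ENNReal.ofReal_eq_zero.2 hx] at hlt
    exact not_lt_bot hlt
  | node _ _ n j P x _ ha hP hcard hsep hch hyx =>
    have hPF : P ∈ F.powerset := Finset.mem_powerset.2 fun t ht => by simpa using (hP ht).2
    have hP1 : 1 < P.card := by rw [hcard]; exact two_le_bigN n
    have hex : ∀ t ∈ P, ∃ k, k ≤ j ∧
        IsLeast {j : ℤ | (∀ t' ∈ P, t' ≠ t → Sep N r n j t t') ∧ adm n j} k := fun t ht =>
      exists_isLeast_sep hN hr hP1 ⟨fun t' ht' hne => hsep t ht t' ht' hne, ha⟩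
    choose! jj hjj hleast using hex
    obtain ⟨t, ht, hle⟩ := hcP P hPF n jj hP ⟨hcard, hleast⟩
    have h1 : rhs n (jj t) t < ENNReal.ofReal y :=
      (hle.trans (Finset.le_sup (f := c) hPF)).trans_lt hlt
    refine absurd h1 (not_lt.2 ?_)
    have hr0 : 0 < r := by linarith
    -- Replacing the common scale j of the tree by the least one jj t increases the weight, enlarges
    -- the cell and weakens the inclusion required next.
    have hz : r ^ (jj t) ≤ r ^ j := zpow_le_zpow_right₀ hr.le (hjj t ht)
    have h2 : Tree N r (nestedNext N r) ((A ∩ cell N r n (jj t) t) ∩ F)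
        (nestedNext N r n (jj t)) x := by
      refine (hch t ht).mono ?_ ?_ le_rfl
      · rintro s ⟨⟨h1, h2⟩, h3⟩
        exact ⟨⟨h1, (mul_le_mul_of_nonneg_right hz (hN.nonneg _ _)).trans h3⟩, h2⟩
      · rintro n' j' ⟨h1, h2⟩
        exact ⟨h1, fun v hv => (mul_le_mul_of_nonneg_right hz (hN.nonneg _ _)).trans (h2 v hv)⟩
    calc ENNReal.ofReal y ≤ ENNReal.ofReal (2 ^ n * r ^ (-jj t) + x) := by
          apply ENNReal.ofReal_le_ofReal
          refine hyx.trans (add_le_add_left (mul_le_mul_of_nonneg_left ?_ (by positivity)) _)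
          exact zpow_le_zpow_right₀ hr.le (neg_le_neg (hjj t ht))
      _ ≤ ENNReal.ofReal (2 ^ n * r ^ (-jj t)) + ENNReal.ofReal x := ENNReal.ofReal_add_le
      _ ≤ rhs n (jj t) t := add_le_add le_rfl (le_treeValue h2)

end Value

/-! ### Iterative organized trees -/

/-- The norms `𝒩_{2^n}`. -/
noncomputable def scaleNorm (U : ℕ → ℝ → ℝ) (n : ℕ) (v : Ell2) : ℝ := normN U (2 ^ n) v

/-- The norm doubles every h levels, since 8C ≤ 2^h; hence θ = 2^{1/h}. The factor 2 allowed in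
`growth` absorbs the incomplete block of d mod h levels. -/
lemma IsYoungFamily.isScaleNorm {U : ℕ → ℝ → ℝ} {C : ℝ} (hU : IsYoungFamily U C) {h : ℕ}
    (hh : 1 ≤ h) (hC : 8 * C ≤ 2 ^ h) :
    IsScaleNorm (scaleNorm U) ((2 : ℝ) ^ (1 / (h : ℝ))) := by
  set θ : ℝ := (2 : ℝ) ^ (1 / (h : ℝ)) with hθ
  have hh0 : (0 : ℝ) < h := by exact_mod_cast hh
  have hθh : θ ^ h = 2 := by
    rw [hθ, ← Real.rpow_natCast, ← Real.rpow_mul (by norm_num), one_div,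
      inv_mul_cancel₀ hh0.ne', Real.rpow_one]
  have hθ1 : 1 < θ := Real.one_lt_rpow (by norm_num) (by positivity)
  have hmono : ∀ n d v, scaleNorm U n v ≤ scaleNorm U (n + d) v := fun n d v =>
    hU.normN_mono (by positivity) (pow_le_pow_right₀ (by norm_num) (by omega)) v
  have hblock : ∀ k n v, 2 ^ k * scaleNorm U n v ≤ scaleNorm U (n + h * k) v := by
    intro k
    induction k with
    | zero => intro n v; simp
    | succ k ih =>
      intro n v
      have h1 := ih n v
      have h2 := hU.two_mul_normN_le (u := 2 ^ (n + h * k)) (by positivity) v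
      have h3 : normN U (8 * C * 2 ^ (n + h * k)) v ≤ scaleNorm U (n + h * (k + 1)) v := by
        refine hU.normN_mono ?_ ?_ v
        · have := hU.two_le; positivity
        · calc 8 * C * 2 ^ (n + h * k) ≤ 2 ^ h * 2 ^ (n + h * k) := by gcongr
            _ = 2 ^ (n + h * (k + 1)) := by rw [← pow_add]; congr 1; ring
      have h4 : 2 * scaleNorm U (n + h * k) v ≤ scaleNorm U (n + h * (k + 1)) v := h2.trans h3
      rw [pow_succ]
      linarith
  refine ⟨hθ1, ?_, ?_, ?_, ?_, ?_, ?_, ?_⟩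
  · intro n
    have h1 := hU.normN_smul (u := 2 ^ n) (by positivity) (c := 2) (by norm_num) 0
    rw [smul_zero] at h1
    have : scaleNorm U n 0 = normN U (2 ^ n) 0 := rfl
    linarith
  · exact fun n v => hU.normN_nonneg (by positivity) v
  · exact fun n v => hU.normN_neg (by positivity) v
  · exact fun n v w => hU.normN_add_le (by positivity) v w
  · intro n v
    have := hU.normN_mul_le (c := 2) (u := 2 ^ n) (by norm_num) (by positivity) v
    rwa [← pow_succ'] at this
  · intro n d v
    have hd : d = h * (d / h) + d % h := (Nat.div_add_mod d h).symm
    have h0 : 0 ≤ scaleNorm U n v := hU.normN_nonneg (by positivity) v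
    have h1 : θ ^ d ≤ 2 ^ (d / h) * 2 := by
      conv_lhs => rw [hd, pow_add, pow_mul, hθh]
      gcongr
      calc θ ^ (d % h) ≤ θ ^ h := pow_le_pow_right₀ hθ1.le (Nat.mod_lt _ hh).le
        _ = 2 := hθh
    have h2 := hblock (d / h) n v
    have h3 := hmono (n + h * (d / h)) (d % h) v
    have h4 : n + h * (d / h) + d % h = n + d := by omega
    rw [h4] at h3
    calc θ ^ d * scaleNorm U n v ≤ 2 ^ (d / h) * 2 * scaleNorm U n v := by gcongr
      _ = 2 * (2 ^ (d / h) * scaleNorm U n v) := by ring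
      _ ≤ 2 * scaleNorm U (n + d) v := by linarith
  · exact fun n v hv => hU.normN_pos (by positivity) hv

/-- The value of a node: the supremum of the values of the nested trees below it. -/
noncomputable def nodeValue (U : ℕ → ℝ → ℝ) (r : ℝ) (F : Finset Ell2) (A : Node) : ℝ≥0∞ :=
  match A.j with
  | ⊤ => 0
  | (j : ℤ) => treeValue (scaleNorm U) r F A.carrier (nestedNext (scaleNorm U) r A.n j)

/-- `a` is the least element of `S` for a fixed well-order of `ℓ²`. -/
def IsFirst (a : Ell2) (S : Set Ell2) : Prop := a ∈ S ∧ ∀ b ∈ S, ¬ WellOrderingRel b a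

lemma exists_isFirst {S : Set Ell2} (hS : S.Nonempty) : ∃ a, IsFirst a S :=
  have wf := (WellOrderingRel.isWellOrder (α := Ell2)).toIsWellFounded.wf
  ⟨wf.min S hS, wf.min_mem S hS, fun _ hb => wf.not_lt_min S hb⟩

lemma IsFirst.unique {a b : Ell2} {S : Set Ell2} (ha : IsFirst a S) (hb : IsFirst b S) : a = b := by
  rcases trichotomous_of WellOrderingRel a b with h | h | h
  · exact (hb.2 a ha.1 h).elim
  · exact h
  · exact (ha.2 b hb.1 h).elim

/-- A branch can therefore follow one and the same point through all its descendants. -/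
lemma IsFirst.subset {a : Ell2} {S S' : Set Ell2} (ha : IsFirst a S) (h : S' ⊆ S) (ha' : a ∈ S') :
    IsFirst a S' := ⟨ha', fun _ hb => ha.2 _ (h hb)⟩

/-- The properties required of the family of children chosen for a set `S`. -/
structure GoodOffspring (U : ℕ → ℝ → ℝ) (r : ℝ) (F : Finset Ell2) (S : Set Ell2)
    (adm : ℕ → ℤ → Prop) (n : ℕ) (C : Set Node) : Prop where
  offspring : IsOffspring U r S (adm n) n C
  finite : C.Finite
  nonempty : S.Nonempty → C.Nonempty
  carrier_subset : ∀ D ∈ C, D.carrier ⊆ S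
  carrier_nonempty : ∀ D ∈ C, D.carrier.Nonempty
  n_eq : ∀ D ∈ C, D.n = n
  leaf : ∀ D ∈ C, D.j = ⊤ → ∃ a, D.carrier = {a}
  value_le : ∀ D ∈ C, treeValue (scaleNorm U) r F S adm ≤
    2 * (ENNReal.ofReal (Real.log C.ncard) * scale r D.j) + nodeValue U r F D
  first : treeValue (scaleNorm U) r F S adm = 0 → ∀ a, IsFirst a S → ∃ D ∈ C, a ∈ D.carrier

/-! ### Good families of children -/

section Offspring

variable {U : ℕ → ℝ → ℝ} {C θ r : ℝ} (hU : IsYoungFamily U C) (hN : IsScaleNorm (scaleNorm U) θ)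
  (hr : 1 < r)
include hU hr

lemma ballB_eq_cell (j : ℤ) (n : ℕ) (t : Ell2) :
    ballB U r j t (2 ^ n) = cell (scaleNorm U) r n j t :=
  Set.ext fun s => hU.mem_ballB_iff (by linarith) j n t s

lemma lt_phiBar_iff_sep (j : ℤ) (n : ℕ) (s t : Ell2) :
    (2 : ℝ≥0∞) ^ n < phiBar U r j s t ↔ Sep (scaleNorm U) r n j s t :=
  hU.lt_phiBar_iff (by linarith) j n s t

lemma ballB_subset_iff (j j' : ℤ) (n n' : ℕ) :
    ballB U r j' 0 (2 ^ n') ⊆ ballB U r j 0 (2 ^ n) ↔ CellLE (scaleNorm U) r n j n' j' := by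
  rw [ballB_eq_cell hU hr, ballB_eq_cell hU hr]
  simp only [Set.subset_def, mem_cell, sub_zero, CellLE]

include hN

omit hU hN hr in
lemma goodOffspring_leaf (F : Finset Ell2) {S : Set Ell2} (adm : ℕ → ℤ → Prop) {n : ℕ}
    (hS : S.encard < bigN n) (h0 : treeValue (scaleNorm U) r F S adm = 0) :
    GoodOffspring U r F S adm n {D | ∃ a ∈ S, D = ⟨{a}, n, ⊤⟩} := by
  have hfin : S.Finite := Set.encard_lt_top_iff.1 (hS.trans (by simp))
  refine ⟨Or.inl ⟨hS, rfl⟩, ?_, ?_, ?_, ?_, ?_, ?_, ?_, ?_⟩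
  · refine (hfin.image fun a => (⟨{a}, n, ⊤⟩ : Node)).subset ?_
    rintro D ⟨a, ha, rfl⟩
    exact ⟨a, ha, rfl⟩
  · rintro ⟨a, ha⟩
    exact ⟨_, a, ha, rfl⟩
  · rintro D ⟨a, ha, rfl⟩
    simpa using ha
  · rintro D ⟨a, ha, rfl⟩
    simp
  · rintro D ⟨a, ha, rfl⟩
    rfl
  · rintro D ⟨a, ha, rfl⟩ _
    exact ⟨a, rfl⟩
  · intro D _
    rw [h0]
    exact bot_le
  · rintro _ a ha
    exact ⟨_, ⟨a, ha.1, rfl⟩, rfl⟩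

lemma goodOffspring_split (F : Finset Ell2) {S : Set Ell2} (adm : ℕ → ℤ → Prop) {n : ℕ}
    {P : Finset Ell2} (hPS : (P : Set Ell2) ⊆ S) (hP : P.card = bigN n) {jj : Ell2 → ℤ}
    (hjj : ∀ t ∈ P, IsLeast {j : ℤ | (∀ t' ∈ P, t' ≠ t → Sep (scaleNorm U) r n j t t') ∧ adm n j}
      (jj t))
    (hval : ∀ t ∈ P, treeValue (scaleNorm U) r F S adm ≤ ENNReal.ofReal (2 ^ n * r ^ (-jj t)) +
        treeValue (scaleNorm U) r F (S ∩ cell (scaleNorm U) r n (jj t) t)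
          (nestedNext (scaleNorm U) r n (jj t)))
    (hfirst : treeValue (scaleNorm U) r F S adm = 0 → ∀ a, IsFirst a S → a ∈ P) :
    GoodOffspring U r F S adm n
      {D | ∃ t ∈ P, D = ⟨S ∩ ballB U r (jj t) t (2 ^ n), n, (jj t : WithTop ℤ)⟩} := by
  have hmem : ∀ t ∈ P, t ∈ S ∩ ballB U r (jj t) t (2 ^ n) := by
    intro t ht
    refine ⟨hPS ht, ?_⟩
    rw [ballB_eq_cell hU hr, mem_cell, sub_self, hN.zero, mul_zero]
    positivity
  have hCeq : {D | ∃ t ∈ P, D = (⟨S ∩ ballB U r (jj t) t (2 ^ n), n, (jj t : WithTop ℤ)⟩ : Node)}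
      = (fun t => (⟨S ∩ ballB U r (jj t) t (2 ^ n), n, (jj t : WithTop ℤ)⟩ : Node)) '' P := by
    ext D
    constructor
    · rintro ⟨t, ht, rfl⟩; exact ⟨t, ht, rfl⟩
    · rintro ⟨t, ht, rfl⟩; exact ⟨t, ht, rfl⟩
  have hcard : Set.ncard {D | ∃ t ∈ P, D =
      (⟨S ∩ ballB U r (jj t) t (2 ^ n), n, (jj t : WithTop ℤ)⟩ : Node)} = bigN n := by
    rw [hCeq, Set.InjOn.ncard_image, Set.ncard_coe_finset, hP]
    -- Distinct points have distinct children: t' is separated from t by the constant 4, whereas A_t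
    -- has radius constant 1. So there are exactly N_n children.
    intro t ht t' ht' heq
    by_contra hne
    have h1 := congrArg Node.carrier heq
    simp only at h1
    have h2 : t' ∈ S ∩ ballB U r (jj t) t (2 ^ n) := h1 ▸ hmem t' ht'
    have h3 := h2.2
    rw [ballB_eq_cell hU hr, mem_cell, hN.sub_comm] at h3
    have h4 := (hjj t ht).1.1 t' ht' (Ne.symm hne)
    unfold Sep at h4
    have : (0 : ℝ) < 2 ^ n := by positivity
    linarith
  refine ⟨Or.inr ⟨P, hPS, hP, jj, ?_, rfl⟩, ?_, ?_, ?_, ?_, ?_, ?_, ?_, ?_⟩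
  · intro t ht
    simpa only [lt_phiBar_iff_sep hU hr] using hjj t ht
  · rw [hCeq]; exact P.finite_toSet.image _
  · intro _
    have : 0 < P.card := by rw [hP]; exact lt_of_lt_of_le two_pos (two_le_bigN n)
    obtain ⟨t, ht⟩ := Finset.card_pos.1 this
    exact ⟨_, t, ht, rfl⟩
  · rintro D ⟨t, ht, rfl⟩
    exact Set.inter_subset_left
  · rintro D ⟨t, ht, rfl⟩
    exact ⟨t, hmem t ht⟩
  · rintro D ⟨t, ht, rfl⟩
    rfl
  · rintro D ⟨t, ht, rfl⟩ h
    exact absurd h (WithTop.coe_ne_top)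
  · rintro D ⟨t, ht, rfl⟩
    rw [hcard]
    refine (hval t ht).trans (add_le_add ?_ (le_of_eq ?_))
    · have hlog : Real.log (bigN n : ℝ) = 2 ^ n * Real.log 2 := by
        unfold bigN; push_cast; rw [Real.log_pow]; norm_cast
      have hr0 : (0 : ℝ) ≤ r ^ (-jj t) := by positivity
      change _ ≤ 2 * (ENNReal.ofReal (Real.log (bigN n : ℝ)) * ENNReal.ofReal (r ^ (-jj t)))
      have h2 : (2 : ℝ≥0∞) = ENNReal.ofReal 2 := by norm_num
      rw [hlog, h2, ← ENNReal.ofReal_mul (by positivity), ← ENNReal.ofReal_mul (by norm_num)]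
      apply ENNReal.ofReal_le_ofReal
      -- The factor 2 in front of the logarithm comes from log N_n = 2^n log 2 and 2 log 2 ≥ 1.
      have h3 := Real.log_two_gt_d9
      have h4 : 0 ≤ 2 ^ n * r ^ (-jj t) := by positivity
      nlinarith
    · rw [← ballB_eq_cell hU hr]; rfl
  · intro h0 a ha
    exact ⟨_, ⟨a, hfirst h0 a ha, rfl⟩, hmem a (hfirst h0 a ha)⟩

/-- Every set has a good family of children. -/
lemma exists_goodOffspring (F : Finset Ell2) (S : Set Ell2) (adm : ℕ → ℤ → Prop) (n₀ : ℕ)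
    (hadm : ∀ n j, adm n j → n₀ ≤ n)
    (hex : ∀ P : Finset Ell2, (P : Set Ell2) ⊆ S → 1 < P.card → ∀ t ∈ P, ∃ j,
      (∀ t' ∈ P, t' ≠ t → Sep (scaleNorm U) r n₀ j t t') ∧ adm n₀ j) :
    ∃ n C, n₀ ≤ n ∧ GoodOffspring U r F S adm n C := by
  classical
  -- At value 0 the inequality for the values is void; it only remains to choose an admissible
  -- family that keeps the first point of S.
  rcases eq_or_ne (treeValue (scaleNorm U) r F S adm) 0 with h0 | h0
  · refine ⟨n₀, ?_⟩
    rcases lt_or_ge S.encard (bigN n₀) with hS | hS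
    · exact ⟨_, le_rfl, goodOffspring_leaf F adm hS h0⟩
    · have hne : S.Nonempty := by
        rw [← Set.encard_pos]
        refine lt_of_lt_of_le ?_ hS
        exact_mod_cast lt_of_lt_of_le two_pos (two_le_bigN n₀)
      obtain ⟨a, ha⟩ := exists_isFirst hne
      obtain ⟨P', hP1, hP2, hP3⟩ := Set.exists_superset_subset_encard_eq
        (Set.singleton_subset_iff.2 ha.1) (k := bigN n₀)
        (by
          rw [Set.encard_singleton]
          exact_mod_cast (le_trans (by norm_num) (two_le_bigN n₀))) hS
      have hfin : P'.Finite := Set.finite_of_encard_eq_coe hP3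
      obtain ⟨P, rfl⟩ := hfin.exists_finset_coe
      rw [Set.encard_coe_eq_coe_finsetCard] at hP3
      have hcard : P.card = bigN n₀ := by exact_mod_cast hP3
      have h1 : 1 < P.card := by rw [hcard]; exact two_le_bigN n₀
      have hex' : ∀ t ∈ P, ∃ k, IsLeast
          {j : ℤ | (∀ t' ∈ P, t' ≠ t → Sep (scaleNorm U) r n₀ j t t') ∧ adm n₀ j} k := by
        intro t ht
        obtain ⟨j, hj⟩ := hex P hP2 h1 t ht
        obtain ⟨k, -, hk⟩ := exists_isLeast_sep hN hr h1 hj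
        exact ⟨k, hk⟩
      choose! jj hjj using hex'
      refine ⟨_, le_rfl, goodOffspring_split hU hN hr F adm hP2 hcard hjj ?_ ?_⟩
      · intro t _
        rw [h0]; exact bot_le
      · intro _ b hb
        rw [hb.unique ha]
        exact hP1 rfl
  · obtain ⟨n, P, hPS, hP, jj, hjj, hval⟩ := exists_optimal_step hN hr (pos_iff_ne_zero.2 h0)
    have hne : P.Nonempty := by
      rw [← Finset.card_pos, hP]; exact lt_of_lt_of_le two_pos (two_le_bigN n)
    obtain ⟨t, ht⟩ := hne
    exact ⟨n, _, hadm _ _ (hjj t ht).1.2, goodOffspring_split hU hN hr F adm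
      (hPS.trans Set.inter_subset_left) hP hjj hval (fun h => (h0 h).elim)⟩

omit hU in
/-- Distinct points are separated at all sufficiently fine scales. -/
lemma exists_forall_sep (n : ℕ) (P : Finset Ell2) (t : Ell2) :
    ∃ j₀ : ℤ, ∀ j, j₀ ≤ j → ∀ t' ∈ P, t' ≠ t → Sep (scaleNorm U) r n j t t' := by
  have h : ∀ t' : Ell2, ∃ m : ℕ, t' ≠ t → Sep (scaleNorm U) r n m t t' := by
    intro t'
    by_cases hne : t' = t
    · exact ⟨0, fun h => (h hne).elim⟩
    · have hpos := hN.pos n (t - t') (sub_ne_zero.2 (Ne.symm hne))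
      obtain ⟨m, hm⟩ := pow_unbounded_of_one_lt (4 * 2 ^ n / scaleNorm U n (t - t')) hr
      refine ⟨m, fun _ => ?_⟩
      rw [div_lt_iff₀ hpos] at hm
      unfold Sep
      rwa [zpow_natCast]
  choose m hm using h
  refine ⟨(P.sup m : ℕ), fun j hj t' ht' hne => ?_⟩
  have h1 := hm t' hne
  unfold Sep at h1 ⊢
  refine h1.trans_le (mul_le_mul_of_nonneg_right ?_ (hN.nonneg _ _))
  refine zpow_le_zpow_right₀ hr.le (le_trans ?_ hj)
  exact_mod_cast Finset.le_sup (f := m) ht'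

lemma exists_goodOffspring_node (F : Finset Ell2) (A : Node) (jA : ℤ) :
    ∃ n C, A.n + 1 ≤ n ∧
      GoodOffspring U r F A.carrier (nestedNext (scaleNorm U) r A.n jA) n C := by
  refine exists_goodOffspring hU hN hr F A.carrier _ (A.n + 1) (fun n j h => h.1) ?_
  intro P _ _ t _
  obtain ⟨j₀, hj₀⟩ := exists_forall_sep hN hr (A.n + 1) P t
  -- For one level up, `cellLE_of_le` asks that 4r^{-j'} ≤ θ r^{-j}: one factor 2 is in that lemma,
  -- the other is 2^{n+1}/2^n.
  obtain ⟨m, hm⟩ := pow_unbounded_of_one_lt (4 : ℝ) hr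
  refine ⟨max j₀ (jA + m), hj₀ _ (le_max_left _ _), Nat.lt_succ_self _, ?_⟩
  have hr0 : 0 < r := by linarith
  apply cellLE_of_le hN hr0
  have h1 : r ^ (-max j₀ (jA + m)) ≤ r ^ (-(jA + m)) :=
    zpow_le_zpow_right₀ hr.le (neg_le_neg (le_max_right _ _))
  have h2 : r ^ (-(jA + m)) * r ^ m = r ^ (-jA) := by
    rw [← zpow_natCast r m, ← zpow_add₀ hr0.ne']; congr 1; ring
  have h3 : 0 < r ^ (-(jA + m)) := by positivity
  have h4 : 4 * r ^ (-max j₀ (jA + m)) ≤ r ^ (-jA) := by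
    rw [← h2]; nlinarith
  have h5 : (0 : ℝ) < 2 ^ A.n := by positivity
  have h6 : 0 < 2 ^ A.n * r ^ (-jA) := by positivity
  have h7 := hN.one_lt
  rw [pow_succ, pow_one]
  nlinarith

/-- The condition `j ≥ j̃₀` on the first generation. -/
def rootAdm (U : ℕ → ℝ → ℝ) (r : ℝ) (T : Set Ell2) (_ : ℕ) (j : ℤ) : Prop :=
  ∀ i : ℤ, (∀ s ∈ T, ∀ t ∈ T, phiBar U r i s t ≤ 1) → i ≤ j

/-- If φ̄_i ≤ 1 on T for some i > j, then s - t lies in 4r^{-i}B(2^n), against the separation at j.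
So the condition at the root is automatic for separated families. -/
lemma rootAdm_of_sep {T : Set Ell2} {n : ℕ} {j : ℤ} {s t : Ell2} (hs : s ∈ T) (ht : t ∈ T)
    (h : Sep (scaleNorm U) r n j s t) : rootAdm U r T n j := by
  intro i hi
  by_contra! hlt
  have h1 := hi s hs t ht
  have h2 : phiBar U r i s t ≤ ENNReal.ofReal (2 ^ n) := by
    refine h1.trans ?_
    rw [← IsYoungFamily.two_pow_eq]
    exact one_le_pow₀ (by norm_num)
  rw [hU.phiBar_le_iff (by linarith) (by positivity)] at h2
  unfold Sep at h
  have h3 : r ^ j * scaleNorm U n (s - t) ≤ r ^ i * scaleNorm U n (s - t) :=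
    mul_le_mul_of_nonneg_right (zpow_le_zpow_right₀ hr.le hlt.le) (hN.nonneg _ _)
  have h4 : scaleNorm U n (s - t) = normN U (2 ^ n) (s - t) := rfl
  rw [← h4] at h2
  linarith

lemma exists_goodOffspring_root (F : Finset Ell2) (T : Set Ell2) :
    ∃ n C, GoodOffspring U r F T (rootAdm U r T) n C := by
  obtain ⟨n, C, -, h⟩ := exists_goodOffspring hU hN hr F T (rootAdm U r T) 0
    (fun _ _ _ => Nat.zero_le _) (by
      intro P hP hcard t ht
      obtain ⟨j₀, hj₀⟩ := exists_forall_sep hN hr 0 P t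
      refine ⟨j₀, hj₀ _ le_rfl, ?_⟩
      obtain ⟨t', ht', hne⟩ := Finset.exists_mem_ne hcard t
      exact rootAdm_of_sep hU hN hr (hP ht) (hP ht') (hj₀ _ le_rfl t' ht' hne))
  exact ⟨n, C, h⟩

end Offspring

/-! ### The tree of optimal choices and its branches -/

section Construction

variable {U : ℕ → ℝ → ℝ} {C θ r : ℝ} (hU : IsYoungFamily U C) (hN : IsScaleNorm (scaleNorm U) θ)
  (hr : 1 < r)

/-- A system of good families of children for `T` and for all nodes. -/
structure GoodSystem (U : ℕ → ℝ → ℝ) (r : ℝ) (F : Finset Ell2) (T : Set Ell2)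
    (c : Option Node → Set Node) : Prop where
  root : ∃ n, GoodOffspring U r F T (rootAdm U r T) n (c none)
  leaf : ∀ A : Node, A.j = ⊤ → c (some A) = ∅
  step : ∀ (A : Node) (jA : ℤ), A.j = jA → ∃ n, A.n + 1 ≤ n ∧
    GoodOffspring U r F A.carrier (nestedNext (scaleNorm U) r A.n jA) n (c (some A))

include hU hN hr in
lemma exists_goodSystem (F : Finset Ell2) (T : Set Ell2) : ∃ c, GoodSystem U r F T c := by
  obtain ⟨n₀, C₀, h₀⟩ := exists_goodOffspring_root hU hN hr F T
  have h : ∀ A : Node, ∃ C : Set Node, (A.j = ⊤ → C = ∅) ∧ ∀ jA : ℤ, A.j = jA → ∃ n, A.n + 1 ≤ n ∧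
      GoodOffspring U r F A.carrier (nestedNext (scaleNorm U) r A.n jA) n C := by
    rintro ⟨S, n, j⟩
    cases j with
    | top => exact ⟨∅, fun _ => rfl, fun jA h => (WithTop.coe_ne_top h.symm).elim⟩
    | coe j =>
      obtain ⟨n', C', hn, hC⟩ := exists_goodOffspring_node hU hN hr F ⟨S, n, j⟩ j
      refine ⟨C', fun h => (WithTop.coe_ne_top h).elim, fun jA h => ?_⟩
      have : j = jA := WithTop.coe_injective h
      subst this
      exact ⟨n', hn, hC⟩
  choose c hc using h
  refine ⟨fun o => o.elim C₀ c, ⟨n₀, h₀⟩, fun A hA => (hc A).1 hA, fun A jA hA => (hc A).2 jA hA⟩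

variable {F : Finset Ell2} {T : Set Ell2} {c : Option Node → Set Node}

/-- The iterative organized tree generated by a good system. -/
def GoodSystem.tree (h : GoodSystem U r F T c) (hU : IsYoungFamily U C) (hr : 1 < r) :
    IterativeOrganizedTree U r T where
  c := c
  root := by
    obtain ⟨n, hn⟩ := h.root
    exact ⟨n, hn.offspring⟩
  leaf := fun _ A _ hA => h.leaf A hA
  step := by
    intro k A _ jA hjA
    obtain ⟨n, hn, hC⟩ := h.step A jA hjA
    refine ⟨n, hn, ?_⟩
    have hA : A.n < n := hn
    have := hC.offspring
    have heq : nestedNext (scaleNorm U) r A.n jA n =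
        fun j => ballB U r j 0 (2 ^ n) ⊆ ballB U r jA 0 (2 ^ A.n) := by
      funext j
      simp only [nestedNext, hA, true_and, ballB_subset_iff hU hr]
    rwa [heq] at this

namespace GoodSystem

variable (h : GoodSystem U r F T c)
include h

/-- The children of a node form a good family. -/
lemma exists_good_of_mem {A B : Node} (hB : B ∈ c (some A)) : ∃ (jA : ℤ) (n : ℕ), A.j = jA ∧
    A.n + 1 ≤ n ∧
    GoodOffspring U r F A.carrier (nestedNext (scaleNorm U) r A.n jA) n (c (some A)) := by
  rcases hj : A.j with _ | j
  · rw [h.leaf A hj] at hB; exact hB.elim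
  · obtain ⟨n, hn, hC⟩ := h.step A j hj
    exact ⟨j, n, rfl, hn, hC⟩

lemma generation_spec (k : ℕ) : (generation c k).Finite ∧ ∀ A ∈ generation c k,
    k ≤ A.n ∧ A.carrier ⊆ T ∧ A.carrier.Nonempty ∧ (A.j = ⊤ → ∃ a, A.carrier = {a}) := by
  induction k with
  | zero =>
    obtain ⟨n, hn⟩ := h.root
    exact ⟨hn.finite, fun A hA => ⟨Nat.zero_le _, hn.carrier_subset A hA, hn.carrier_nonempty A hA,
      hn.leaf A hA⟩⟩
  | succ k ih =>
    constructor
    · refine ih.1.biUnion fun A hA => ?_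
      rcases (c (some A)).eq_empty_or_nonempty with he | ⟨B, hB⟩
      · rw [he]; exact Set.finite_empty
      · obtain ⟨_, _, _, _, hC⟩ := h.exists_good_of_mem hB
        exact hC.finite
    · intro B hB
      obtain ⟨A, hA, hBA⟩ := Set.mem_iUnion₂.1 hB
      obtain ⟨_, n, _, hn, hC⟩ := h.exists_good_of_mem hBA
      obtain ⟨h1, h2, _, _⟩ := ih.2 A hA
      refine ⟨?_, (hC.carrier_subset B hBA).trans h2, hC.carrier_nonempty B hBA, hC.leaf B hBA⟩
      rw [hC.n_eq B hBA]; omega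

open Classical in
/-- The part of the sum over a path that belongs to the children of `D`. -/
noncomputable def branchTerm (r : ℝ) (c : Option Node → Set Node) (t : Ell2) (D : Option Node) :
    ℝ≥0∞ :=
  ∑' A : c D,
    if t ∈ A.1.carrier then ENNReal.ofReal (Real.log (c D).ncard) * scale r A.1.j else 0

omit h in
lemma le_branchTerm {t : Ell2} {D : Option Node} {A : Node} (hA : A ∈ c D) (ht : t ∈ A.carrier) :
    ENNReal.ofReal (Real.log (c D).ncard) * scale r A.j ≤ branchTerm r c t D := by
  classical
  refine le_trans (le_of_eq ?_) (ENNReal.le_tsum (⟨A, hA⟩ : c D))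
  rw [if_pos ht]

omit h in
lemma nodeValue_of_coe {A : Node} {jA : ℤ} (hj : A.j = jA) : nodeValue U r F A =
    treeValue (scaleNorm U) r F A.carrier (nestedNext (scaleNorm U) r A.n jA) := by
  unfold nodeValue
  rw [hj]

/-- The inequality for the values is iterated along the branch. The parents are collected in a
finite set because the path sum is indexed by parents; the strict growth of n shows that a new
parent is not already in it. -/
lemma value_le_branch {t : Ell2} (k : ℕ) : ∀ A ∈ generation c k, t ∈ A.carrier →
    ∃ s : Finset (Option Node),
      (∀ D ∈ s, (D = none ∨ ∃ l, ∃ B ∈ generation c l, D = some B ∧ B.n < A.n)) ∧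
      treeValue (scaleNorm U) r F T (rootAdm U r T) ≤
        2 * ∑ D ∈ s, branchTerm r c t D + nodeValue U r F A := by
  classical
  induction k with
  | zero =>
    intro A hA ht
    obtain ⟨n, hn⟩ := h.root
    refine ⟨{none}, by simp, (hn.value_le A hA).trans ?_⟩
    rw [Finset.sum_singleton]
    gcongr
    exact le_branchTerm hA ht
  | succ k ih =>
    intro B hB ht
    obtain ⟨A, hA, hBA⟩ := Set.mem_iUnion₂.1 hB
    obtain ⟨jA, n, hjA, hn, hC⟩ := h.exists_good_of_mem hBA
    obtain ⟨s, hs, hle⟩ := ih A hA (hC.carrier_subset B hBA ht)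
    have hBn := hC.n_eq B hBA
    have hnot : some A ∉ s := by
      intro hmem
      rcases hs _ hmem with h0 | ⟨l, A', _, h1, h2⟩
      · cases h0
      · cases h1; exact lt_irrefl _ h2
    refine ⟨insert (some A) s, ?_, ?_⟩
    · intro D hD
      rcases Finset.mem_insert.1 hD with rfl | hD
      · exact Or.inr ⟨k, A, hA, rfl, by omega⟩
      · rcases hs D hD with h0 | ⟨l, A', h1, h2, h3⟩
        · exact Or.inl h0
        · exact Or.inr ⟨l, A', h1, h2, by omega⟩
    · rw [Finset.sum_insert hnot, mul_add]
      rw [nodeValue_of_coe hjA] at hle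
      refine (hle.trans (add_le_add le_rfl (hC.value_le B hBA))).trans ?_
      have := le_branchTerm (r := r) hBA ht
      calc _ = 2 * (ENNReal.ofReal (Real.log (c (some A)).ncard) * scale r B.j) +
            2 * ∑ D ∈ s, branchTerm r c t D + nodeValue U r F B := by ring
        _ ≤ _ := by gcongr

lemma sum_branchTerm_le (hU : IsYoungFamily U C) (hr : 1 < r) {t : Ell2} (s : Finset (Option Node))
    (hs : ∀ D ∈ s, (D = none ∨ ∃ l, ∃ B ∈ generation c l, D = some B)) :
    ∑ D ∈ s, branchTerm r c t D ≤ (h.tree hU hr).pathSum t := by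
  have heq : (h.tree hU hr).pathSum t =
      ∑' D : (h.tree hU hr).vertices, branchTerm r c t D := rfl
  rw [heq, tsum_subtype (h.tree hU hr).vertices (branchTerm r c t)]
  refine le_trans (le_of_eq ?_) (ENNReal.sum_le_tsum s)
  refine Finset.sum_congr rfl fun D hD => ?_
  rw [Set.indicator_of_mem]
  rcases hs D hD with rfl | ⟨l, B, hB, rfl⟩
  · exact Set.mem_insert _ _
  · exact Set.mem_insert_of_mem _ ⟨B, Set.mem_iUnion.2 ⟨l, hB⟩, rfl⟩

omit h in
lemma nodeValue_eq_zero_of_subsingleton {A : Node} (hA : A.carrier.Subsingleton) :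
    nodeValue U r F A = 0 := by
  unfold nodeValue
  split
  · rfl
  · refine treeValue_eq_zero fun n j P _ hP hc => ?_
    have h1 : P.card ≤ 1 := Finset.card_le_one.2 fun a ha b hb => hA (hP ha).1 (hP hb).1
    have := two_le_bigN n
    omega

-- All later families would need more than |F| points of F, as N_n > n.
omit h in
lemma nodeValue_eq_zero_of_card_le {A : Node} (hA : F.card ≤ A.n) : nodeValue U r F A = 0 := by
  unfold nodeValue
  split
  · rfl
  · refine treeValue_eq_zero fun n j P hadm hP hc => ?_
    have h1 : P.card ≤ F.card := Finset.card_le_card fun a ha => by simpa using (hP ha).2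
    have := lt_bigN n
    have := hadm.1
    omega

/-- Generations are finite, so infinitely many nodes reach arbitrarily late ones, and n is at least
the index of the generation. -/
lemma exists_infinite_node {t : Ell2}
    (hinf : {A | A ∈ ⋃ k, generation c k ∧ t ∈ A.carrier}.Infinite) (L : ℕ) :
    ∃ k, ∃ A ∈ generation c k, t ∈ A.carrier ∧ L ≤ A.n := by
  by_contra! hcon
  refine hinf (((Set.finite_Iio L).biUnion fun k _ => (h.generation_spec k).1).subset ?_)
  rintro A ⟨hA, ht⟩
  obtain ⟨k, hk⟩ := Set.mem_iUnion.1 hA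
  have h1 := hcon k A hk ht
  have h2 := ((h.generation_spec k).2 A hk).1
  exact Set.mem_iUnion₂.2 ⟨k, by simp only [Set.mem_Iio]; omega, hk⟩

/-- Either way of belonging to S_Γ provides a node of value 0 containing t, where the iterated
inequality stops. -/
lemma value_le_pathSum (hU : IsYoungFamily U C) (hr : 1 < r) {t : Ell2}
    (ht : t ∈ (h.tree hU hr).points) :
    treeValue (scaleNorm U) r F T (rootAdm U r T) ≤ 2 * (h.tree hU hr).pathSum t := by
  obtain ⟨k, A, hA, htA, hzero⟩ : ∃ k, ∃ A ∈ generation c k, t ∈ A.carrier ∧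
      nodeValue U r F A = 0 := by
    rcases ht.2 with ⟨A, hA, hAt⟩ | hinf
    · obtain ⟨k, hk⟩ := Set.mem_iUnion.1 hA
      exact ⟨k, A, hk, by rw [hAt]; rfl,
        nodeValue_eq_zero_of_subsingleton (by rw [hAt]; exact Set.subsingleton_singleton)⟩
    · obtain ⟨k, A, hA, htA, hL⟩ := h.exists_infinite_node hinf F.card
      exact ⟨k, A, hA, htA, nodeValue_eq_zero_of_card_le hL⟩
  obtain ⟨s, hs, hle⟩ := h.value_le_branch k A hA htA
  rw [hzero, add_zero] at hle
  refine hle.trans ?_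
  gcongr
  refine h.sum_branchTerm_le hU hr s fun D hD => ?_
  rcases hs D hD with h0 | ⟨l, B, h1, h2, _⟩
  · exact Or.inl h0
  · exact Or.inr ⟨l, B, h1, h2⟩

lemma mem_points_of_leaf (hU : IsYoungFamily U C) (hr : 1 < r) {k : ℕ} {A : Node}
    (hA : A ∈ generation c k) (hj : A.j = ⊤) : (h.tree hU hr).points.Nonempty := by
  obtain ⟨-, hT, -, hl⟩ := (h.generation_spec k).2 A hA
  obtain ⟨a, ha⟩ := hl hj
  exact ⟨a, hT (by rw [ha]; rfl), Or.inl ⟨A, Set.mem_iUnion.2 ⟨k, hA⟩, ha⟩⟩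

/-- A leaf supplies a point at once. Without leaves every generation is nonempty, and from
generation |F| on all values vanish. From there the first point of a node passes to a child forever.
-/
lemma points_nonempty (hU : IsYoungFamily U C) (hr : 1 < r) (hT : T.Nonempty) :
    (h.tree hU hr).points.Nonempty := by
  by_contra hcon
  have hleaf : ∀ k, ∀ A ∈ generation c k, ∃ jA : ℤ, A.j = jA := by
    intro k A hA
    rcases hj : A.j with _ | j
    · exact (hcon (h.mem_points_of_leaf hU hr hA hj)).elim
    · exact ⟨j, rfl⟩
  have hex : ∀ k, (generation c k).Nonempty := by
    intro k
    induction k with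
    | zero =>
      obtain ⟨n, hn⟩ := h.root
      exact hn.nonempty hT
    | succ k ih =>
      obtain ⟨A, hA⟩ := ih
      obtain ⟨jA, hjA⟩ := hleaf k A hA
      obtain ⟨n, _, hC⟩ := h.step A jA hjA
      obtain ⟨B, hB⟩ := hC.nonempty ((h.generation_spec k).2 A hA).2.2.1
      exact ⟨B, Set.mem_iUnion₂.2 ⟨A, hA, hB⟩⟩
  obtain ⟨A₀, hA₀⟩ := hex F.card
  obtain ⟨a, ha⟩ := exists_isFirst ((h.generation_spec F.card).2 A₀ hA₀).2.2.1
  have hpath : ∀ m, ∃ B ∈ generation c (F.card + m), IsFirst a B.carrier := by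
    intro m
    induction m with
    | zero => exact ⟨A₀, hA₀, ha⟩
    | succ m ih =>
      obtain ⟨B, hB, haB⟩ := ih
      obtain ⟨jB, hjB⟩ := hleaf _ B hB
      obtain ⟨n, _, hC⟩ := h.step B jB hjB
      have h0 : nodeValue U r F B = 0 :=
        nodeValue_eq_zero_of_card_le (le_trans (by omega) ((h.generation_spec _).2 B hB).1)
      rw [nodeValue_of_coe hjB] at h0
      obtain ⟨D, hD, haD⟩ := hC.first h0 a haB
      exact ⟨D, Set.mem_iUnion₂.2 ⟨B, hB, hD⟩, haB.subset (hC.carrier_subset D hD) haD⟩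
  refine hcon ⟨a, ((h.generation_spec _).2 A₀ hA₀).2.1 ha.1, Or.inr fun hfin => ?_⟩
  -- Finitely many nodes would have bounded n, while n exceeds every bound along the path.
  obtain ⟨M, hM⟩ := (hfin.image Node.n).bddAbove
  obtain ⟨B, hB, haB⟩ := hpath (M + 1)
  have h1 := hM ⟨B, ⟨Set.mem_iUnion.2 ⟨_, hB⟩, haB.1⟩, rfl⟩
  have h2 := ((h.generation_spec _).2 B hB).1
  omega

end GoodSystem

include hU hN hr in
/-- The size of `T` controls the values of the nested trees with points in a finite subset. -/
lemma treeValue_le_size (hF : (F : Set Ell2) ⊆ T) (hne : F.Nonempty) :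
    treeValue (scaleNorm U) r F T (rootAdm U r T) ≤ 2 * size U r T := by
  have hT : T.Nonempty := by
    obtain ⟨a, ha⟩ := hne
    exact ⟨a, hF ha⟩
  obtain ⟨c, h⟩ := exists_goodSystem hU hN hr F T
  have h1 : (h.tree hU hr).rho ≤ size U r T :=
    le_iSup₂ (f := fun (Γ : IterativeOrganizedTree U r T) (_ : Γ.points.Nonempty) => Γ.rho)
      (h.tree hU hr) (h.points_nonempty hU hr hT)
  have h2 : treeValue (scaleNorm U) r F T (rootAdm U r T) / 2 ≤ (h.tree hU hr).rho :=
    le_iInf₂ fun t ht => ENNReal.div_le_of_le_mul' (h.value_le_pathSum hU hr ht)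
  have h3 := h2.trans h1
  rwa [ENNReal.div_le_iff_le_mul (by simp) (by simp), mul_comm] at h3

include hU hN hr in
lemma Tree.ofReal_le_size {y κ q : ℝ} (hq : q = θ⁻¹) (hκ : κ = 2 * q / (1 - q))
    (hF : (F : Set Ell2) ⊆ T) (hne : F.Nonempty)
    (h : Tree (scaleNorm U) r freeNext (F : Set Ell2) (fun _ _ => True) y) :
    ENNReal.ofReal y ≤ ENNReal.ofReal (2 * (1 + κ)) * size U r T := by
  have hθ := hN.one_lt
  have hr0 : 0 < r := by linarith
  have hq0 : 0 < q := by rw [hq]; have : 0 < θ := by linarith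
                         positivity
  have hq1 : q < 1 := by rw [hq]; exact inv_lt_one_of_one_lt₀ hθ
  have hκ0 : 0 < κ := by rw [hκ]; have := sub_pos.2 hq1; positivity
  rcases h.exists_nested hN hr0 hq hκ 0 (fun _ _ _ => Nat.zero_le _) with h0 | ⟨n, j, z, -, hz, hle⟩
  · rw [ENNReal.ofReal_eq_zero.2 h0]; exact bot_le
  · have h1 : Tree (scaleNorm U) r (nestedNext (scaleNorm U) r) (T ∩ F) (rootAdm U r T) z := by
      rw [Set.inter_eq_self_of_subset_right hF]
      cases hz with
      | zero _ _ _ hx => exact .zero _ _ _ hx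
      | node _ _ n j P x _ _ hP hc hsep hch hzx =>
        have hP1 : 1 < P.card := by rw [hc]; exact two_le_bigN n
        obtain ⟨t, ht⟩ := Finset.card_pos.1 (zero_lt_one.trans hP1)
        obtain ⟨t', ht', hne'⟩ := Finset.exists_mem_ne hP1 t
        exact .node _ _ n j P x _ (rootAdm_of_sep hU hN hr (hF (hP ht)) (hF (hP ht'))
          (hsep t ht t' ht' hne')) hP hc hsep hch hzx
    have h2 := (le_treeValue h1).trans (treeValue_le_size hU hN hr hF hne)
    have h3 : y ≤ (1 + κ) * z := by
      have : 0 ≤ κ * (2 ^ n * r ^ (-j)) * q ^ (n - 0) := by positivity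
      linarith
    calc ENNReal.ofReal y ≤ ENNReal.ofReal ((1 + κ) * z) := ENNReal.ofReal_le_ofReal h3
      _ = ENNReal.ofReal (1 + κ) * ENNReal.ofReal z := ENNReal.ofReal_mul (by positivity)
      _ ≤ ENNReal.ofReal (1 + κ) * (2 * size U r T) := by gcongr
      _ = ENNReal.ofReal (2 * (1 + κ)) * size U r T := by
        rw [ENNReal.ofReal_mul (by norm_num)]
        norm_num
        ring

end Construction

/-! ### Splitting sets -/

section FreeValue

variable {E : Type*} [AddCommGroup E] {N : ℕ → E → ℝ} {θ r : ℝ}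

/-- The supremum of the values of the trees on `A` in which the first parameter increases, starting
at `n` at least. -/
noncomputable def freeValue (N : ℕ → E → ℝ) (r : ℝ) (A : Set E) (n : ℕ) : ℝ≥0∞ :=
  ⨆ (y : ℝ) (_ : Tree N r freeNext A (fun n' _ => n ≤ n') y), ENNReal.ofReal y

lemma le_freeValue {A : Set E} {n : ℕ} {y : ℝ} (h : Tree N r freeNext A (fun n' _ => n ≤ n') y) :
    ENNReal.ofReal y ≤ freeValue N r A n :=
  le_iSup₂ (f := fun (y : ℝ) (_ : Tree N r freeNext A (fun n' _ => n ≤ n') y) =>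
    ENNReal.ofReal y) y h

lemma freeValue_mono {A B : Set E} {m n : ℕ} (hAB : A ⊆ B) (hmn : m ≤ n) :
    freeValue N r A n ≤ freeValue N r B m :=
  iSup₂_le fun _ hy => le_freeValue (hy.mono hAB (fun _ _ h => hmn.trans h) le_rfl)

lemma add_le_freeValue (hr : 0 < r) {A : Set E} {n m : ℕ} (hnm : n ≤ m) {j : ℤ} {P : Finset E}
    (hPA : (P : Set E) ⊆ A)
    (hP : P.card = bigN m) (hsep : ∀ t ∈ P, ∀ t' ∈ P, t' ≠ t → Sep N r m j t t') {v : ℝ≥0∞}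
    (hv : ∀ t ∈ P, v ≤ freeValue N r (A ∩ cell N r m j t) (m + 1)) :
    ENNReal.ofReal (2 ^ m * r ^ (-j)) + v ≤ freeValue N r A n := by
  have ha : (0 : ℝ) ≤ 2 ^ m * r ^ (-j) := by positivity
  -- The one-step tree shows that the truncated subtraction below is a true one.
  have h0 : ENNReal.ofReal (2 ^ m * r ^ (-j)) ≤ freeValue N r A n :=
    le_freeValue (.node _ _ m j P 0 _ hnm hPA hP hsep (fun _ _ => .zero _ _ _ le_rfl) (by simp))
  have h1 : v ≤ freeValue N r A n - ENNReal.ofReal (2 ^ m * r ^ (-j)) := by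
    refine le_of_forall_lt_imp_le_of_dense fun c hc => ?_
    refine ENNReal.le_sub_of_add_le_left ENNReal.ofReal_ne_top ?_
    have hct : c ≠ ⊤ := hc.ne_top
    rw [← ENNReal.ofReal_toReal hct, ← ENNReal.ofReal_add ha ENNReal.toReal_nonneg]
    refine le_freeValue (.node _ _ m j P c.toReal _ hnm hPA hP hsep (fun t ht => ?_) le_rfl)
    obtain ⟨y, hy⟩ := lt_iSup_iff.1 (hc.trans_le (hv t ht))
    obtain ⟨hy1, hlt⟩ := lt_iSup_iff.1 hy
    refine hy1.mono subset_rfl (fun _ _ h => h) ?_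
    rw [← ENNReal.ofReal_toReal hct] at hlt
    exact (ENNReal.lt_ofReal_iff_toReal_lt ENNReal.ofReal_ne_top).1 hlt |>.le |> fun h => by
      rwa [ENNReal.toReal_ofReal ENNReal.toReal_nonneg] at h
  exact (add_le_add le_rfl h1).trans_eq (add_tsub_cancel_of_le h0)

open Classical in
/-- Greedy selection of at most `k` separated points. -/
lemma exists_greedy {E : Type*} (D : Finset E) (w : Set E → ℝ≥0∞) (hw : Monotone w)
    (big : E → E → Prop) (hrefl : ∀ t, big t t)
    (hsymm : ∀ s t, big s t → big t s) (small : E → Set E) (k : ℕ) :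
    ∃ P R : Finset E, P ⊆ D ∧ P.card ≤ k ∧ (∀ p ∈ P, ∀ q ∈ P, q ≠ p → ¬ big p q) ∧
      (∀ t, t ∈ R ↔ t ∈ D ∧ ∀ p ∈ P, ¬ big t p) ∧
      (R = ∅ ∨ (P.card = k ∧ ∀ t ∈ R, ∀ p ∈ P, w (R ∩ small t) ≤ w (D ∩ small p))) := by
  induction k with
  | zero => exact ⟨∅, D, by simp, by simp, by simp, by simp, Or.inr (by simp)⟩
  | succ k ih =>
    obtain ⟨P, R, hPD, hcard, hsep, hR, hdich⟩ := ih
    rcases R.eq_empty_or_nonempty with he | hne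
    · exact ⟨P, R, hPD, hcard.trans (Nat.le_succ k), hsep, hR, Or.inl he⟩
    · obtain ⟨hk, hle⟩ := hdich.resolve_left hne.ne_empty
      -- Choosing q with the largest w near it ensures that no point left over has more weight near
      -- it than any selected point.
      obtain ⟨q, hq, hmax⟩ := R.exists_max_image (fun t => w (R ∩ small t)) hne
      have hqD : q ∈ D ∧ ∀ p ∈ P, ¬ big q p := (hR q).1 hq
      have hqP : q ∉ P := fun h => hqD.2 q h (hrefl q)
      refine ⟨insert q P, D.filter (fun t => ∀ p ∈ insert q P, ¬ big t p), ?_, ?_, ?_,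
        fun t => Finset.mem_filter, ?_⟩
      · exact Finset.insert_subset hqD.1 hPD
      · rw [Finset.card_insert_of_notMem hqP]; omega
      · intro p hp p' hp' hne'
        rcases Finset.mem_insert.1 hp with rfl | hp1 <;> rcases Finset.mem_insert.1 hp' with rfl | hp2
        · exact (hne' rfl).elim
        · exact hqD.2 _ hp2
        · exact fun h => hqD.2 _ hp1 (hsymm _ _ h)
        · exact hsep p hp1 p' hp2 hne'
      · right
        refine ⟨by rw [Finset.card_insert_of_notMem hqP, hk], ?_⟩
        have hsub : D.filter (fun t => ∀ p ∈ insert q P, ¬ big t p) ⊆ R := by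
          intro t ht
          rw [Finset.mem_filter] at ht
          exact (hR t).2 ⟨ht.1, fun p hp => ht.2 p (Finset.mem_insert_of_mem hp)⟩
        have hRD : R ⊆ D := fun t ht => ((hR t).1 ht).1
        intro t ht p hp
        have h1 : w ((D.filter (fun t => ∀ p ∈ insert q P, ¬ big t p) : Finset E) ∩ small t) ≤
            w (R ∩ small t) := hw (Set.inter_subset_inter_left _ (by exact_mod_cast hsub))
        refine h1.trans ?_
        rcases Finset.mem_insert.1 hp with rfl | hp
        · exact (hmax t (hsub ht)).trans
            (hw (Set.inter_subset_inter_left _ (by exact_mod_cast hRD)))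
        · exact hle t (hsub ht) p hp

-- Any point t of the remainder completes the greedily selected points to a separated family of
-- N_{n+1} points. By the greedy choice the functional near each of them is at least that of R near
-- t, so a tree can be prolonged by this family.
open Classical in
lemma exists_split (hN : IsScaleNorm N θ) (hr : 0 < r) (D : Finset E) (n : ℕ) (j : ℤ) :
    ∃ P R : Finset E, P ⊆ D ∧ R ⊆ D ∧ P.card < bigN (n + 1) ∧
      (∀ t ∈ D, t ∈ R ∨ ∃ p ∈ P, ¬ Sep N r (n + 1) (j + 1) t p) ∧
      (∀ t ∈ R, bigN (n + 1) ≤ D.card ∧ ENNReal.ofReal (2 ^ (n + 1) * r ^ (-(j + 1))) +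
        freeValue N r (R ∩ cell N r (n + 1) (j + 1) t) (n + 2) ≤ freeValue N r D (n + 1)) := by
  have hsymm : ∀ s t, ¬ Sep N r (n + 1) (j + 1) s t → ¬ Sep N r (n + 1) (j + 1) t s := by
    intro s t h; unfold Sep at h ⊢; rwa [hN.sub_comm]
  have hrefl : ∀ t : E, ¬ Sep N r (n + 1) (j + 1) t t := by
    intro t
    unfold Sep
    rw [sub_self, hN.zero, mul_zero, not_lt]
    positivity
  obtain ⟨P, R, hPD, hcard, hsep, hR, hdich⟩ := exists_greedy D (fun A => freeValue N r A (n + 2))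
    (fun A B h => freeValue_mono h le_rfl) (fun s t => ¬ Sep N r (n + 1) (j + 1) s t) hrefl hsymm
    -- One point short of N_{n+1}: the last one is supplied by the remainder.
    (fun t => cell N r (n + 1) (j + 1) t) (bigN (n + 1) - 1)
  have hb := two_le_bigN (n + 1)
  refine ⟨P, R, hPD, fun t ht => ((hR t).1 ht).1, by omega, ?_, ?_⟩
  · intro t ht
    by_cases h : ∃ p ∈ P, ¬ Sep N r (n + 1) (j + 1) t p
    · exact Or.inr h
    · left
      exact (hR t).2 ⟨ht, fun p hp hn => h ⟨p, hp, hn⟩⟩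
  · intro t ht
    obtain ⟨hk, hle⟩ := hdich.resolve_left (Finset.ne_empty_of_mem ht)
    have htD : t ∈ D ∧ ∀ p ∈ P, ¬ ¬ Sep N r (n + 1) (j + 1) t p := (hR t).1 ht
    have htP : t ∉ P := fun h => htD.2 t h (hrefl t)
    have hsub : insert t P ⊆ D := Finset.insert_subset htD.1 hPD
    have hcard' : (insert t P).card = bigN (n + 1) := by
      rw [Finset.card_insert_of_notMem htP]; omega
    refine ⟨hcard' ▸ Finset.card_le_card hsub, ?_⟩
    refine add_le_freeValue hr le_rfl (by exact_mod_cast hsub) hcard' ?_ ?_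
    · intro p hp q hq hne
      rcases Finset.mem_insert.1 hp with rfl | hp1 <;> rcases Finset.mem_insert.1 hq with rfl | hq1
      · exact (hne rfl).elim
      · exact not_not.1 (htD.2 _ hq1)
      · by_contra hc
        exact htD.2 _ hp1 (hsymm _ _ hc)
      · exact not_not.1 (hsep p hp1 q hq1 hne)
    · intro p hp
      rcases Finset.mem_insert.1 hp with rfl | hp
      · refine freeValue_mono (Set.inter_subset_inter_left _ ?_) le_rfl
        exact fun u hu => ((hR u).1 hu).1
      · exact hle t ht p hp

end FreeValue

/-! ### Trajectories -/

section Trajectory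

variable {E : Type*} [AddCommGroup E] {N : ℕ → E → ℝ} {θ r : ℝ}

/-- A finite set with a scale and a centre. -/
structure ChainState (E : Type*) where
  /-- the set -/
  D : Finset E
  /-- the scale -/
  j : ℤ
  /-- the centre -/
  z : E

/-- The centres used in splitting a set, and the remainder, are chosen by `splitting`. -/
structure IsSplitting (N : ℕ → E → ℝ) (r : ℝ) (P R : Finset E → ℕ → ℤ → Finset E) : Prop where
  subset : ∀ D n j, P D n j ⊆ D
  rest_subset : ∀ D n j, R D n j ⊆ D
  card_lt : ∀ D n j, (P D n j).card < bigN (n + 1)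
  cover : ∀ D n j, ∀ t ∈ D, t ∈ R D n j ∨ ∃ p ∈ P D n j, ¬ Sep N r (n + 1) (j + 1) t p
  rest : ∀ D n j, ∀ t ∈ R D n j, bigN (n + 1) ≤ D.card ∧
    ENNReal.ofReal (2 ^ (n + 1) * r ^ (-(j + 1))) +
      freeValue N r (R D n j ∩ cell N r (n + 1) (j + 1) t) (n + 2) ≤ freeValue N r D (n + 1)

lemma exists_isSplitting (hN : IsScaleNorm N θ) (hr : 0 < r) : ∃ P R, IsSplitting N r P R := by
  choose P R h using exists_split (N := N) hN hr
  exact ⟨P, R, ⟨fun D n j => (h D n j).1, fun D n j => (h D n j).2.1, fun D n j => (h D n j).2.2.1,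
    fun D n j => (h D n j).2.2.2.1, fun D n j => (h D n j).2.2.2.2⟩⟩

open Classical in
/-- The piece with centre `p`. -/
noncomputable def piece (N : ℕ → E → ℝ) (r : ℝ) (n : ℕ) (s : ChainState E) (p : E) :
    ChainState E :=
  ⟨s.D.filter (fun t => ¬ Sep N r (n + 1) (s.j + 1) t p), s.j + 1, p⟩

/-- The remainder of a splitting. -/
def restState (R : Finset E → ℕ → ℤ → Finset E) (n : ℕ) (s : ChainState E) : ChainState E :=
  ⟨R s.D n s.j, s.j, s.z⟩

open Classical in
/-- The part of the splitting containing `t`. -/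
noncomputable def nextState (N : ℕ → E → ℝ) (r : ℝ) (P R : Finset E → ℕ → ℤ → Finset E) (t : E)
    (n : ℕ) (s : ChainState E) : ChainState E :=
  if h : t ∉ R s.D n s.j ∧ ∃ p ∈ P s.D n s.j, ¬ Sep N r (n + 1) (s.j + 1) t p then
    piece N r n s h.2.choose
  else restState R n s

/-- The sequence of sets containing `t` that starts with `s` at level `n`. -/
noncomputable def traj (N : ℕ → E → ℝ) (r : ℝ) (P R : Finset E → ℕ → ℤ → Finset E) (t : E) :
    ℕ → ℕ → ChainState E → ChainState E
  | 0, _, s => s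
  | k + 1, n, s => traj N r P R t k (n + 1) (nextState N r P R t n s)

lemma traj_succ {P R : Finset E → ℕ → ℤ → Finset E} {t : E} (k n : ℕ) (s : ChainState E) :
    traj N r P R t (k + 1) n s = nextState N r P R t (n + k) (traj N r P R t k n s) := by
  induction k generalizing n s with
  | zero => rfl
  | succ k ih =>
    rw [traj, ih, traj]
    congr 1
    omega

/-- The weight `2^n r^{-j}` of a state at level `n`. -/
noncomputable def weight (r : ℝ) (n : ℕ) (s : ChainState E) : ℝ := 2 ^ n * r ^ (-s.j)

omit [AddCommGroup E] in
lemma weight_pos (hr : 0 < r) (n : ℕ) (s : ChainState E) : 0 < weight r n s := by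
  unfold weight; positivity

/-- At level `n` the set of the state is contained in a ball around its centre. -/
def ChainState.Valid (N : ℕ → E → ℝ) (r : ℝ) (n : ℕ) (s : ChainState E) : Prop :=
  ∀ t ∈ s.D, N n (t - s.z) ≤ 4 * weight r n s

variable {P R : Finset E → ℕ → ℤ → Finset E}

lemma not_sep_iff (hr : 0 < r) {n : ℕ} {j : ℤ} {s t : E} :
    ¬ Sep N r n j s t ↔ N n (s - t) ≤ 4 * (2 ^ n * r ^ (-j)) := by
  have hj : 0 < r ^ j := by positivity
  unfold Sep
  rw [not_lt, zpow_neg, ← mul_assoc, ← div_eq_mul_inv, le_div_iff₀ hj, mul_comm]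

lemma piece_valid (hr : 0 < r) (n : ℕ) (s : ChainState E) (p : E) :
    (piece N r n s p).Valid N r (n + 1) := by
  classical
  intro t ht
  exact (not_sep_iff hr).1 (Finset.mem_filter.1 ht).2

lemma restState_valid (hN : IsScaleNorm N θ) (hS : IsSplitting N r P R) {n : ℕ} {s : ChainState E}
    (hs : s.Valid N r n) : (restState R n s).Valid N r (n + 1) := by
  intro t ht
  have h1 := hs t (hS.rest_subset _ _ _ ht)
  have h2 := hN.double n (t - s.z)
  have h3 : weight r (n + 1) (restState R n s) = 2 * weight r n s := by
    unfold weight restState; ring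
  rw [h3]
  change N (n + 1) (t - s.z) ≤ _
  linarith

/-- A point of `D` passes either to a piece or to the remainder. -/
lemma nextState_cases (hS : IsSplitting N r P R) {t : E} {n : ℕ} {s : ChainState E}
    (ht : t ∈ s.D) :
    (∃ p ∈ P s.D n s.j, nextState N r P R t n s = piece N r n s p ∧ t ∈ (piece N r n s p).D) ∨
    (nextState N r P R t n s = restState R n s ∧ t ∈ (restState R n s).D) := by
  classical
  by_cases h : t ∉ R s.D n s.j ∧ ∃ p ∈ P s.D n s.j, ¬ Sep N r (n + 1) (s.j + 1) t p
  · left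
    refine ⟨h.2.choose, h.2.choose_spec.1, by rw [nextState, dif_pos h], ?_⟩
    exact Finset.mem_filter.2 ⟨ht, h.2.choose_spec.2⟩
  · right
    refine ⟨by rw [nextState, dif_neg h], ?_⟩
    by_contra hc
    exact h ⟨hc, (hS.cover s.D n s.j t ht).resolve_left hc⟩

lemma traj_spec (hN : IsScaleNorm N θ) (hr : 0 < r) (hS : IsSplitting N r P R) {t : E}
    {s : ChainState E} (ht : t ∈ s.D) {n : ℕ} (hs : s.Valid N r n) (k : ℕ) :
    t ∈ (traj N r P R t k n s).D ∧ (traj N r P R t k n s).Valid N r (n + k) := by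
  induction k with
  | zero => exact ⟨ht, hs⟩
  | succ k ih =>
    rw [traj_succ]
    rcases nextState_cases hS (n := n + k) ih.1 with ⟨p, _, h1, h2⟩ | ⟨h1, h2⟩
    · rw [h1]; exact ⟨h2, piece_valid hr _ _ _⟩
    · rw [h1]; exact ⟨h2, restState_valid hN hS ih.2⟩

lemma traj_subset (hN : IsScaleNorm N θ) (hr : 0 < r) (hS : IsSplitting N r P R) {t : E}
    {s : ChainState E} (ht : t ∈ s.D) {n : ℕ} (hs : s.Valid N r n) :
    Antitone fun k => (traj N r P R t k n s).D := by
  classical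
  refine antitone_nat_of_succ_le fun k => ?_
  rw [traj_succ]
  rcases nextState_cases hS (n := n + k) (traj_spec hN hr hS ht hs k).1 with
    ⟨p, _, h1, _⟩ | ⟨h1, _⟩
  · rw [h1]; exact Finset.filter_subset _ _
  · rw [h1]; exact hS.rest_subset _ _ _

/-- The weights and values along a trajectory. -/
lemma traj_step (hN : IsScaleNorm N θ) (hr : 0 < r) (hS : IsSplitting N r P R) {t : E}
    {s : ChainState E} (ht : t ∈ s.D) (hs : s.Valid N r 0) (k : ℕ) :
    let x : ℕ → ℝ := fun k => weight r k (traj N r P R t k 0 s)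
    let g : ℕ → ℝ≥0∞ := fun k => freeValue N r (traj N r P R t k 0 s).D k
    x (k + 1) = 2 / r * x k ∨
      (bigN (k + 1) ≤ s.D.card ∧ ∀ m, 1 ≤ m → 16 * r * x (k + 1 + m) ≤ θ ^ m * x (k + 1) →
        ENNReal.ofReal (x (k + 1) / r) + g (k + 1 + m) ≤ g k) := by
  intro x g
  have hk := traj_spec hN hr hS ht hs k
  rw [zero_add] at hk
  have hanti := traj_subset hN hr hS ht hs
  set S := traj N r P R t k 0 s with hSdef
  have hsucc : traj N r P R t (k + 1) 0 s = nextState N r P R t k S := by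
    rw [traj_succ, zero_add]
  rcases nextState_cases hS (n := k) hk.1 with ⟨p, _, h1, _⟩ | ⟨h1, h2⟩
  · left
    change weight r (k + 1) (traj N r P R t (k + 1) 0 s) = 2 / r * weight r k S
    rw [hsucc, h1]
    unfold weight piece
    rw [neg_add, zpow_add₀ hr.ne', zpow_neg_one, pow_succ]
    field_simp
  · right
    have hrest := hS.rest S.D k S.j
    refine ⟨(hrest t h2).1.trans (Finset.card_le_card (hanti (Nat.zero_le k))), ?_⟩
    intro m hm hle
    have hx : x (k + 1) = 2 ^ (k + 1) * r ^ (-S.j) := by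
      change weight r (k + 1) (traj N r P R t (k + 1) 0 s) = _
      rw [hsucc, h1]; rfl
    have hxr : x (k + 1) / r = 2 ^ (k + 1) * r ^ (-(S.j + 1)) := by
      rw [hx, neg_add, zpow_add₀ hr.ne', zpow_neg_one]; field_simp
    have hspec := traj_spec hN hr hS ht hs (k + 1 + m)
    rw [zero_add] at hspec
    have hsub : (traj N r P R t (k + 1 + m) 0 s).D ⊆ R S.D k S.j := by
      have := hanti (show k + 1 ≤ k + 1 + m by omega)
      simp only [hsucc, h1] at this
      exact this
    -- Later points are within 8x_{k+1+m} of t in N_{k+1+m}, through the common centre. Growth costs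
    -- another factor 2, whence the 16 in the hypothesis.
    have hcell : ((traj N r P R t (k + 1 + m) 0 s).D : Set E) ⊆
        R S.D k S.j ∩ cell N r (k + 1) (S.j + 1) t := by
      intro u hu
      refine ⟨hsub hu, ?_⟩
      have h3 := hN.sub_le (k + 1 + m) u t (traj N r P R t (k + 1 + m) 0 s).z
      have h4 := hspec.2 u hu
      have h5 := hspec.2 t hspec.1
      have h6 := hN.growth (k + 1) m (u - t)
      have h7 : 0 < θ ^ m := pow_pos (zero_lt_one.trans hN.one_lt) _
      have h8 : θ ^ m * N (k + 1) (u - t) ≤ θ ^ m * (x (k + 1) / r) := by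
        have h9 : 16 * x (k + 1 + m) ≤ θ ^ m * (x (k + 1) / r) := by
          rw [← mul_div_assoc, le_div_iff₀ hr]; linarith
        have h10 : x (k + 1 + m) = weight r (k + 1 + m) (traj N r P R t (k + 1 + m) 0 s) := rfl
        rw [← h10] at h4 h5
        linarith
      have h9 := le_of_mul_le_mul_left h8 h7
      rw [hxr, zpow_neg, ← div_eq_mul_inv, le_div_iff₀ (by positivity)] at h9
      rw [mem_cell]; linarith
    calc ENNReal.ofReal (x (k + 1) / r) + g (k + 1 + m)
        ≤ ENNReal.ofReal (2 ^ (k + 1) * r ^ (-(S.j + 1))) +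
          freeValue N r (R S.D k S.j ∩ cell N r (k + 1) (S.j + 1) t) (k + 2) := by
            rw [hxr]
            exact add_le_add le_rfl (freeValue_mono hcell (by omega))
      _ ≤ freeValue N r S.D (k + 1) := (hrest t h2).2
      _ ≤ g k := freeValue_mono subset_rfl (Nat.le_succ k)

end Trajectory

/-! ### Sums along trajectories -/

lemma geom_sum_le {β : ℝ} (h0 : 0 ≤ β) (h1 : β < 1) (n : ℕ) :
    ∑ i ∈ Finset.range n, β ^ i ≤ 1 / (1 - β) := by
  rw [one_div, ← tsum_geometric_of_lt_one h0 h1]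
  exact (summable_geometric_of_lt_one h0 h1).sum_le_tsum _ (fun _ _ => by positivity)

lemma sum_pow_dist_le {β : ℝ} (h0 : 0 ≤ β) (h1 : β < 1) (p m : ℕ) :
    ∑ k ∈ Finset.range m, β ^ ((p - k) + (k - p)) ≤ 2 / (1 - β) := by
  have h2 : ∑ k ∈ Finset.range m, β ^ ((p - k) + (k - p)) ≤
      ∑ k ∈ Finset.range (p + 1 + m), β ^ ((p - k) + (k - p)) :=
    Finset.sum_le_sum_of_subset_of_nonneg (Finset.range_mono (by omega))
      (fun _ _ _ => by positivity)
  refine h2.trans ?_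
  rw [Finset.sum_range_add]
  have h3 : ∑ k ∈ Finset.range (p + 1), β ^ ((p - k) + (k - p)) ≤ 1 / (1 - β) := by
    rw [← Finset.sum_range_reflect]
    refine le_trans (le_of_eq (Finset.sum_congr rfl fun k hk => ?_)) (geom_sum_le h0 h1 (p + 1))
    rw [Finset.mem_range] at hk
    congr 1
    omega
  have h4 : ∑ k ∈ Finset.range m, β ^ ((p - (p + 1 + k)) + (p + 1 + k - p)) ≤ 1 / (1 - β) := by
    refine le_trans (Finset.sum_le_sum fun k _ => ?_) (geom_sum_le h0 h1 m)
    exact pow_le_pow_of_le_one h0 h1.le (by omega)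
  have : 2 / (1 - β) = 1 / (1 - β) + 1 / (1 - β) := by ring
  linarith

/-- As the drop of g skips e + 1 levels, the quantity that telescopes is the sum of e + 1
consecutive values of g. -/
lemma sum_le_of_telescope {f g : ℕ → ℝ≥0∞} {e : ℕ} (hg : Antitone g) (M : ℕ)
    (h : ∀ n < M, f n + g (n + 1 + e) ≤ g n) :
    ∑ n ∈ Finset.range M, f n ≤ (e + 1 : ℕ) * g 0 := by
  have key : ∀ m ≤ M, ∑ n ∈ Finset.range m, f n + ∑ i ∈ Finset.range (e + 1), g (m + i) ≤
      ∑ i ∈ Finset.range (e + 1), g i := by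
    intro m
    induction m with
    | zero => intro _; simp
    | succ m ih =>
      intro hm
      refine le_trans ?_ (ih (by omega))
      rw [Finset.sum_range_succ f, Finset.sum_range_succ _ e, Finset.sum_range_succ' _ e, add_zero]
      have h1 := h m (by omega)
      have h2 : ∀ i, m + 1 + i = m + (i + 1) := by intro i; omega
      simp only [h2] at h1 ⊢
      calc _ = ∑ n ∈ Finset.range m, f n + (∑ i ∈ Finset.range e, g (m + (i + 1)) +
            (f m + g (m + (e + 1)))) := by ring
        _ ≤ _ := by
          gcongr
  calc ∑ n ∈ Finset.range M, f n ≤ ∑ i ∈ Finset.range (e + 1), g i :=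
        le_trans le_self_add (key M le_rfl)
    _ ≤ ∑ i ∈ Finset.range (e + 1), g 0 := Finset.sum_le_sum fun i _ => hg (Nat.zero_le i)
    _ = _ := by simp

/-- Call p a peak if x_n ≤ α^{|p - n|} x_p for all n up to M. Each x_k is at most α^{-|p - k|} x_p
for some peak p, so peaks control the sum up to a geometric series. No peak follows a passage to a
piece, since 2α < r; after a remainder, x can grow by at most α^e in e steps, and this permits the
drop of g to be used. -/
lemma sum_weights_le {x : ℕ → ℝ} {g : ℕ → ℝ≥0∞} {α r : ℝ} {e M₀ : ℕ} (hx : ∀ k, 0 < x k)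
    (hα : 1 < α) (hr : 2 * α < r) (he : 1 ≤ e) (hαe : 16 * r * α ^ e ≤ (α ^ 2) ^ e)
    (hg : Antitone g)
    (hstep : ∀ k, x (k + 1) = 2 / r * x k ∨ (k < M₀ ∧ ∀ m, 1 ≤ m →
      16 * r * x (k + 1 + m) ≤ (α ^ 2) ^ m * x (k + 1) →
        ENNReal.ofReal (x (k + 1) / r) + g (k + 1 + m) ≤ g k)) (N : ℕ) :
    ∑ k ∈ Finset.range N, ENNReal.ofReal (x k) ≤ ENNReal.ofReal (2 / (1 - α⁻¹)) *
      (ENNReal.ofReal (x 0) + ENNReal.ofReal r * ((e + 1 : ℕ) * g 0)) := by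
  classical
  have hα0 : 0 < α := by linarith
  have hr0 : 0 < r := by linarith
  set β := α⁻¹ with hβ
  have hβ0 : 0 < β := by positivity
  have hβ1 : β < 1 := inv_lt_one_of_one_lt₀ hα
  have hαβ : ∀ n, α ^ n * β ^ n = 1 := by
    intro n; rw [← mul_pow, hβ, mul_inv_cancel₀ hα0.ne', one_pow]
  -- Passages to a remainder occur only at n < M₀, so the comparison of a peak at n + 1 with n + 1 +
  -- e stays below M.
  set M := N + M₀ + e + 1 with hM
  let peak : ℕ → Prop := fun p => ∀ n ≤ M, x n ≤ α ^ ((p - n) + (n - p)) * x p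
  let f : ℕ → ℝ := fun p => if peak p then x p else 0
  have hf0 : ∀ p, 0 ≤ f p := by
    intro p
    by_cases h : peak p
    · simp only [f, if_pos h]; exact (hx p).le
    · simp only [f, if_neg h]; exact le_rfl
  -- every term is dominated by a peak
  have hdom : ∀ k < M, x k ≤ ∑ p ∈ Finset.range (M + 1), f p * β ^ ((p - k) + (k - p)) := by
    intro k hk
    obtain ⟨p, hp, hmax⟩ := (Finset.range (M + 1)).exists_max_image
      (fun p => x p * β ^ ((p - k) + (k - p))) ⟨0, by simp⟩
    have hpk : peak p := by
      intro n hn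
      have h1 := hmax n (by simp; omega)
      have h2 := mul_le_mul_of_nonneg_right h1 (pow_pos hα0 ((n - k) + (k - n))).le
      rw [mul_assoc, mul_comm (β ^ _), hαβ, mul_one] at h2
      refine h2.trans ?_
      have h3 : α ^ ((n - k) + (k - n)) ≤ α ^ (((p - n) + (n - p)) + ((p - k) + (k - p))) :=
        pow_le_pow_right₀ hα.le (by omega)
      have h4 := (hx p).le
      calc x p * β ^ ((p - k) + (k - p)) * α ^ ((n - k) + (k - n))
          ≤ x p * β ^ ((p - k) + (k - p)) * α ^ (((p - n) + (n - p)) + ((p - k) + (k - p))) := by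
            gcongr
        _ = α ^ ((p - n) + (n - p)) * x p * (α ^ ((p - k) + (k - p)) * β ^ ((p - k) + (k - p))) := by
            rw [pow_add α]; ring
        _ = _ := by rw [hαβ, mul_one]
    have h5 := hmax k (by simp; omega)
    simp only [Nat.sub_self, add_zero, pow_zero, mul_one] at h5
    refine h5.trans ?_
    have h6 := Finset.single_le_sum (f := fun p => f p * β ^ ((p - k) + (k - p)))
      (fun q _ => mul_nonneg (hf0 q) (by positivity)) hp
    simp only [f, if_pos hpk] at h6 ⊢
    exact h6
  have hsum : ∑ k ∈ Finset.range N, x k ≤ 2 / (1 - β) * ∑ p ∈ Finset.range (M + 1), f p := by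
    calc ∑ k ∈ Finset.range N, x k
        ≤ ∑ k ∈ Finset.range N, ∑ p ∈ Finset.range (M + 1), f p * β ^ ((p - k) + (k - p)) :=
          Finset.sum_le_sum fun k hk => hdom k (by rw [Finset.mem_range] at hk; omega)
      _ = ∑ p ∈ Finset.range (M + 1), f p * ∑ k ∈ Finset.range N, β ^ ((p - k) + (k - p)) := by
          rw [Finset.sum_comm]; simp only [Finset.mul_sum]
      _ ≤ ∑ p ∈ Finset.range (M + 1), f p * (2 / (1 - β)) :=
          Finset.sum_le_sum fun p _ =>
            mul_le_mul_of_nonneg_left (sum_pow_dist_le hβ0.le hβ1 p N) (hf0 p)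
      _ = _ := by rw [← Finset.sum_mul, mul_comm]
  -- a peak is the end of a step to a remainder, which is paid for by the decrease of `g`
  have htel : ∀ n < M, ENNReal.ofReal (f (n + 1) / r) + g (n + 1 + e) ≤ g n := by
    intro n hn
    by_cases hp : peak (n + 1)
    · rcases hstep n with h1 | ⟨hnM, h2⟩
      · exfalso
        have h3 := hp n hn.le
        have e1 : (n + 1 - n) + (n - (n + 1)) = 1 := by omega
        rw [e1, pow_one, h1] at h3
        have h4 : α * (2 / r * x n) = (2 * α / r) * x n := by ring
        rw [h4] at h3
        have h5 : 2 * α / r < 1 := by rw [div_lt_one hr0]; exact hr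
        have := hx n
        nlinarith
      · have h3 : f (n + 1) = x (n + 1) := if_pos hp
        rw [h3]
        refine h2 e he ?_
        have h4 := hp (n + 1 + e) (by omega)
        have e1 : (n + 1 - (n + 1 + e)) + (n + 1 + e - (n + 1)) = e := by omega
        rw [e1] at h4
        have h5 := (hx (n + 1)).le
        calc 16 * r * x (n + 1 + e) ≤ 16 * r * (α ^ e * x (n + 1)) := by gcongr
          _ = 16 * r * α ^ e * x (n + 1) := by ring
          _ ≤ _ := by gcongr
    · have h3 : f (n + 1) = 0 := if_neg hp
      rw [h3, zero_div, ENNReal.ofReal_zero, zero_add]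
      exact hg (by omega)
  have h1 := sum_le_of_telescope hg M htel
  rw [← ENNReal.ofReal_sum_of_nonneg (fun k _ => (hx k).le)]
  have hβ2 : 0 ≤ 2 / (1 - β) := by have := sub_pos.2 hβ1; positivity
  refine (ENNReal.ofReal_le_ofReal hsum).trans ?_
  rw [ENNReal.ofReal_mul hβ2]
  gcongr
  rw [Finset.sum_range_succ', ENNReal.ofReal_add (Finset.sum_nonneg fun i _ => hf0 _) (hf0 0),
    add_comm]
  refine add_le_add (ENNReal.ofReal_le_ofReal ?_) ?_
  · by_cases h : peak 0
    · simp only [f, if_pos h]; exact le_rfl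
    · simp only [f, if_neg h]; exact (hx 0).le
  · have h2 : ∑ i ∈ Finset.range M, f (i + 1) = r * ∑ i ∈ Finset.range M, f (i + 1) / r := by
      rw [← Finset.sum_div, mul_div_cancel₀ _ hr0.ne']
    rw [h2, ENNReal.ofReal_mul hr0.le,
      ENNReal.ofReal_sum_of_nonneg (fun i _ => div_nonneg (hf0 _) hr0.le)]
    gcongr

/-! ### Total weight of a trajectory and the initial scale -/

section Trajectory

variable {E : Type*} [AddCommGroup E] {N : ℕ → E → ℝ} {α r : ℝ} {P R : Finset E → ℕ → ℤ → Finset E}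

lemma sum_traj_le (hN : IsScaleNorm N (α ^ 2)) (hα : 1 < α) (hr : 2 * α < r)
    (hS : IsSplitting N r P R) {e : ℕ} (he : 1 ≤ e) (hαe : 16 * r * α ^ e ≤ (α ^ 2) ^ e) {t : E}
    {s : ChainState E} (ht : t ∈ s.D) (hs : s.Valid N r 0) (n : ℕ) :
    ∑ k ∈ Finset.range n, ENNReal.ofReal (weight r k (traj N r P R t k 0 s)) ≤
      ENNReal.ofReal (2 / (1 - α⁻¹)) *
      (ENNReal.ofReal (r ^ (-s.j)) + ENNReal.ofReal r * ((e + 1 : ℕ) * freeValue N r s.D 0)) := by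
  have hr0 : 0 < r := by linarith
  have h := sum_weights_le (x := fun k => weight r k (traj N r P R t k 0 s))
    (g := fun k => freeValue N r (traj N r P R t k 0 s).D k) (M₀ := s.D.card)
    (fun k => weight_pos hr0 _ _) hα hr he hαe ?_ ?_ n
  · refine h.trans_eq ?_
    simp [weight, traj]
  · intro a b hab
    exact freeValue_mono (by exact_mod_cast traj_subset hN hr0 hS ht hs hab) hab
  · intro k
    rcases traj_step hN hr0 hS ht hs k with h | ⟨h1, h2⟩
    · exact Or.inl h
    · exact Or.inr ⟨lt_of_lt_of_le ((Nat.lt_succ_self k).trans (lt_bigN (k + 1))) h1, h2⟩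

/-- A finite set with at least two points has a scale at which it is contained in the ball of
radius `4 r^{-j} B(1)` around each of its points, and which is controlled by the value of the
trees. -/
lemma exists_root_scale (hN : IsScaleNorm N (α ^ 2)) (hr : 1 < r) {F : Finset E}
    (hF : 1 < F.card) : ∃ j : ℤ, (∀ s ∈ F, ∀ t ∈ F, N 0 (s - t) ≤ 4 * r ^ (-j)) ∧
      ENNReal.ofReal (r ^ (-j)) ≤ ENNReal.ofReal r * freeValue N r F 0 := by
  have hr0 : 0 < r := by linarith
  obtain ⟨a, ha, b, hb, hab⟩ := Finset.one_lt_card.1 hF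
  have hpos := hN.pos 0 (a - b) (sub_ne_zero.2 hab)
  have hbound : ∃ B : ℤ, ∀ j : ℤ, (∀ s ∈ F, ∀ t ∈ F, N 0 (s - t) ≤ 4 * r ^ (-j)) → j ≤ B := by
    obtain ⟨m, hm⟩ := pow_unbounded_of_one_lt (4 / N 0 (a - b)) hr
    refine ⟨m, fun j hj => ?_⟩
    by_contra! hlt
    have h1 := hj a ha b hb
    rw [zpow_neg, ← div_eq_mul_inv, le_div_iff₀ (by positivity)] at h1
    rw [div_lt_iff₀ hpos] at hm
    have h2 : r ^ (m : ℤ) ≤ r ^ j := zpow_le_zpow_right₀ hr.le hlt.le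
    rw [zpow_natCast] at h2
    nlinarith
  have hex : ∃ j : ℤ, ∀ s ∈ F, ∀ t ∈ F, N 0 (s - t) ≤ 4 * r ^ (-j) := by
    obtain ⟨q, hq, hmax⟩ := (F ×ˢ F).exists_max_image (fun q => N 0 (q.1 - q.2))
      ⟨(a, b), Finset.mk_mem_product ha hb⟩
    obtain ⟨m, hm⟩ := pow_unbounded_of_one_lt (N 0 (q.1 - q.2)) hr
    refine ⟨-(m : ℤ), fun s hs t ht => ?_⟩
    rw [neg_neg, zpow_natCast]
    have := hmax (s, t) (Finset.mk_mem_product hs ht)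
    have h0 : 0 < r ^ m := by positivity
    simp only at this
    linarith
  -- Take j greatest: at j + 1 two points are separated, and since N_0 = 2 they form a one-step tree
  -- of value r^{-(j+1)}.
  obtain ⟨j, hj, hmax⟩ := Int.exists_greatest_of_bdd hbound hex
  refine ⟨j, hj, ?_⟩
  have hnext : ¬ ∀ s ∈ F, ∀ t ∈ F, N 0 (s - t) ≤ 4 * r ^ (-(j + 1)) := fun h => by
    have := hmax _ h; omega
  push Not at hnext
  obtain ⟨s, hs, t, ht, hlt⟩ := hnext
  have hsep : Sep N r 0 (j + 1) s t := by
    by_contra h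
    rw [not_sep_iff hr0, pow_zero, one_mul] at h
    linarith
  have hsep' : Sep N r 0 (j + 1) t s := by unfold Sep at hsep ⊢; rwa [hN.sub_comm]
  have hst : s ≠ t := by
    rintro rfl
    unfold Sep at hsep
    rw [sub_self, hN.zero, mul_zero] at hsep
    norm_num at hsep
  classical
  have h1 := add_le_freeValue (N := N) (r := r) hr0 (A := (F : Set E)) (n := 0) (m := 0) le_rfl
    (j := j + 1) (P := {s, t}) (v := 0)
    (by intro u hu; simp only [Finset.coe_insert, Finset.coe_singleton, Set.mem_insert_iff,
          Set.mem_singleton_iff] at hu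
        rcases hu with rfl | rfl <;> assumption)
    (by rw [Finset.card_pair hst]; rfl)
    (by
      intro p hp q hq hne
      rw [Finset.mem_insert, Finset.mem_singleton] at hp hq
      rcases hp with rfl | rfl <;> rcases hq with rfl | rfl
      · exact (hne rfl).elim
      · exact hsep
      · exact hsep'
      · exact (hne rfl).elim) (fun _ _ => bot_le)
  rw [add_zero, pow_zero, one_mul] at h1
  calc ENNReal.ofReal (r ^ (-j)) = ENNReal.ofReal r * ENNReal.ofReal (r ^ (-(j + 1))) := by
        rw [← ENNReal.ofReal_mul hr0.le, neg_add, zpow_add₀ hr0.ne', zpow_neg_one]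
        congr 1
        field_simp
    _ ≤ _ := by gcongr

end Trajectory

/-! ### Exponential moments -/

section Moments

variable {Ω : Type*} [MeasurableSpace Ω] {μ : Measure Ω} [IsProbabilityMeasure μ]

lemma exp_mul_abs_le (s : ℝ) (hs : 0 ≤ s) (z : ℝ) :
    ENNReal.ofReal (Real.exp (s * |z|)) ≤ ENNReal.ofReal (Real.exp s) *
      (1 + ∑' k : ℕ, ENNReal.ofReal (Real.exp (s * (k + 1))) *
        ({z : ℝ | (k : ℝ) + 1 ≤ |z|}.indicator 1 z)) := by
  rcases lt_or_ge |z| 1 with h | h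
  · calc ENNReal.ofReal (Real.exp (s * |z|)) ≤ ENNReal.ofReal (Real.exp s) * 1 := by
          rw [mul_one]
          apply ENNReal.ofReal_le_ofReal
          rw [Real.exp_le_exp]
          nlinarith
      _ ≤ _ := by gcongr; exact le_self_add
  · set k := ⌊|z|⌋₊ with hk
    have hk1 : 1 ≤ k := Nat.one_le_floor_iff _ |>.2 h
    have hk2 : (k : ℝ) ≤ |z| := Nat.floor_le (abs_nonneg z)
    have hk3 : |z| < k + 1 := Nat.lt_floor_add_one _
    obtain ⟨m, hm⟩ : ∃ m, k = m + 1 := ⟨k - 1, by omega⟩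
    rw [hm] at hk2 hk3
    push_cast at hk2 hk3
    have hterm : ENNReal.ofReal (Real.exp (s * (m + 1))) ≤
        ∑' k : ℕ, ENNReal.ofReal (Real.exp (s * (k + 1))) *
          ({z : ℝ | (k : ℝ) + 1 ≤ |z|}.indicator 1 z) := by
      refine le_trans (le_of_eq ?_) (ENNReal.le_tsum m)
      rw [Set.indicator_of_mem (by exact hk2)]
      simp
    calc ENNReal.ofReal (Real.exp (s * |z|))
        ≤ ENNReal.ofReal (Real.exp s) * ENNReal.ofReal (Real.exp (s * (m + 1))) := by
          rw [← ENNReal.ofReal_mul (Real.exp_pos _).le, ← Real.exp_add]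
          apply ENNReal.ofReal_le_ofReal
          rw [Real.exp_le_exp]
          nlinarith
      _ ≤ _ := by gcongr; exact hterm.trans le_add_self

/-- Summing over integer levels of |Z|, the gap 1/2 between s and β leaves a geometric series of
ratio e^{-1/2} < 0.61, and 0.61/0.39 ≤ 2. -/
lemma lintegral_exp_le {Z : Ω → ℝ} (hZ : Measurable Z) {s β B : ℝ} (hs : 0 ≤ s) (hB : 0 ≤ B)
    (hβ : s + 1 / 2 ≤ β) (htail : ∀ x, 1 ≤ x → μ.real {ω | x ≤ |Z ω|} ≤ B * Real.exp (-(β * x))) :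
    ∫⁻ ω, ENNReal.ofReal (Real.exp (s * |Z ω|)) ∂μ ≤ ENNReal.ofReal (Real.exp s * (1 + 2 * B)) := by
  have hmeas : ∀ k : ℕ, MeasurableSet {z : ℝ | (k : ℝ) + 1 ≤ |z|} := fun k =>
    measurableSet_le measurable_const measurable_id.abs
  have hgeo : Real.exp (-(1 / 2)) < 0.61 := by
    have h1 : (1.64 : ℝ) < Real.exp (1 / 2) := by
      have h2 : Real.exp (1 / 2) ^ 2 = Real.exp 1 := by
        rw [← Real.exp_nat_mul]; norm_num
      have h3 := Real.exp_one_gt_d9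
      nlinarith [Real.exp_pos (1 / 2)]
    rw [Real.exp_neg]
    rw [inv_lt_comm₀ (Real.exp_pos _) (by norm_num)]
    refine lt_trans (by norm_num) h1
  calc ∫⁻ ω, ENNReal.ofReal (Real.exp (s * |Z ω|)) ∂μ
      ≤ ∫⁻ ω, ENNReal.ofReal (Real.exp s) *
        (1 + ∑' k : ℕ, ENNReal.ofReal (Real.exp (s * (k + 1))) *
        ({z : ℝ | (k : ℝ) + 1 ≤ |z|}.indicator 1 (Z ω))) ∂μ :=
        lintegral_mono fun ω => exp_mul_abs_le s hs (Z ω)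
    _ = ENNReal.ofReal (Real.exp s) * (1 + ∑' k : ℕ, ENNReal.ofReal (Real.exp (s * (k + 1))) *
        μ {ω | (k : ℝ) + 1 ≤ |Z ω|}) := by
        have hm : ∀ k : ℕ, Measurable fun ω => ENNReal.ofReal (Real.exp (s * (k + 1))) *
            ({z : ℝ | (k : ℝ) + 1 ≤ |z|}.indicator (1 : ℝ → ℝ≥0∞) (Z ω)) := fun k =>
          ((measurable_one.indicator (hmeas k)).comp hZ).const_mul _
        rw [lintegral_const_mul' _ _ ENNReal.ofReal_ne_top, lintegral_add_left measurable_const,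
          lintegral_tsum fun k => (hm k).aemeasurable]
        simp only [lintegral_const, measure_univ, mul_one]
        congr 3
        ext k
        rw [lintegral_const_mul' _ _ ENNReal.ofReal_ne_top]
        congr 1
        exact lintegral_indicator_one (hZ (hmeas k))
    _ ≤ ENNReal.ofReal (Real.exp s) * (1 + ∑' k : ℕ, ENNReal.ofReal (B * (0.61) ^ (k + 1))) := by
        gcongr with k
        have h1 : μ {ω | (k : ℝ) + 1 ≤ |Z ω|} ≤
            ENNReal.ofReal (B * Real.exp (-(β * (k + 1)))) := by
          rw [← ofReal_measureReal]
          exact ENNReal.ofReal_le_ofReal (htail _ (by simp))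
        refine (mul_le_mul_right h1 _).trans ?_
        rw [← ENNReal.ofReal_mul (Real.exp_pos _).le]
        apply ENNReal.ofReal_le_ofReal
        have h2 : Real.exp (s * (k + 1)) * (B * Real.exp (-(β * (k + 1)))) =
            B * Real.exp ((s - β) * (k + 1)) := by
          rw [mul_left_comm, ← Real.exp_add]; congr 2; ring
        rw [h2]
        refine mul_le_mul_of_nonneg_left ?_ hB
        calc Real.exp ((s - β) * (k + 1)) ≤ Real.exp (((k + 1 : ℕ) : ℝ) * (-(1 / 2))) := by
              rw [Real.exp_le_exp]; push_cast; nlinarith [Nat.cast_nonneg (α := ℝ) k]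
          _ = Real.exp (-(1 / 2)) ^ (k + 1) := by rw [Real.exp_nat_mul]
          _ ≤ _ := pow_le_pow_left₀ (Real.exp_pos _).le hgeo.le _
    _ ≤ _ := by
        have hsum : HasSum (fun k : ℕ => B * (0.61 : ℝ) ^ (k + 1)) (B * 0.61 * (1 - 0.61)⁻¹) := by
          have := (hasSum_geometric_of_lt_one (r := (0.61 : ℝ)) (by norm_num) (by norm_num)).mul_left
            (B * 0.61)
          refine this.congr_fun ?_ |> fun h => h
          intro k; simp only [pow_succ]; ring
        rw [← ENNReal.ofReal_tsum_of_nonneg (fun k => by positivity) hsum.summable, hsum.tsum_eq,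
          ← ENNReal.ofReal_one, ← ENNReal.ofReal_add (by norm_num) (by norm_num; positivity),
          ← ENNReal.ofReal_mul (Real.exp_pos _).le]
        apply ENNReal.ofReal_le_ofReal
        have h1 : (0.61 : ℝ) * (1 - 0.61)⁻¹ ≤ 2 := by norm_num
        have h2 := mul_le_mul_of_nonneg_left h1 hB
        refine mul_le_mul_of_nonneg_left ?_ (Real.exp_pos _).le
        linarith

lemma integrable_exp_of_tail {Z : Ω → ℝ} (hZ : Measurable Z) {s β B : ℝ} (hs : 0 ≤ s) (hB : 0 ≤ B)
    (hβ : s + 1 / 2 ≤ β) (htail : ∀ x, 1 ≤ x → μ.real {ω | x ≤ |Z ω|} ≤ B * Real.exp (-(β * x))) :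
    Integrable (fun ω => Real.exp (s * |Z ω|)) μ ∧
      ∫ ω, Real.exp (s * |Z ω|) ∂μ ≤ Real.exp s * (1 + 2 * B) := by
  have h := lintegral_exp_le hZ hs hB hβ htail
  have hm : AEStronglyMeasurable (fun ω => Real.exp (s * |Z ω|)) μ := by fun_prop
  have h0 : 0 ≤ᵐ[μ] fun ω => Real.exp (s * |Z ω|) := ae_of_all _ fun ω => (Real.exp_pos _).le
  refine ⟨(lintegral_ofReal_ne_top_iff_integrable hm h0).1 (h.trans_lt ENNReal.ofReal_lt_top).ne, ?_⟩
  rw [integral_eq_lintegral_of_nonneg_ae h0 hm]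
  exact ENNReal.toReal_le_of_le_ofReal (by positivity) h

lemma exp_le_quadratic (x : ℝ) : Real.exp x ≤ 1 + x + x ^ 2 * Real.exp |x| := by
  have he : 1 ≤ Real.exp |x| := Real.one_le_exp (abs_nonneg x)
  rcases le_or_gt |x| 1 with h | h
  · have h1 := (abs_le.1 (Real.abs_exp_sub_one_sub_id_le h)).2
    nlinarith [sq_nonneg x]
  · rcases le_or_gt 0 x with h0 | h0
    · rw [abs_of_nonneg h0] at h ⊢
      have h1 : 1 ≤ x ^ 2 := by nlinarith
      have h2 := mul_le_mul_of_nonneg_right h1 (Real.exp_pos x).le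
      linarith
    · have h1 : Real.exp x ≤ 1 := Real.exp_le_one_iff.2 h0.le
      rw [abs_of_neg h0] at h he ⊢
      nlinarith [sq_nonneg x]

lemma exp_le_of_small {s z : ℝ} (hs : |s| ≤ 1 / 4) :
    Real.exp (s * z) ≤ 1 + s * z + 32 * s ^ 2 * Real.exp (1 / 2 * |z|) := by
  refine (exp_le_quadratic (s * z)).trans ?_
  have h1 : z ^ 2 ≤ 32 * Real.exp (|z| / 4) := by
    have := Real.quadratic_le_exp_of_nonneg (x := |z| / 4) (by positivity)
    nlinarith [sq_abs z, abs_nonneg z]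
  have h2 : Real.exp |s * z| ≤ Real.exp (|z| / 4) := by
    rw [Real.exp_le_exp, abs_mul]; nlinarith [abs_nonneg z]
  have h3 : Real.exp (1 / 2 * |z|) = Real.exp (|z| / 4) * Real.exp (|z| / 4) := by
    rw [← Real.exp_add]; congr 1; ring
  have h4 : z ^ 2 * Real.exp |s * z| ≤ 32 * Real.exp (|z| / 4) * Real.exp (|z| / 4) :=
    mul_le_mul h1 h2 (Real.exp_pos _).le (by positivity)
  rw [h3]
  nlinarith [mul_le_mul_of_nonneg_left h4 (sq_nonneg s)]

lemma sq_le_exp (z : ℝ) : z ^ 2 ≤ 32 * Real.exp (1 / 2 * |z|) := by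
  have := Real.quadratic_le_exp_of_nonneg (x := 1 / 2 * |z|) (by positivity)
  nlinarith [sq_abs z, abs_nonneg z]

/-- A symmetric random variable `Z` with `P(|Z| ≥ x) ≤ e^{-V(x)}`, where `V(x) ≥ x` for `x ≥ 1`. -/
structure IsSymmTail (μ : Measure Ω) (Z : Ω → ℝ) (V : ℝ → ℝ) : Prop where
  meas : Measurable Z
  symm : IdentDistrib Z (fun ω => -Z ω) μ μ
  tail : ∀ x, μ.real {ω | x ≤ |Z ω|} ≤ Real.exp (-V x)
  le : ∀ x, 1 ≤ x → x ≤ V x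

namespace IsSymmTail

variable {Z : Ω → ℝ} {V : ℝ → ℝ} (h : IsSymmTail μ Z V)
include h

lemma exp_half : Integrable (fun ω => Real.exp (1 / 2 * |Z ω|)) μ ∧
    ∫ ω, Real.exp (1 / 2 * |Z ω|) ∂μ ≤ 5 := by
  obtain ⟨h1, h2⟩ := integrable_exp_of_tail (μ := μ) h.meas (s := 1 / 2) (β := 1) (B := 1)
    (by norm_num) (by norm_num) (by norm_num) (fun x hx => by
      refine (h.tail x).trans ?_
      rw [one_mul, one_mul, Real.exp_le_exp]
      exact neg_le_neg (h.le x hx))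
  refine ⟨h1, h2.trans ?_⟩
  have h3 : Real.exp (1 / 2) ^ 2 = Real.exp 1 := by
    rw [← Real.exp_nat_mul]; norm_num
  have h4 := Real.exp_one_lt_d9
  have h5 : Real.exp (1 / 2) < 1.65 := by nlinarith [Real.exp_pos (1 / 2)]
  linarith

lemma integrable : Integrable Z μ := by
  refine (h.exp_half.1.const_mul 2).mono' h.meas.aestronglyMeasurable (ae_of_all _ fun ω => ?_)
  have := Real.add_one_le_exp (1 / 2 * |Z ω|)
  rw [Real.norm_eq_abs]
  linarith

lemma memLp_two : MemLp Z 2 μ := by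
  rw [memLp_two_iff_integrable_sq h.meas.aestronglyMeasurable]
  refine (h.exp_half.1.const_mul 32).mono' (h.meas.pow_const 2).aestronglyMeasurable
    (ae_of_all _ fun ω => ?_)
  rw [Real.norm_eq_abs, abs_of_nonneg (sq_nonneg _)]
  exact sq_le_exp (Z ω)

lemma integral_sq_le : ∫ ω, Z ω ^ 2 ∂μ ≤ 160 := by
  have h1 : ∫ ω, Z ω ^ 2 ∂μ ≤ ∫ ω, 32 * Real.exp (1 / 2 * |Z ω|) ∂μ :=
    integral_mono h.memLp_two.integrable_sq (h.exp_half.1.const_mul 32) fun ω => sq_le_exp (Z ω)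
  rw [integral_const_mul] at h1
  linarith [h.exp_half.2]

omit [IsProbabilityMeasure μ] in
lemma integral_eq_zero : ∫ ω, Z ω ∂μ = 0 := by
  have h1 := h.symm.integral_eq
  rw [integral_neg] at h1
  linarith

/-- The linear term vanishes with the mean; 160 = 32 · 5 by `exp_half`. -/
lemma mgf_le_of_small {s : ℝ} (hs : |s| ≤ 1 / 4) :
    Integrable (fun ω => Real.exp (s * Z ω)) μ ∧ mgf Z μ s ≤ Real.exp (160 * s ^ 2) := by
  have hint : Integrable (fun ω => 1 + s * Z ω + 32 * s ^ 2 * Real.exp (1 / 2 * |Z ω|)) μ :=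
    ((integrable_const 1).add (h.integrable.const_mul s)).add (h.exp_half.1.const_mul _)
  have hi : Integrable (fun ω => Real.exp (s * Z ω)) μ := by
    refine hint.mono' ((h.meas.const_mul s).exp).aestronglyMeasurable (ae_of_all _ fun ω => ?_)
    rw [Real.norm_eq_abs, abs_of_pos (Real.exp_pos _)]
    exact exp_le_of_small hs
  refine ⟨hi, ?_⟩
  have h1 : mgf Z μ s ≤ ∫ ω, (1 + s * Z ω + 32 * s ^ 2 * Real.exp (1 / 2 * |Z ω|)) ∂μ :=
    integral_mono hi hint fun ω => exp_le_of_small hs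
  rw [integral_add (f := fun ω => 1 + s * Z ω)
      ((integrable_const 1).add (h.integrable.const_mul s)) (h.exp_half.1.const_mul _),
    integral_add (integrable_const 1) (h.integrable.const_mul s), integral_const_mul,
    integral_const_mul, h.integral_eq_zero] at h1
  simp only [integral_const, probReal_univ, smul_eq_mul, mul_one, mul_zero, add_zero] at h1
  have h2 := mul_le_mul_of_nonneg_left h.exp_half.2 (show 0 ≤ 32 * s ^ 2 by positivity)
  have h3 := Real.add_one_le_exp (160 * s ^ 2)
  linarith

/-- For x > 1 the conjugate bound reads tx - 2V(x) + 1 ≤ M, so the tail is at most e^{(M-1)/2}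
e^{-tx/2} and E e^{t|Z|/4} ≤ 3e^M. Passing to the eighth part t/32 of the exponent removes the
factor 3, through 8w ≤ 7 + w^8. -/
lemma mgf_le_of_large {t M : ℝ} (ht : 2 ≤ t) (hM : ∀ a, t * a - hatU V a ≤ M) {s : ℝ}
    (hs : |s| = t / 32) :
    Integrable (fun ω => Real.exp (s * Z ω)) μ ∧ mgf Z μ s ≤ Real.exp M := by
  have hM1 : t - 1 ≤ M := by
    have := hM 1
    rw [hatU_of_abs_le (by simp)] at this
    linarith
  have htail : ∀ x, 1 ≤ x → μ.real {ω | x ≤ |Z ω|} ≤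
      Real.exp ((M - 1) / 2) * Real.exp (-(t / 2 * x)) := by
    intro x hx
    refine (h.tail x).trans ?_
    rw [← Real.exp_add, Real.exp_le_exp]
    rcases eq_or_lt_of_le hx with rfl | hx'
    · have := h.le 1 le_rfl
      linarith
    · have h1 := hM x
      rw [hatU_of_one_lt (by rwa [abs_of_pos (by linarith)]), abs_of_pos (by linarith)] at h1
      linarith
  obtain ⟨h1, h2⟩ := integrable_exp_of_tail (μ := μ) h.meas (s := t / 4) (β := t / 2)
    (by linarith) (Real.exp_pos _).le (by linarith) htail
  have h3 : Real.exp (t / 4) * (1 + 2 * Real.exp ((M - 1) / 2)) ≤ 3 * Real.exp M := by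
    have e1 : Real.exp (t / 4) ≤ Real.exp ((M + 1) / 4) := Real.exp_le_exp.2 (by linarith)
    have e2 : 1 ≤ Real.exp ((M - 1) / 2) := Real.one_le_exp (by linarith)
    calc Real.exp (t / 4) * (1 + 2 * Real.exp ((M - 1) / 2))
        ≤ Real.exp ((M + 1) / 4) * (3 * Real.exp ((M - 1) / 2)) := by gcongr; linarith
      _ = 3 * Real.exp ((M + 1) / 4 + (M - 1) / 2) := by rw [Real.exp_add]; ring
      _ ≤ _ := by gcongr; linarith
  have hpt : ∀ ω, Real.exp (s * Z ω) ≤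
      Real.exp (M / 2) * (7 / 8) + Real.exp (M / 2) / 8 * Real.exp (-(4 * M)) *
        Real.exp (t / 4 * |Z ω|) := by
    intro ω
    have e1 : Real.exp (s * Z ω) ≤ Real.exp (t / 32 * |Z ω|) := by
      rw [Real.exp_le_exp]
      calc s * Z ω ≤ |s * Z ω| := le_abs_self _
        _ = _ := by rw [abs_mul, hs]
    refine e1.trans ?_
    set w := Real.exp (t / 32 * |Z ω| - M / 2) with hw
    have e2 : 8 * w ≤ 7 + w ^ 8 := by
      have := one_add_mul_le_pow (a := w - 1) (by linarith [Real.exp_pos (t / 32 * |Z ω| - M / 2)]) 8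
      norm_num at this
      linarith
    have e3 : Real.exp (t / 32 * |Z ω|) = Real.exp (M / 2) * w := by
      rw [hw, ← Real.exp_add]; congr 1; ring
    have e4 : w ^ 8 = Real.exp (-(4 * M)) * Real.exp (t / 4 * |Z ω|) := by
      rw [hw, ← Real.exp_nat_mul, ← Real.exp_add]; congr 1; push_cast; ring
    rw [e3, mul_assoc, ← e4]
    have := mul_le_mul_of_nonneg_left e2 (Real.exp_pos (M / 2)).le
    linarith
  have hint : Integrable (fun ω => Real.exp (M / 2) * (7 / 8) +
      Real.exp (M / 2) / 8 * Real.exp (-(4 * M)) * Real.exp (t / 4 * |Z ω|)) μ :=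
    (integrable_const _).add (h1.const_mul _)
  have hi : Integrable (fun ω => Real.exp (s * Z ω)) μ := by
    refine hint.mono' ((h.meas.const_mul s).exp).aestronglyMeasurable (ae_of_all _ fun ω => ?_)
    rw [Real.norm_eq_abs, abs_of_pos (Real.exp_pos _)]
    exact hpt ω
  refine ⟨hi, ?_⟩
  have h4 : mgf Z μ s ≤ ∫ ω, (Real.exp (M / 2) * (7 / 8) +
      Real.exp (M / 2) / 8 * Real.exp (-(4 * M)) * Real.exp (t / 4 * |Z ω|)) ∂μ :=
    integral_mono hi hint hpt
  rw [integral_add (integrable_const _) (h1.const_mul _)] at h4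
  simp only [integral_const_mul, integral_const, probReal_univ, smul_eq_mul, one_mul] at h4
  have h5 : Real.exp (-(4 * M)) * (3 * Real.exp M) ≤ 1 := by
    have e1 : Real.exp (-(4 * M)) * (3 * Real.exp M) = 3 * Real.exp (-(3 * M)) := by
      rw [mul_left_comm, ← Real.exp_add]; congr 2; ring
    rw [e1, Real.exp_neg, ← div_eq_mul_inv, div_le_one (Real.exp_pos _)]
    have := Real.add_one_le_exp (3 * M)
    linarith
  have h6 := mul_le_mul_of_nonneg_left (h2.trans h3)
    (show 0 ≤ Real.exp (M / 2) / 8 * Real.exp (-(4 * M)) by positivity)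
  have h7 : Real.exp (M / 2) / 8 * (Real.exp (-(4 * M)) * (3 * Real.exp M)) ≤
      Real.exp (M / 2) / 8 * 1 := mul_le_mul_of_nonneg_left h5 (by positivity)
  have h8 : Real.exp (M / 2) ≤ Real.exp M := Real.exp_le_exp.2 (by linarith)
  calc mgf Z μ s ≤ _ := h4
    _ ≤ Real.exp (M / 2) * (7 / 8) + Real.exp (M / 2) / 8 * 1 := by
      refine add_le_add (le_of_eq (by ring)) ?_
      refine h6.trans (le_trans (le_of_eq (by ring)) h7)
    _ = Real.exp (M / 2) := by ring
    _ ≤ _ := h8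

/-- The exponential moments are controlled by the conjugate function of `Û`. -/
lemma mgf_le {t M : ℝ} (hM : ∀ a, t * a - hatU V a ≤ M) :
    Integrable (fun ω => Real.exp (t / 32 * Z ω)) μ ∧ mgf Z μ (t / 32) ≤ Real.exp M := by
  have hM' : ∀ a, |t| * a - hatU V a ≤ M := by
    intro a
    rcases le_total 0 t with h0 | h0
    · rw [abs_of_nonneg h0]; exact hM a
    · rw [abs_of_nonpos h0]
      have := hM (-a)
      rw [hatU_neg] at this
      linarith
  rcases le_or_gt |t| 2 with h2 | h2
  · obtain ⟨h3, h4⟩ := h.mgf_le_of_small (s := t / 32) (by rw [abs_div]; norm_num; linarith)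
    refine ⟨h3, h4.trans (Real.exp_le_exp.2 ?_)⟩
    -- The maximum of ta - a² is t²/4, which exceeds 160(t/32)².
    have h5 := hM (t / 2)
    rw [hatU_of_abs_le (by rw [abs_div]; norm_num; linarith)] at h5
    nlinarith [sq_nonneg t]
  · exact h.mgf_le_of_large h2.le hM' (by rw [abs_div]; norm_num)

end IsSymmTail

end Moments

/-! ### The canonical process -/

section Canonical

variable {Ω : Type*} [MeasurableSpace Ω] {μ : Measure Ω} [IsProbabilityMeasure μ]
  {Y : ℕ → Ω → ℝ} {U : ℕ → ℝ → ℝ} {C : ℝ}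

/-- The partial sums of the series defining `X_v`. -/
def partialSum (Y : ℕ → Ω → ℝ) (v : Ell2) (m : ℕ) (ω : Ω) : ℝ :=
  ∑ i ∈ Finset.range m, v i * Y i ω

/-- Independent symmetric random variables with tails given by a Young family. -/
structure IsCanonical (μ : Measure Ω) (Y : ℕ → Ω → ℝ) (U : ℕ → ℝ → ℝ) (C : ℝ) : Prop where
  young : IsYoungFamily U C
  symm : ∀ i, IsSymmTail μ (Y i) (U i)
  indep : iIndepFun Y μ

namespace IsCanonical

variable (h : IsCanonical μ Y U C)
include h

omit [IsProbabilityMeasure μ] in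
lemma measurable_term (v : Ell2) (i : ℕ) : Measurable (fun ω => v i * Y i ω) :=
  (h.symm i).meas.const_mul _

omit [IsProbabilityMeasure μ] in
lemma measurable_partialSum (v : Ell2) (m : ℕ) : Measurable (partialSum Y v m) :=
  Finset.measurable_fun_sum _ fun i _ => h.measurable_term v i

lemma memLp_term (v : Ell2) (i : ℕ) : MemLp (fun ω => v i * Y i ω) 2 μ :=
  (h.symm i).memLp_two.const_mul _

omit [IsProbabilityMeasure μ] in
lemma indep_term (v : Ell2) : iIndepFun (fun i ω => v i * Y i ω) μ :=
  h.indep.comp (fun i y => v i * y) fun _ => measurable_const_mul _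

lemma memLp_sum (v : Ell2) (s : Finset ℕ) : MemLp (fun ω => ∑ i ∈ s, v i * Y i ω) 2 μ :=
  memLp_finsetSum _ fun i _ => h.memLp_term v i

lemma integral_sum (v : Ell2) (s : Finset ℕ) : ∫ ω, ∑ i ∈ s, v i * Y i ω ∂μ = 0 := by
  rw [integral_finsetSum _ fun i _ => (h.memLp_term v i).integrable (by norm_num)]
  refine Finset.sum_eq_zero fun i _ => ?_
  rw [integral_const_mul, (h.symm i).integral_eq_zero, mul_zero]

lemma integral_sq_sum_le (v : Ell2) (s : Finset ℕ) :
    ∫ ω, (∑ i ∈ s, v i * Y i ω) ^ 2 ∂μ ≤ 160 * ∑ i ∈ s, v i ^ 2 := by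
  have h1 := IndepFun.variance_sum (μ := μ) (X := fun i ω => v i * Y i ω) (s := s)
    (fun i _ => h.memLp_term v i) (fun i _ j _ hij => (h.indep_term v).indepFun hij)
  have e1 : (∑ i ∈ s, fun ω => v i * Y i ω) = fun ω => ∑ i ∈ s, v i * Y i ω := by
    ext ω; simp
  rw [e1, variance_of_integral_eq_zero (h.memLp_sum v s).aemeasurable (h.integral_sum v s)] at h1
  rw [h1, Finset.mul_sum]
  refine Finset.sum_le_sum fun i _ => ?_
  have e2 : ∫ ω, v i * Y i ω ∂μ = 0 := by
    rw [integral_const_mul, (h.symm i).integral_eq_zero, mul_zero]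
  rw [variance_of_integral_eq_zero (h.memLp_term v i).aemeasurable e2]
  simp only [mul_pow]
  rw [integral_const_mul, mul_comm]
  exact mul_le_mul_of_nonneg_right (h.symm i).integral_sq_le (sq_nonneg _)

/-- The series defining `X_v` converges almost surely. -/
lemma exists_tendsto (v : Ell2) :
    ∀ᵐ ω ∂μ, ∃ l, Tendsto (fun m => partialSum Y v m ω) atTop (𝓝 l) := by
  set f : ℕ → Ω → ℝ := fun i ω => v i * Y i ω with hf
  have hsm : ∀ i, StronglyMeasurable (f i) := fun i => (h.measurable_term v i).stronglyMeasurable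
  set ℱ := Filtration.natural f hsm
  have hint : ∀ n, Integrable (partialSum Y v (n + 1)) μ := fun n =>
    (h.memLp_sum v _).integrable (by norm_num)
  have hadp : StronglyAdapted ℱ fun n => partialSum Y v (n + 1) := by
    intro n
    refine Finset.stronglyMeasurable_fun_sum _ fun i hi => ?_
    exact ((Filtration.stronglyAdapted_natural hsm) i).mono
      (ℱ.mono (Nat.lt_succ_iff.1 (Finset.mem_range.1 hi)))
  -- The partial sums are a martingale bounded in L², hence in L¹. The shift by one matches the
  -- natural filtration, where term n is known at time n.
  have hmart : Martingale (fun n => partialSum Y v (n + 1)) ℱ μ := by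
    refine martingale_of_condExp_sub_eq_zero_nat hadp hint fun n => ?_
    have e1 : partialSum Y v (n + 1 + 1) - partialSum Y v (n + 1) = f (n + 1) := by
      ext ω
      simp only [Pi.sub_apply, partialSum, Finset.sum_range_succ _ (n + 1), hf]
      ring
    rw [e1]
    refine ((h.indep_term v).condExp_natural_ae_eq_of_lt hsm (Nat.lt_succ_self n)).trans ?_
    refine ae_of_all _ fun ω => ?_
    change ∫ ω, v (n + 1) * Y (n + 1) ω ∂μ = 0
    rw [integral_const_mul, (h.symm _).integral_eq_zero, mul_zero]
  have hbdd : ∀ n, eLpNorm (partialSum Y v (n + 1)) 1 μ ≤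
      (Real.toNNReal (1 + 160 * ∑' i, v i ^ 2) : ℝ≥0) := by
    intro n
    rw [eLpNorm_one_eq_lintegral_enorm, ← ofReal_integral_norm_eq_lintegral_enorm (hint n)]
    change _ ≤ ENNReal.ofReal _
    apply ENNReal.ofReal_le_ofReal
    have h1 : ∫ ω, ‖partialSum Y v (n + 1) ω‖ ∂μ ≤
        ∫ ω, (1 + partialSum Y v (n + 1) ω ^ 2) ∂μ := by
      refine integral_mono (hint n).norm
        ((integrable_const 1).add (h.memLp_sum v _).integrable_sq) fun ω => ?_
      simp only [Real.norm_eq_abs]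
      nlinarith [sq_abs (partialSum Y v (n + 1) ω), sq_nonneg (|partialSum Y v (n + 1) ω| - 1)]
    rw [integral_add (g := fun ω => partialSum Y v (n + 1) ω ^ 2) (integrable_const 1)
      (h.memLp_sum v _).integrable_sq] at h1
    simp only [integral_const, probReal_univ, smul_eq_mul, mul_one] at h1
    have h2 := h.integral_sq_sum_le v (Finset.range (n + 1))
    have h3 := (summable_sq v).sum_le_tsum (Finset.range (n + 1)) fun i _ => sq_nonneg _
    have h4 : ∫ ω, partialSum Y v (n + 1) ω ^ 2 ∂μ ≤ 160 * ∑ i ∈ Finset.range (n + 1), v i ^ 2 := h2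
    linarith
  filter_upwards [hmart.submartingale.exists_ae_tendsto_of_bdd hbdd] with ω hω
  obtain ⟨l, hl⟩ := hω
  exact ⟨l, (tendsto_add_atTop_iff_nat 1).1 hl⟩

lemma tendsto_process (v : Ell2) :
    ∀ᵐ ω ∂μ, Tendsto (fun m => partialSum Y v m ω) atTop (𝓝 (process Y v ω)) := by
  filter_upwards [h.exists_tendsto v] with ω hω
  exact tendsto_nhds_limUnder hω

lemma process_sub (v w : Ell2) :
    ∀ᵐ ω ∂μ, process Y (v - w) ω = process Y v ω - process Y w ω := by
  filter_upwards [h.tendsto_process v, h.tendsto_process w, h.tendsto_process (v - w)]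
    with ω h1 h2 h3
  refine tendsto_nhds_unique h3 ((h1.sub h2).congr fun m => ?_)
  simp only [partialSum, ← Finset.sum_sub_distrib]
  refine Finset.sum_congr rfl fun i _ => ?_
  simp [sub_mul]

lemma aestronglyMeasurable_process (v : Ell2) : AEStronglyMeasurable (process Y v) μ :=
  aestronglyMeasurable_of_tendsto_ae atTop
    (fun m => (h.measurable_partialSum v m).aestronglyMeasurable) (h.tendsto_process v)

lemma lintegral_sq_sub_le (v : Ell2) (m : ℕ) :
    ∫⁻ ω, ENNReal.ofReal ((process Y v ω - partialSum Y v m ω) ^ 2) ∂μ ≤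
      ENNReal.ofReal (160 * (∑' i, v i ^ 2 - ∑ i ∈ Finset.range m, v i ^ 2)) := by
  have h1 : ∫⁻ ω, ENNReal.ofReal ((process Y v ω - partialSum Y v m ω) ^ 2) ∂μ ≤
      ∫⁻ ω, liminf (fun k => ENNReal.ofReal
        ((partialSum Y v k ω - partialSum Y v m ω) ^ 2)) atTop ∂μ := by
    refine lintegral_mono_ae ?_
    filter_upwards [h.tendsto_process v] with ω hω
    refine (Tendsto.liminf_eq ?_).ge
    exact ENNReal.tendsto_ofReal ((hω.sub_const _).pow 2)
  refine h1.trans ((lintegral_liminf_le fun k => ?_).trans ?_)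
  · exact (((h.measurable_partialSum v k).sub (h.measurable_partialSum v m)).pow_const 2).ennreal_ofReal
  · refine Filter.liminf_le_of_frequently_le' (Eventually.frequently ?_)
    filter_upwards [eventually_ge_atTop m] with k hk
    have e1 : ∀ ω, partialSum Y v k ω - partialSum Y v m ω = ∑ i ∈ Finset.Ico m k, v i * Y i ω := by
      intro ω
      rw [Finset.sum_Ico_eq_sub _ hk]; rfl
    simp only [e1]
    rw [← ofReal_integral_eq_lintegral_ofReal (h.memLp_sum v _).integrable_sq
      (ae_of_all _ fun ω => sq_nonneg _)]
    apply ENNReal.ofReal_le_ofReal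
    refine (h.integral_sq_sum_le v _).trans ?_
    rw [Finset.sum_Ico_eq_sub _ hk]
    have := (summable_sq v).sum_le_tsum (Finset.range k) fun i _ => sq_nonneg _
    linarith

/-- By Fatou the tails of the series are small in L². As the partial sums are centred, (E X_v)² ≤
E(X_v - S_m)² → 0. -/
lemma process_integrable_and_mean (v : Ell2) :
    Integrable (process Y v) μ ∧ ∫ ω, process Y v ω ∂μ = 0 := by
  set R : ℕ → ℝ := fun m => 160 * (∑' i, v i ^ 2 - ∑ i ∈ Finset.range m, v i ^ 2) with hR
  have hR0 : ∀ m, 0 ≤ R m := by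
    intro m
    have := (summable_sq v).sum_le_tsum (Finset.range m) fun i _ => sq_nonneg _
    simp only [hR]; linarith
  have hRlim : Tendsto R atTop (𝓝 0) := by
    have h1 := (summable_sq v).hasSum.tendsto_sum_nat
    have h2 := (h1.const_sub (∑' i, v i ^ 2)).const_mul 160
    simpa [hR] using h2
  have hint : ∀ m, Integrable (partialSum Y v m) μ := fun m =>
    (h.memLp_sum v _).integrable (by norm_num)
  have hdiff : ∀ m, MemLp (fun ω => process Y v ω - partialSum Y v m ω) 2 μ ∧
      ∫ ω, (process Y v ω - partialSum Y v m ω) ^ 2 ∂μ ≤ R m := by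
    intro m
    have hmeas : AEStronglyMeasurable (fun ω => process Y v ω - partialSum Y v m ω) μ :=
      (h.aestronglyMeasurable_process v).sub (h.measurable_partialSum v m).aestronglyMeasurable
    have h1 := h.lintegral_sq_sub_le v m
    have h0 : 0 ≤ᵐ[μ] fun ω => (process Y v ω - partialSum Y v m ω) ^ 2 :=
      ae_of_all _ fun ω => sq_nonneg _
    constructor
    · rw [memLp_two_iff_integrable_sq hmeas]
      exact (lintegral_ofReal_ne_top_iff_integrable (hmeas.pow 2) h0).1
        (h1.trans_lt ENNReal.ofReal_lt_top).ne
    · rw [integral_eq_lintegral_of_nonneg_ae h0 (hmeas.pow 2)]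
      exact ENNReal.toReal_le_of_le_ofReal (hR0 m) h1
  have hX : Integrable (process Y v) μ := by
    have := ((hdiff 0).1.integrable (by norm_num)).add (hint 0)
    refine this.congr (ae_of_all _ fun ω => ?_)
    simp
  refine ⟨hX, ?_⟩
  have hsq : ∀ m, (∫ ω, process Y v ω ∂μ) ^ 2 ≤ R m := by
    intro m
    have h1 := variance_nonneg (fun ω => process Y v ω - partialSum Y v m ω) μ
    rw [variance_eq_sub (hdiff m).1] at h1
    have h2 : ∫ ω, (process Y v ω - partialSum Y v m ω) ∂μ = ∫ ω, process Y v ω ∂μ := by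
      rw [integral_sub hX (hint m)]
      have : ∫ ω, partialSum Y v m ω ∂μ = 0 := h.integral_sum v _
      rw [this, sub_zero]
    rw [h2] at h1
    have h3 := (hdiff m).2
    have h4 : μ[(fun ω => process Y v ω - partialSum Y v m ω) ^ 2] =
        ∫ ω, (process Y v ω - partialSum Y v m ω) ^ 2 ∂μ := rfl
    rw [h4] at h1
    linarith
  have h5 : (∫ ω, process Y v ω ∂μ) ^ 2 ≤ 0 := ge_of_tendsto' hRlim hsq
  exact pow_eq_zero_iff (two_ne_zero) |>.1 (le_antisymm h5 (sq_nonneg _))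

/-! ### Tails -/

-- With λ = w/𝒩_w(v), the supremum over a of λ∑v_i a_i - ∑Û_i(a_i) is at most w. If K = ∑Û_i(a_i)
-- exceeds w, then `normN_mul_le` bounds the linear part by K. This supremum splits into a sum over
-- coordinates.
omit h in
lemma exists_conjugate_bounds (hU : IsYoungFamily U C) {w : ℝ} (hw : 0 < w) (v : Ell2)
    (hN : 0 < normN U w v) (m : ℕ) : ∃ M : ℕ → ℝ, (∀ i < m, ∀ a,
      w / normN U w v * v i * a - hatU (U i) a ≤ M i) ∧ ∑ i ∈ Finset.range m, M i ≤ w := by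
  set N := normN U w v with hNdef
  have key : ∀ a : ℕ → ℝ, ∑ i ∈ Finset.range m, (w / N * v i * a i - hatU (U i) (a i)) ≤ w := by
    intro a
    rw [Finset.sum_sub_distrib]
    have e1 : ∑ i ∈ Finset.range m, w / N * v i * a i =
        w / N * ∑ i ∈ Finset.range m, v i * a i := by
      rw [Finset.mul_sum]; exact Finset.sum_congr rfl fun i _ => by ring
    rw [e1]
    set K := ∑ i ∈ Finset.range m, hatU (U i) (a i) with hK
    have hK0 : 0 ≤ K := Finset.sum_nonneg fun i _ => hU.hatU_nonneg i _
    have hwN : 0 < w / N := by positivity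
    rcases le_or_gt K w with hle | hgt
    · have h1 := mul_le_mul_of_nonneg_left (hU.sum_le_normN m a hle v) hwN.le
      rw [div_mul_cancel₀ _ hN.ne'] at h1
      linarith
    · have h1 := hU.sum_le_normN (u := K) m a le_rfl v
      have h2 := hU.normN_mul_le (c := K / w) (u := w) (by rw [one_le_div hw]; exact hgt.le) hw.le v
      rw [div_mul_cancel₀ _ hw.ne'] at h2
      have h3 := mul_le_mul_of_nonneg_left (h1.trans h2) hwN.le
      have h4 : w / N * (K / w * N) = K := by field_simp
      linarith
  have hbdd : ∀ i < m, BddAbove (Set.range fun a : ℝ => w / N * v i * a - hatU (U i) a) := by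
    intro i hi
    refine ⟨w, ?_⟩
    rintro _ ⟨a, rfl⟩
    have h1 := key (fun j => if j = i then a else 0)
    rw [Finset.sum_eq_single_of_mem i (Finset.mem_range.2 hi)
      (fun j _ hj => by simp [hj, hatU_zero])] at h1
    simpa using h1
  refine ⟨fun i => ⨆ a : ℝ, (w / N * v i * a - hatU (U i) a), fun i hi a => le_ciSup (hbdd i hi) a, ?_⟩
  refine le_of_forall_pos_le_add fun ε hε => ?_
  have hδ : 0 < ε / (m + 1) := by positivity
  have hex : ∀ i, ∃ a, (⨆ a : ℝ, (w / N * v i * a - hatU (U i) a)) - ε / (m + 1) <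
      w / N * v i * a - hatU (U i) a := fun i => exists_lt_of_lt_ciSup (sub_lt_self _ hδ)
  choose a ha using hex
  have h1 := key a
  have h2 : ∑ i ∈ Finset.range m, ((⨆ a : ℝ, (w / N * v i * a - hatU (U i) a)) - ε / (m + 1)) ≤
      ∑ i ∈ Finset.range m, (w / N * v i * a i - hatU (U i) (a i)) :=
    Finset.sum_le_sum fun i _ => (ha i).le
  rw [Finset.sum_sub_distrib] at h2
  simp only [Finset.sum_const, Finset.card_range, nsmul_eq_mul] at h2
  have h3 : (m : ℝ) * (ε / (m + 1)) ≤ ε := by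
    rw [← mul_div_assoc, div_le_iff₀ (by positivity)]
    nlinarith
  linarith

/-- Chernoff's inequality at λ = w/(32𝒩_w(v)): the moment is at most e^w and the level 64𝒩_w(v)
contributes e^{-2w}. -/
lemma measure_partialSum_ge {w : ℝ} (hw : 0 < w) {v : Ell2} (hN : 0 < normN U w v) (m : ℕ) :
    μ.real {ω | 64 * normN U w v ≤ partialSum Y v m ω} ≤ Real.exp (-w) := by
  obtain ⟨M, hM, hsum⟩ := exists_conjugate_bounds h.young hw v hN m
  set N := normN U w v with hNdef
  set l := w / N / 32 with hl
  have hl0 : 0 ≤ l := by positivity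
  have hterm : ∀ i < m, Integrable (fun ω => Real.exp (l * (v i * Y i ω))) μ ∧
      mgf (fun ω => v i * Y i ω) μ l ≤ Real.exp (M i) := by
    intro i hi
    obtain ⟨h1, h2⟩ := (h.symm i).mgf_le (hM i hi)
    have e1 : ∀ ω, l * (v i * Y i ω) = w / N * v i / 32 * Y i ω := by
      intro ω; rw [hl]; ring
    refine ⟨by simpa only [e1] using h1, ?_⟩
    have e2 : mgf (fun ω => v i * Y i ω) μ l = mgf (Y i) μ (w / N * v i / 32) := by
      unfold mgf; simp only [e1]
    rw [e2]; exact h2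
  have e3 : (∑ i ∈ Finset.range m, fun ω => v i * Y i ω) = partialSum Y v m := by
    ext ω; simp [partialSum]
  have hint := (h.indep_term v).integrable_exp_mul_sum (h.measurable_term v) (t := l)
    (s := Finset.range m) fun i hi => (hterm i (Finset.mem_range.1 hi)).1
  have hmgf := (h.indep_term v).mgf_sum (h.measurable_term v) (t := l) (Finset.range m)
  rw [e3] at hint hmgf
  have h1 := measure_ge_le_exp_mul_mgf (μ := μ) (64 * N) hl0 hint
  refine h1.trans ?_
  have h2 : mgf (partialSum Y v m) μ l ≤ Real.exp w := by
    rw [hmgf]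
    calc ∏ i ∈ Finset.range m, mgf (fun ω => v i * Y i ω) μ l
        ≤ ∏ i ∈ Finset.range m, Real.exp (M i) :=
          Finset.prod_le_prod (fun i _ => mgf_nonneg) fun i hi =>
            (hterm i (Finset.mem_range.1 hi)).2
      _ = Real.exp (∑ i ∈ Finset.range m, M i) := (Real.exp_sum _ _).symm
      _ ≤ _ := Real.exp_le_exp.2 hsum
  have h3 : -l * (64 * N) = -(2 * w) := by rw [hl]; field_simp; norm_num
  rw [h3]
  calc Real.exp (-(2 * w)) * mgf (partialSum Y v m) μ l ≤ Real.exp (-(2 * w)) * Real.exp w := by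
        gcongr
    _ = _ := by rw [← Real.exp_add]; congr 1; ring

lemma measure_partialSum_abs_ge {w : ℝ} (hw : 0 < w) {v : Ell2} (hN : 0 < normN U w v) (m : ℕ) :
    μ {ω | 64 * normN U w v ≤ |partialSum Y v m ω|} ≤ ENNReal.ofReal (2 * Real.exp (-w)) := by
  have hneg : normN U w (-v) = normN U w v := h.young.normN_neg hw.le v
  have h1 := h.measure_partialSum_ge hw hN m
  have h2 := h.measure_partialSum_ge hw (v := -v) (by rwa [hneg]) m
  rw [hneg] at h2
  have hsub : {ω | 64 * normN U w v ≤ |partialSum Y v m ω|} ⊆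
      {ω | 64 * normN U w v ≤ partialSum Y v m ω} ∪
      {ω | 64 * normN U w v ≤ partialSum Y (-v) m ω} := by
    intro ω hω
    have e : partialSum Y (-v) m ω = -partialSum Y v m ω := by simp [partialSum]
    rcases le_abs.1 (show 64 * normN U w v ≤ |partialSum Y v m ω| from hω) with h3 | h3
    · exact Or.inl h3
    · right
      change _ ≤ partialSum Y (-v) m ω
      rw [e]; exact h3
  refine (measure_mono hsub).trans ((measure_union_le _ _).trans ?_)
  rw [two_mul, ENNReal.ofReal_add (Real.exp_pos _).le (Real.exp_pos _).le, ← ofReal_measureReal,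
    ← ofReal_measureReal]
  exact add_le_add (ENNReal.ofReal_le_ofReal h1) (ENNReal.ofReal_le_ofReal h2)

/-- The tail bound `P(|X_v| > 64 𝒩_w(v)) ≤ 2 e^{-w}`. -/
lemma measure_process_gt {w : ℝ} (hw : 0 < w) (v : Ell2) :
    μ {ω | 64 * normN U w v < |process Y v ω|} ≤ ENNReal.ofReal (2 * Real.exp (-w)) := by
  rcases eq_or_ne v 0 with rfl | hv
  · have h0 : ∀ ω, process Y 0 ω = 0 := by
      intro ω
      have : (fun m : ℕ => ∑ i ∈ Finset.range m, (0 : Ell2) i * Y i ω) = fun _ => 0 := by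
        ext m; simp
      unfold process
      rw [this]
      exact tendsto_const_nhds.limUnder_eq
    have h1 : {ω | 64 * normN U w 0 < |process Y 0 ω|} = ∅ := by
      ext ω
      simp only [h0, abs_zero, Set.mem_ofPred_eq, Set.mem_empty_iff_false, iff_false, not_lt]
      have := h.young.normN_nonneg hw.le 0
      positivity
    rw [h1, measure_empty]; exact bot_le
  · have hN := h.young.normN_pos hw hv
    set A : ℕ → Set Ω := fun k => ⋂ m ≥ k, {ω | 64 * normN U w v ≤ |partialSum Y v m ω|} with hA
    have hmono : Monotone A := by
      intro k l hkl ω hω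
      simp only [hA, Set.mem_iInter] at hω ⊢
      exact fun m hm => hω m (hkl.trans hm)
    have hsub : {ω | 64 * normN U w v < |process Y v ω|} ≤ᵐ[μ] ⋃ k, A k := by
      filter_upwards [h.tendsto_process v] with ω hω hlt
      have h1 := hω.abs.eventually (lt_mem_nhds (show 64 * normN U w v < |process Y v ω| from hlt))
      obtain ⟨k, hk⟩ := eventually_atTop.1 h1
      refine Set.mem_iUnion.2 ⟨k, ?_⟩
      simp only [hA, Set.mem_iInter]
      exact fun m hm => (hk m hm).le
    refine (measure_mono_ae hsub).trans ?_
    rw [hmono.measure_iUnion]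
    refine iSup_le fun k => (measure_mono ?_).trans (h.measure_partialSum_abs_ge hw hN k)
    intro ω hω
    simp only [hA, Set.mem_iInter] at hω
    exact hω k le_rfl

end IsCanonical

end Canonical

/-! ### Chaining -/

lemma bigN_succ_le_exp (n : ℕ) : (bigN (n + 1) : ℝ) ≤ Real.exp (1.4 * 2 ^ n) := by
  have h1 : (bigN (n + 1) : ℝ) = Real.exp (Real.log 2 * (2 * 2 ^ n)) := by
    rw [Real.exp_mul, Real.exp_log (by norm_num)]
    unfold bigN
    push_cast
    rw [pow_succ, mul_comm (2 ^ n) 2, ← Real.rpow_natCast]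
    norm_num
  rw [h1, Real.exp_le_exp]
  have h2 := Real.log_two_lt_d9
  have h3 : (0 : ℝ) < 2 ^ n := by positivity
  nlinarith

/-- The closing inequality of the union bound: the factor N_{n+1} ≤ e^{1.4·2^n} is absorbed and the
bound for level n + 1 becomes the one for level n. -/
lemma bigN_mul_exp_le {u : ℝ} (hu : 1 ≤ u) (n : ℕ) :
    (bigN (n + 1) : ℝ) * (2 * Real.exp (-(8 * u * 2 ^ n)) + 4 * Real.exp (-(3 * u * 2 ^ (n + 1)))) ≤
      4 * Real.exp (-(3 * u * 2 ^ n)) := by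
  have h2 : (1 : ℝ) ≤ 2 ^ n := one_le_pow₀ (by norm_num)
  set y := u * 2 ^ n with hy
  have hy1 : 1 ≤ y := one_le_mul_of_one_le_of_one_le hu h2
  have e1 : 3 * u * 2 ^ (n + 1) = 6 * y := by rw [hy, pow_succ]; ring
  have e2 : 8 * u * 2 ^ n = 8 * y := by rw [hy]; ring
  have e3 : 3 * u * 2 ^ n = 3 * y := by rw [hy]; ring
  rw [e1, e2, e3]
  have h3 : (bigN (n + 1) : ℝ) ≤ Real.exp (1.4 * y) :=
    (bigN_succ_le_exp n).trans (Real.exp_le_exp.2 (by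
      have : (2 : ℝ) ^ n ≤ y := le_mul_of_one_le_left (by positivity) hu
      linarith))
  have h4 : Real.exp (-(8 * y)) ≤ Real.exp (-(6 * y)) := Real.exp_le_exp.2 (by linarith)
  have h5 : 1.5 ≤ Real.exp (1.6 * y) := by
    have := Real.add_one_le_exp (1.6 * y); linarith
  calc (bigN (n + 1) : ℝ) * (2 * Real.exp (-(8 * y)) + 4 * Real.exp (-(6 * y)))
      ≤ Real.exp (1.4 * y) * (6 * Real.exp (-(6 * y))) := by
        refine mul_le_mul h3 (by linarith) (by positivity) (Real.exp_pos _).le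
    _ = 6 * Real.exp (-(4.6 * y)) := by rw [mul_left_comm, ← Real.exp_add]; congr 2; ring
    _ ≤ 4 * (Real.exp (1.6 * y) * Real.exp (-(4.6 * y))) := by
        have := mul_le_mul_of_nonneg_right h5 (Real.exp_pos (-(4.6 * y))).le
        linarith
    _ = _ := by rw [← Real.exp_add]; congr 2; ring

section Chaining

variable {Ω : Type*} [MeasurableSpace Ω] {μ : Measure Ω} [IsProbabilityMeasure μ]
  {Y : ℕ → Ω → ℝ} {U : ℕ → ℝ → ℝ} {C θ r : ℝ} {P R : Finset Ell2 → ℕ → ℤ → Finset Ell2}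

/-- The event that an increment is large. -/
def jumpEvent (Y : ℕ → Ω → ℝ) (c : ℝ) (p z : Ell2) : Set Ω :=
  {ω | c < |process Y p ω - process Y z ω|}

/-- The sum of the weights over `k + 1` steps of a trajectory. -/
noncomputable def trajSum (U : ℕ → ℝ → ℝ) (r : ℝ) (P R : Finset Ell2 → ℕ → ℤ → Finset Ell2)
    (t : Ell2) (k n : ℕ) (s : ChainState Ell2) : ℝ :=
  ∑ i ∈ Finset.range (k + 1), weight r (n + i) (traj (scaleNorm U) r P R t i n s)

lemma trajSum_succ (t : Ell2) (k n : ℕ) (s : ChainState Ell2) :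
    trajSum U r P R t (k + 1) n s = weight r n s +
      trajSum U r P R t k (n + 1) (nextState (scaleNorm U) r P R t n s) := by
  unfold trajSum
  rw [Finset.sum_range_succ', add_comm]
  congr 1
  refine Finset.sum_congr rfl fun i _ => ?_
  rw [traj]
  congr 1
  omega

/-- The tail bound at w = 8u2^n with 𝒩_w ≤ 8uN_n; hence 2048 = 64 · 8 · 4. -/
lemma IsCanonical.measure_jumpEvent (h : IsCanonical μ Y U C) {u : ℝ} (hu : 1 ≤ u) {n : ℕ}
    {p z : Ell2} {x : ℝ} (hx : scaleNorm U n (p - z) ≤ 4 * x) :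
    μ (jumpEvent Y (2048 * u * x) p z) ≤ ENNReal.ofReal (2 * Real.exp (-(8 * u * 2 ^ n))) := by
  refine le_trans (measure_mono_ae ?_) (h.measure_process_gt (w := 8 * u * 2 ^ n) (by positivity) (p - z))
  filter_upwards [h.process_sub p z] with ω hω hlt
  have h1 : normN U (8 * u * 2 ^ n) (p - z) ≤ 8 * u * scaleNorm U n (p - z) :=
    h.young.normN_mul_le (by linarith) (by positivity) _
  change _ < |process Y (p - z) ω|
  rw [hω]
  have h2 : 2048 * u * x < |process Y p ω - process Y z ω| := hlt
  nlinarith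

/-- The probability that the increments along the trajectories starting at a given state are
large. -/
lemma IsCanonical.measure_chain (h : IsCanonical μ Y U C) (hN : IsScaleNorm (scaleNorm U) θ)
    (hr : 0 < r) (hS : IsSplitting (scaleNorm U) r P R) {u : ℝ} (hu : 1 ≤ u) (k : ℕ) :
    ∀ (n : ℕ) (s : ChainState Ell2), s.Valid (scaleNorm U) r n → s.D.card ≤ bigN (n + k + 1) →
      μ {ω | ∃ t ∈ s.D, 2048 * u * trajSum U r P R t k n s < |process Y t ω - process Y s.z ω|} ≤
        ENNReal.ofReal (4 * Real.exp (-(3 * u * 2 ^ n))) := by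
  induction k with
  | zero =>
    intro n s hs hcard
    -- Here D has at most N_{n+1} points, and the chain goes from the centre directly to each of
    -- them.
    have hsub : {ω | ∃ t ∈ s.D, 2048 * u * trajSum U r P R t 0 n s <
        |process Y t ω - process Y s.z ω|} ⊆
        ⋃ t ∈ s.D, jumpEvent Y (2048 * u * weight r n s) t s.z := by
      rintro ω ⟨t, ht, hlt⟩
      refine Set.mem_iUnion₂.2 ⟨t, ht, ?_⟩
      simpa [trajSum, traj, jumpEvent] using hlt
    refine (measure_mono hsub).trans ((measure_biUnion_finset_le _ _).trans ?_)
    refine (Finset.sum_le_sum fun t ht => h.measure_jumpEvent hu (hs t ht)).trans ?_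
    rw [Finset.sum_const, nsmul_eq_mul, ← ENNReal.ofReal_natCast,
      ← ENNReal.ofReal_mul (Nat.cast_nonneg _)]
    apply ENNReal.ofReal_le_ofReal
    refine le_trans ?_ (bigN_mul_exp_le hu n)
    have h1 : (s.D.card : ℝ) ≤ bigN (n + 1) := by exact_mod_cast hcard
    have h2 := Real.exp_pos (-(3 * u * 2 ^ (n + 1)))
    refine mul_le_mul h1 (by linarith) (by positivity) (by positivity)
  | succ k ih =>
    intro n s hs hcard
    set a := ENNReal.ofReal (2 * Real.exp (-(8 * u * 2 ^ n))) with ha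
    set b := ENNReal.ofReal (4 * Real.exp (-(3 * u * 2 ^ (n + 1)))) with hb
    let bad : ChainState Ell2 → Set Ω := fun s' => {ω | ∃ t ∈ s'.D,
      2048 * u * trajSum U r P R t k (n + 1) s' < |process Y t ω - process Y s'.z ω|}
    have hsub : {ω | ∃ t ∈ s.D, 2048 * u * trajSum U r P R t (k + 1) n s <
        |process Y t ω - process Y s.z ω|} ⊆
        (⋃ p ∈ P s.D n s.j, (jumpEvent Y (2048 * u * weight r n s) p s.z ∪
          bad (piece (scaleNorm U) r n s p))) ∪ bad (restState R n s) := by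
      rintro ω ⟨t, ht, hlt⟩
      rw [trajSum_succ, mul_add] at hlt
      -- In a piece the chain moves to the new centre p. The remainder keeps its centre, so there is
      -- no increment to control.
      rcases nextState_cases hS (n := n) ht with ⟨p, hp, h1, h2⟩ | ⟨h1, h2⟩
      · left
        refine Set.mem_iUnion₂.2 ⟨p, hp, ?_⟩
        rw [h1] at hlt
        by_contra hcon
        rw [Set.mem_union, not_or] at hcon
        have h3 : |process Y p ω - process Y s.z ω| ≤ 2048 * u * weight r n s :=
          not_lt.1 hcon.1
        have h4 : |process Y t ω - process Y p ω| ≤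
            2048 * u * trajSum U r P R t k (n + 1) (piece (scaleNorm U) r n s p) := by
          by_contra hlt'
          exact hcon.2 ⟨t, h2, not_le.1 hlt'⟩
        have h5 := abs_sub_le (process Y t ω) (process Y p ω) (process Y s.z ω)
        linarith
      · right
        rw [h1] at hlt
        refine ⟨t, h2, lt_of_le_of_lt ?_ hlt⟩
        have := weight_pos hr n s
        have h3 : 0 ≤ 2048 * u * weight r n s := by positivity
        linarith
    have hpiece : ∀ p ∈ P s.D n s.j, μ (jumpEvent Y (2048 * u * weight r n s) p s.z ∪
        bad (piece (scaleNorm U) r n s p)) ≤ a + b := by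
      intro p hp
      refine (measure_union_le _ _).trans (add_le_add
        (h.measure_jumpEvent hu (hs p (hS.subset _ _ _ hp)))
        (ih (n + 1) _ (piece_valid hr n s p) ?_))
      classical
      refine le_trans (Finset.card_le_card (Finset.filter_subset _ _)) (hcard.trans_eq ?_)
      congr 1; omega
    have hrest : μ (bad (restState R n s)) ≤ b := by
      refine ih (n + 1) _ (restState_valid hN hS hs) ?_
      refine le_trans (Finset.card_le_card (hS.rest_subset _ _ _)) (hcard.trans_eq ?_)
      congr 1; omega
    calc μ _ ≤ μ (⋃ p ∈ P s.D n s.j, (jumpEvent Y (2048 * u * weight r n s) p s.z ∪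
          bad (piece (scaleNorm U) r n s p))) + μ (bad (restState R n s)) :=
          (measure_mono hsub).trans (measure_union_le _ _)
      -- The remainder is counted like a piece; fewer than N_{n+1} centres leave room for it.
      _ ≤ ∑ p ∈ P s.D n s.j, (a + b) + (a + b) := by
          refine add_le_add ((measure_biUnion_finset_le _ _).trans (Finset.sum_le_sum hpiece)) ?_
          exact hrest.trans le_add_self
      _ = ((P s.D n s.j).card + 1 : ℕ) * (a + b) := by
          rw [Finset.sum_const, nsmul_eq_mul]; push_cast; ring
      _ ≤ (bigN (n + 1) : ℕ) * (a + b) := by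
          gcongr
          exact hS.card_lt s.D n s.j
      _ ≤ _ := by
          rw [ha, hb, ← ENNReal.ofReal_add (by positivity) (by positivity),
            ← ENNReal.ofReal_natCast, ← ENNReal.ofReal_mul (Nat.cast_nonneg _)]
          exact ENNReal.ofReal_le_ofReal (bigN_mul_exp_le hu n)

/-- The expected maximum of the process over a finite set, bounded along the trajectories. -/
lemma IsCanonical.integral_sup_le (h : IsCanonical μ Y U C) (hN : IsScaleNorm (scaleNorm U) θ)
    (hr : 0 < r) (hS : IsSplitting (scaleNorm U) r P R) {F : Finset Ell2} (hF : F.Nonempty)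
    {j : ℤ} {z : Ell2} (hz : z ∈ F)
    (hs : (⟨F, j, z⟩ : ChainState Ell2).Valid (scaleNorm U) r 0) {A : ℝ} (hA : 0 < A)
    (hsum : ∀ t ∈ F, trajSum U r P R t F.card 0 ⟨F, j, z⟩ ≤ A) :
    ∫ ω, F.sup' hF (fun t => process Y t ω) ∂μ ≤ 2 ^ 18 * A := by
  set Z : Ω → ℝ := fun ω => F.sup' hF (fun t => |process Y t ω - process Y z ω|) with hZ
  have hX : ∀ t, Integrable (process Y t) μ := fun t => (h.process_integrable_and_mean t).1
  -- a measurable modification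
  choose X' hX'm hX'e using fun t => (h.aestronglyMeasurable_process t)
  set Z' : Ω → ℝ := fun ω => F.sup' hF (fun t => |X' t ω - X' z ω|) with hZ'
  have hZ'm : Measurable Z' := by
    have : Z' = F.sup' hF (fun t => fun ω => |X' t ω - X' z ω|) := by
      ext ω; simp [hZ']
    rw [this]
    exact Finset.measurable_sup' hF fun t _ =>
      ((hX'm t).measurable.sub (hX'm z).measurable).abs
  have hall : ∀ᵐ ω ∂μ, ∀ t ∈ F, process Y t ω = X' t ω :=
    (Finset.eventually_all F).2 fun t _ => hX'e t
  have hZZ' : Z =ᵐ[μ] Z' := by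
    filter_upwards [hall] with ω hω
    exact Finset.sup'_congr hF rfl fun t ht => by rw [hω t ht, hω z hz]
  -- The extra factor 2 turns the weak inequality in the tail of Z' into the strict one of the
  -- chaining event.
  set B := 2 * (2048 * A) with hB
  have hB0 : 0 < B := by positivity
  have htail : ∀ x, 1 ≤ x → μ.real {ω | x ≤ |Z' ω / B|} ≤ 4 * Real.exp (-(3 * x)) := by
    intro x hx
    have h1 := h.measure_chain hN hr hS hx F.card 0 ⟨F, j, z⟩ hs
      (by simpa using ((Nat.lt_succ_self _).trans (lt_bigN (F.card + 1))).le)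
    refine ENNReal.toReal_le_of_le_ofReal (by positivity) (le_trans (measure_mono_ae ?_)
      (h1.trans_eq (by rw [pow_zero, mul_one])))
    filter_upwards [hZZ'] with ω hω hle
    have h2 : x ≤ |Z' ω / B| := hle
    have hnn : 0 ≤ Z' ω := by
      refine le_trans (abs_nonneg (X' z ω - X' z ω)) ?_
      exact Finset.le_sup' (fun t => |X' t ω - X' z ω|) hz
    rw [abs_of_nonneg (by positivity), le_div_iff₀ hB0, ← hω] at h2
    obtain ⟨t, ht, hmax⟩ := Finset.exists_mem_eq_sup' hF (fun t => |process Y t ω - process Y z ω|)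
    refine ⟨t, ht, ?_⟩
    have h3 : Z ω = |process Y t ω - process Y z ω| := hmax
    change _ < |process Y t ω - process Y z ω|
    rw [← h3]
    have h4 := hsum t ht
    have h5 : 2048 * x * trajSum U r P R t F.card 0 ⟨F, j, z⟩ ≤ 2048 * x * A := by gcongr
    have h6 : 0 < x * A := by positivity
    have h7 : x * B = 4096 * (x * A) := by rw [hB]; ring
    linarith
  obtain ⟨h1, h2⟩ := integrable_exp_of_tail (μ := μ) (hZ'm.div_const B) (s := 1) (β := 3) (B := 4)
    (by norm_num) (by norm_num) (by norm_num) htail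
  have hZ'le : ∀ ω, Z' ω ≤ B * Real.exp (1 * |Z' ω / B|) := by
    intro ω
    have h3 := Real.add_one_le_exp (1 * |Z' ω / B|)
    have h4 := le_abs_self (Z' ω / B)
    have h5 : Z' ω = B * (Z' ω / B) := by field_simp
    rw [h5]
    refine (mul_le_mul_of_nonneg_left ?_ hB0.le)
    rw [mul_div_cancel_left₀ _ hB0.ne']
    linarith
  have hpt : (fun ω => F.sup' hF (fun t => process Y t ω)) ≤ᵐ[μ]
      fun ω => process Y z ω + B * Real.exp (1 * |Z' ω / B|) := by
    filter_upwards [hZZ'] with ω hω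
    refine Finset.sup'_le hF _ fun t ht => ?_
    have h3 : |process Y t ω - process Y z ω| ≤ Z ω :=
      Finset.le_sup' (fun t => |process Y t ω - process Y z ω|) ht
    rw [hω] at h3
    have h4 := hZ'le ω
    have h5 := le_abs_self (process Y t ω - process Y z ω)
    linarith
  have hsupint : Integrable (fun ω => F.sup' hF (fun t => process Y t ω)) μ := by
    have : (fun ω => F.sup' hF (fun t => process Y t ω)) = F.sup' hF (fun t => process Y t) := by
      ext ω; simp
    rw [this]
    exact Finset.sup'_induction (p := fun f : Ω → ℝ => Integrable f μ) hF _ (fun f hf g hg => hf.sup hg) fun t _ => hX t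
  have h3 := integral_mono_ae hsupint ((hX z).add (h1.const_mul B)) hpt
  refine h3.trans ?_
  have h4 : ∫ ω, (process Y z + fun ω => B * Real.exp (1 * |Z' ω / B|)) ω ∂μ =
      B * ∫ ω, Real.exp (1 * |Z' ω / B|) ∂μ := by
    simp only [Pi.add_apply]
    rw [integral_add (hX z) (h1.const_mul B), (h.process_integrable_and_mean z).2, zero_add,
      integral_const_mul]
  rw [h4]
  have h5 : Real.exp 1 * (1 + 2 * 4) ≤ 64 := by
    have := Real.exp_one_lt_d9; linarith
  calc B * ∫ ω, Real.exp (1 * |Z' ω / B|) ∂μ ≤ B * 64 :=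
        mul_le_mul_of_nonneg_left (h2.trans h5) hB0.le
    _ = 2 ^ 18 * A := by rw [hB]; ring

end Chaining

/-! ### The upper bound -/

lemma IsYoungFamily.mono {U : ℕ → ℝ → ℝ} {C C' : ℝ} (hU : IsYoungFamily U C) (h : C ≤ C') :
    IsYoungFamily U C' :=
  ⟨hU.convex, hU.zero, hU.one, fun i s hs => (hU.doubling i s hs).trans
    (mul_le_mul_of_nonneg_right h ((zero_le_one.trans hs).trans (hU.self_le i hs)))⟩

/-- The bound of the expected supremum by the size, for families with doubling constant `r`. -/
lemma exists_expSup_le_size (r : ℝ) (hr : 4 ≤ r) : ∃ K : ℝ≥0,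
    ∀ (Ω : Type*) [MeasurableSpace Ω] (μ : Measure Ω) [IsProbabilityMeasure μ]
      (Y : ℕ → Ω → ℝ) (U : ℕ → ℝ → ℝ) (T : Set Ell2), IsCanonical μ Y U r →
      expSup μ (process Y) T ≤ K * size U r T := by
  have hr0 : 0 < r := by linarith
  have hr1 : 1 < r := by linarith
  obtain ⟨h, hh1, hh⟩ : ∃ h : ℕ, 1 ≤ h ∧ 8 * r ≤ 2 ^ h := by
    obtain ⟨m, hm⟩ := pow_unbounded_of_one_lt (8 * r) (one_lt_two)
    exact ⟨m + 1, by omega, hm.le.trans (pow_le_pow_right₀ (by norm_num) (by omega))⟩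
  set θ : ℝ := (2 : ℝ) ^ (1 / (h : ℝ)) with hθ
  set α := √θ with hα
  have hθ1 : 1 < θ := Real.one_lt_rpow (by norm_num) (by positivity)
  have hθ2 : θ ≤ 2 := by
    calc θ ≤ (2 : ℝ) ^ (1 : ℝ) := Real.rpow_le_rpow_of_exponent_le (by norm_num)
          (by rw [div_le_one (by positivity)]; exact_mod_cast hh1)
      _ = 2 := Real.rpow_one 2
  have hαθ : α ^ 2 = θ := Real.sq_sqrt (by linarith)
  have hα1 : 1 < α := by
    rw [hα, Real.lt_sqrt (by norm_num)]; linarith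
  -- As α² = θ ≤ 2, one has 2α ≤ 2√2 < 4.
  have hα2 : 2 * α < r := by nlinarith
  obtain ⟨e, he1, he⟩ : ∃ e : ℕ, 1 ≤ e ∧ 16 * r * α ^ e ≤ (α ^ 2) ^ e := by
    obtain ⟨m, hm⟩ := pow_unbounded_of_one_lt (16 * r) hα1
    refine ⟨m + 1, by omega, ?_⟩
    rw [← pow_mul, mul_comm 2, pow_mul, sq]
    refine mul_le_mul_of_nonneg_right ?_ (by positivity)
    exact hm.le.trans (pow_le_pow_right₀ hα1.le (by omega))
  set q := θ⁻¹ with hq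
  set κ := 2 * q / (1 - q) with hκ
  set K₀ : ℝ≥0 := Real.toNNReal (2 / (1 - α⁻¹)) * (Real.toNNReal r * (e + 2)) *
    Real.toNNReal (2 * (1 + κ)) with hK₀
  -- The summand 1 keeps the constant positive, so that its product with an infinite size is
  -- infinite.
  refine ⟨2 ^ 18 * K₀ + 1, ?_⟩
  intro Ω _ μ _ Y U T hY
  have hU := hY.young
  have hN : IsScaleNorm (scaleNorm U) θ := hU.isScaleNorm hh1 hh
  have hN' : IsScaleNorm (scaleNorm U) (α ^ 2) := by rwa [hαθ]
  rcases eq_or_ne (size U r T) ⊤ with htop | htop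
  · rw [htop, ENNReal.mul_top (by simp)]; exact le_top
  refine iSup_le fun F => iSup_le fun hF => iSup_le fun hFT => ?_
  rcases le_or_gt F.card 1 with hcard | hcard
  · obtain ⟨a, rfl⟩ := Finset.card_eq_one.1 (le_antisymm hcard (Finset.card_pos.2 hF))
    simp [(hY.process_integrable_and_mean a).2]
  obtain ⟨j, hj1, hj2⟩ := exists_root_scale hN' hr1 hcard
  obtain ⟨P, R, hS⟩ := exists_isSplitting hN hr0
  obtain ⟨z, hz⟩ := hF
  have hs : (⟨F, j, z⟩ : ChainState Ell2).Valid (scaleNorm U) r 0 := by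
    intro t ht
    simpa [weight] using hj1 t ht z hz
  have hfree : freeValue (scaleNorm U) r F 0 ≤ ENNReal.ofReal (2 * (1 + κ)) * size U r T :=
    iSup₂_le fun y hy => Tree.ofReal_le_size hU hN hr1 hq hκ hFT ⟨z, hz⟩
      (hy.mono subset_rfl (fun _ _ _ => trivial) le_rfl)
  have hbound : ∀ t ∈ F, ENNReal.ofReal (trajSum U r P R t F.card 0 ⟨F, j, z⟩) ≤
      K₀ * size U r T := by
    intro t ht
    have h1 := sum_traj_le hN' hα1 hα2 hS he1 he (s := ⟨F, j, z⟩) ht hs (F.card + 1)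
    unfold trajSum
    simp only [zero_add]
    rw [ENNReal.ofReal_sum_of_nonneg fun k _ => (weight_pos hr0 _ _).le]
    refine h1.trans ?_
    calc _ ≤ ENNReal.ofReal (2 / (1 - α⁻¹)) *
          (ENNReal.ofReal r * freeValue (scaleNorm U) r F 0 +
            ENNReal.ofReal r * ((e + 1 : ℕ) * freeValue (scaleNorm U) r F 0)) := by
          gcongr
      _ = ENNReal.ofReal (2 / (1 - α⁻¹)) * (ENNReal.ofReal r * (e + 2)) *
          freeValue (scaleNorm U) r F 0 := by push_cast; ring
      _ ≤ ENNReal.ofReal (2 / (1 - α⁻¹)) * (ENNReal.ofReal r * (e + 2)) *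
          (ENNReal.ofReal (2 * (1 + κ)) * size U r T) := by gcongr
      _ = _ := by rw [hK₀]; push_cast; simp only [ENNReal.ofReal]; ring
  have hfin : (K₀ : ℝ≥0∞) * size U r T ≠ ⊤ := ENNReal.mul_ne_top ENNReal.coe_ne_top htop
  set A := ((K₀ : ℝ≥0∞) * size U r T).toReal with hA
  have hle : ∀ t ∈ F, trajSum U r P R t F.card 0 ⟨F, j, z⟩ ≤ A := fun t ht =>
    (ENNReal.ofReal_le_iff_le_toReal hfin).1 (hbound t ht)
  have hA0 : 0 < A := by
    refine lt_of_lt_of_le ?_ (hle z hz)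
    exact Finset.sum_pos (fun i _ => weight_pos hr0 _ _) ⟨0, by simp⟩
  have hmain := hY.integral_sup_le hN hr0 hS ⟨z, hz⟩ hz hs hA0 hle
  calc ENNReal.ofReal (∫ ω, F.sup' ⟨z, hz⟩ (fun t => process Y t ω) ∂μ)
      ≤ ENNReal.ofReal (2 ^ 18 * A) := ENNReal.ofReal_le_ofReal hmain
    _ = 2 ^ 18 * (K₀ * size U r T) := by
        rw [ENNReal.ofReal_mul (by positivity), hA, ENNReal.ofReal_toReal hfin]
        congr 1
        rw [ENNReal.ofReal_pow (by norm_num)]; norm_num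
    _ ≤ (2 ^ 18 * K₀ + 1 : ℝ≥0) * size U r T := by
        push_cast
        rw [add_mul, mul_assoc]
        exact le_self_add

/-- The tail functions of independent symmetric random variables. -/
lemma isCanonical_tailFun {Ω : Type*} [MeasurableSpace Ω] {μ : Measure Ω} [IsProbabilityMeasure μ]
    {Y : ℕ → Ω → ℝ} {C₀ : ℝ} (hmeas : ∀ i, Measurable (Y i)) (hind : iIndepFun Y μ)
    (hsymm : ∀ i, IdentDistrib (Y i) (fun ω => -Y i ω) μ μ)
    (hconv : ∀ i, ConvexOn ℝ (Set.Ici 0) (tailFun μ Y i)) (hone : ∀ i, tailFun μ Y i 1 = 1)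
    (hdoub : ∀ i, ∀ s : ℝ, 1 ≤ s → tailFun μ Y i (2 * s) ≤ C₀ * tailFun μ Y i s) :
    IsCanonical μ Y (tailFun μ Y) C₀ := by
  have hY : IsYoungFamily (tailFun μ Y) C₀ := by
    refine ⟨hconv, fun i => ?_, hone, hdoub⟩
    simp [tailFun]
  refine ⟨hY, fun i => ⟨hmeas i, hsymm i, fun x => ?_, fun x hx => hY.self_le i hx⟩, hind⟩
  unfold tailFun
  rw [neg_neg]
  exact Real.le_exp_log _

end CanonicalProcess

theorem mainTheorem4 :
    ∃ (r₀ : ℝ → ℝ) (K : ℝ → ℝ≥0),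
      ∀ (Ω : Type*) [MeasurableSpace Ω] (μ : Measure Ω) [IsProbabilityMeasure μ]
        (Y : ℕ → Ω → ℝ) (C₀ r : ℝ) (T : Set CanonicalProcess.Ell2),
        (∀ i, Measurable (Y i)) →
        iIndepFun Y μ →
        (∀ i, IdentDistrib (Y i) (fun ω => -Y i ω) μ μ) →
        (∀ i, ConvexOn ℝ (Set.Ici 0) (CanonicalProcess.tailFun μ Y i)) →
        (∀ i, CanonicalProcess.tailFun μ Y i 1 = 1) →
        (∀ i, ∀ s : ℝ, 1 ≤ s →
          CanonicalProcess.tailFun μ Y i (2 * s) ≤ C₀ * CanonicalProcess.tailFun μ Y i s) →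
        (∀ i, 1 / C₀ ≤ derivWithin (CanonicalProcess.tailFun μ Y i) (Set.Ioi 0) 0) →
        r₀ C₀ ≤ r →
        CanonicalProcess.expSup μ (CanonicalProcess.process Y) T ≤
          K r * CanonicalProcess.size (CanonicalProcess.tailFun μ Y) r T := by
  classical
  -- For r ≥ C₀ the number r itself serves as doubling constant, so that all constants depend on r
  -- alone.
  refine ⟨fun C₀ => max 4 C₀, fun r => if hr : 4 ≤ r then
    (CanonicalProcess.exists_expSup_le_size r hr).choose else 0, ?_⟩
  intro Ω _ μ _ Y C₀ r T hmeas hind hsymm hconv hone hdoub _ hr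
  have hr4 : 4 ≤ r := (le_max_left _ _).trans hr
  have hY := CanonicalProcess.isCanonical_tailFun hmeas hind hsymm hconv hone hdoub
  simp only [dif_pos hr4]
  exact (CanonicalProcess.exists_expSup_le_size r hr4).choose_spec Ω μ Y _ T
    ⟨hY.young.mono ((le_max_right _ _).trans hr), hY.symm, hY.indep⟩
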